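/- **Capacity-achieving codes over the binary-input AWGN channel have flat EXIT curves.** For $\gamma\ge 0$ let $I_2(\gamma)$ be the mutual information, in bits, between an equiprobable $X\in\{+1,-1\}$ and $\sqrt\gamma\,X+N$, where $N\sim\mathcal N(0,1)$ is independent of $X$. For a nonempty binary code $\mathbf C\subseteq\{+1,-1\}^n$, let $\vec X$ be uniform on $\mathbf C$ and let $Y_i=\sqrt\gamma\,X_i+N_i$ with i.i.d. noise $N_i\sim\mathcal N(0,1)$ independent of $\vec X$. Its rate is $\frac1n\log_2|\mathbf C|$, and its extrinsic LLRs at a priori SNR $\gamma$ are $$L_{ext}(X_i)=\log\frac{P(X_i=1\mid Y_j,\ j\ne i)}{P(X_i=-1\mid Y_j,\ j\ne i)}\in[-\infty,\infty].$$ Its extrinsic information at a priori SNR $\gamma$ is $\frac1n\sum_{i=1}^n I(X_i;L_{ext}(X_i))$, in bits. Its EXIT curve is this quantity as a function of the a priori information $a=I_2(\gamma)\in[0,1)$. Let $SNR>0$ and let $(\mathbf C_k)$ be a capacity-achieving sequence of binary codes of lengths $n_k$ and rate $R=I_2(SNR)$: the rates of the $\mathbf C_k$ tend to $R$, and for every $\gamma>SNR$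 there are decoders for which the block error probability (averaged over the codewords) over the AWGN channel with signal to noise ratio $\gamma$ tends to $0$. Then, as $k\to\infty$: 1. The bits are equiprobable: $\frac1{n_k}\sum_{i=1}^{n_k}\left|P(X_i=1)-\tfrac12\right|\to0$. 2. For $0\le\gamma<SNR$ the extrinsic LLRs are zero: $\frac1{n_k}\sum_{i=1}^{n_k}P\left(|L_{ext}(X_i)|>\varepsilon\right)\to0$ for every $\varepsilon>0$; and $\frac1{n_k}\sum_{i=1}^{n_k} I(X_i;L_{ext}(X_i))\to0$. 3. For $\gamma>SNR$ the extrinsic LLRs are infinite, with the sign of the bit: $\frac1{n_k}\sum_{i=1}^{n_k}P\left(X_iL_{ext}(X_i)\le M\right)\to0$ for every real $M$; and $\frac1{n_k}\sum_{i=1}^{n_k} I(X_i;L_{ext}(X_i))\to1$. 4. The EXIT curve is flat and matched to the channel: at each a priori information $a$ it tends to $0$ if $0\le a<I_2(SNR)$ and to $1$ if $I_2(SNR)<a<1$. The EXIT curve of each $\mathbf C_k$ is integrable on $[0,1]$, and the area under it tends to $1-R$. -/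

import Mathlib

open MeasureTheory ProbabilityTheory Filter Topology
open scoped ENNReal

noncomputable section

/-- Mutual information `I(X;Y)`, in bits: the Kullback-Leibler divergence of the joint law from the
product of the marginal laws, divided by `log 2`. (It is used with `X` binary, where the divergence
is finite.) -/
def mutualInfoBits {Ω α β : Type*} [MeasurableSpace Ω] [MeasurableSpace α] [MeasurableSpace β]
    (μ : Measure Ω) (X : Ω → α) (Y : Ω → β) : ℝ :=
  (InformationTheory.klDiv (μ.map (fun ω => (X ω, Y ω))) ((μ.map X).prod (μ.map Y))).toReal
    / Real.log 2

/-- The channel symbol of a bit: `true ↦ +1`, `false ↦ -1`. -/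
def bpsk (b : Bool) : ℝ := if b then 1 else -1

/-- `I₂(γ)`: the mutual information between an equiprobable `X ∈ {+1,-1}` and
`Y = √γ X + N`, with `N ∼ N(0,1)` independent of `X`. -/
def biAwgnInfo (γ : ℝ) : ℝ :=
  mutualInfoBits ((uniformOn (Set.univ : Set Bool)).prod (gaussianReal 0 1))
    (fun ω => ω.1) (fun ω => Real.sqrt γ * bpsk ω.1 + ω.2)

/-- The a priori SNR at which the a priori information `I₂` reaches the level `a`
(the inverse of the increasing function `I₂` on `[0,∞)`). -/
def snrOfInfo (a : ℝ) : ℝ := sInf {γ : ℝ | 0 ≤ γ ∧ a ≤ biAwgnInfo γ}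

namespace BinaryCode

variable {n : ℕ}

/-- Joint law of the transmitted codeword (uniform on the code) and of the independent
standard Gaussian noise. -/
def law (C : Finset (Fin n → Bool)) : Measure ((Fin n → Bool) × (Fin n → ℝ)) :=
  (uniformOn (C : Set (Fin n → Bool))).prod (Measure.pi fun _ => gaussianReal 0 1)

/-- The `i`-th transmitted bit. -/
def bit (i : Fin n) (ω : (Fin n → Bool) × (Fin n → ℝ)) : Bool := ω.1 i

/-- The `i`-th received value `Yᵢ = √γ Xᵢ + Nᵢ`. -/
def received (γ : ℝ) (i : Fin n) (ω : (Fin n → Bool) × (Fin n → ℝ)) : ℝ :=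
  Real.sqrt γ * bpsk (bit i ω) + ω.2 i

/-- The rate, in bits per channel use. -/
def rate (C : Finset (Fin n → Bool)) : ℝ := Real.logb 2 (C.card : ℝ) / n

/-- Average (over the codewords) block error probability of the decoder `dec` at SNR `γ`. -/
def errorProb (C : Finset (Fin n → Bool)) (γ : ℝ) (dec : (Fin n → ℝ) → (Fin n → Bool)) : ℝ :=
  (law C).real {ω | dec (fun i => received γ i ω) ≠ ω.1}

/-- The σ-algebra generated by all received values except the `i`-th one. -/
@[reducible] def othersSigma (γ : ℝ) (i : Fin n) : MeasurableSpace ((Fin n → Bool) × (Fin n → ℝ)) :=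
  MeasurableSpace.comap (fun ω (j : {j : Fin n // j ≠ i}) => received γ j.1 ω) inferInstance

/-- `P(Xᵢ = b | Yⱼ, j ≠ i)` at SNR `γ`. -/
def extrinsicProb (C : Finset (Fin n → Bool)) (γ : ℝ) (i : Fin n) (b : Bool) :
    (Fin n → Bool) × (Fin n → ℝ) → ℝ :=
  (law C)⟦{ω | bit i ω = b}|othersSigma γ i⟧

/-- The extrinsic log-likelihood ratio
`log (P(Xᵢ = +1 | Yⱼ, j ≠ i) / P(Xᵢ = -1 | Yⱼ, j ≠ i))`, with values in `[-∞,∞]`. -/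
def extrinsicLLR (C : Finset (Fin n → Bool)) (γ : ℝ) (i : Fin n)
    (ω : (Fin n → Bool) × (Fin n → ℝ)) : EReal :=
  ENNReal.log (ENNReal.ofReal (extrinsicProb C γ i true ω) /
    ENNReal.ofReal (extrinsicProb C γ i false ω))

/-- Extrinsic information at a priori SNR `γ`: the average over the bits of `I(Xᵢ; L_ext(Xᵢ))`. -/
def extrinsicInfo (C : Finset (Fin n → Bool)) (γ : ℝ) : ℝ :=
  (∑ i : Fin n, mutualInfoBits (law C) (bit i) (extrinsicLLR C γ i)) / n

/-- The EXIT curve: extrinsic information as a function of the a priori information `a`. -/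
def exitCurve (C : Finset (Fin n → Bool)) (a : ℝ) : ℝ := extrinsicInfo C (snrOfInfo a)

/-- A sequence of binary codes is capacity achieving at `SNR` if its rates tend to `I₂(SNR)` and
it can be decoded with vanishing block error probability at every signal to noise ratio `γ > SNR`
(which is the case when it can be so decoded at `SNR` itself). -/
def CapacityAchieving (SNR : ℝ) (n : ℕ → ℕ) (C : (k : ℕ) → Finset (Fin (n k) → Bool)) : Prop :=
  Tendsto (fun k => rate (C k)) atTop (𝓝 (biAwgnInfo SNR)) ∧
  ∀ γ : ℝ, SNR < γ → ∃ dec : (k : ℕ) → (Fin (n k) → ℝ) → (Fin (n k) → Bool),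
    (∀ k, Measurable (dec k)) ∧
    Tendsto (fun k => errorProb (C k) γ (dec k)) atTop (𝓝 0)

end BinaryCode

end

/-! ### Product measures -/

section ProductMeasure

variable {ι U : Type*} [Fintype ι] [DecidableEq ι] [MeasurableSpace U]

/-! Let `e_i = E[X_i | Y_j, j ≠ i]` be the extrinsic mean of the `i`-th symbol. Everything reduces
to the average over the positions of `E[e_i ^ 2]` (`avgSqExtMean`): it tends to 0 below the
threshold and to 1 above it. The LLR is an increasing function of `e_i`, and the information it
carries is an entropy drop expressed by `e_i`, so Markov's inequality and elementary bounds on the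
binary entropy then give all the assertions on LLRs and extrinsic information. The area follows from
the pointwise limits by dominated convergence.

Below the threshold. Let `s₁ < s₃` be two amplitudes, the code being well decodable at `s₃` with
rate close to the symmetric information `J` there. By a Fano-type argument the mutual information of
codeword and output is close to `log |C|`, so the divergence of the output law from the product
`Q^n` of symmetric mixtures is only `o(n)`. Realise the output at `s₁` as a degradation of the
output at `s₃`, and let `h` be half the difference of the posterior means of one symbol before and
after degradation. Under `Q^n`, `h` at position `i` is orthogonal to every bounded function of the
degraded outputs. Under the code it is correlated with the `e_i` computed at `s₁`: `E[e_i h_i] = c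
E[e_i ^ 2]` with `c > 0`. Hence `G = ∏ (1 + (c / 2) e_i h_i)` is a probability density for `Q^n`
which fits the code better than the constant 1. Gibbs' inequality, for the joint law of codeword and
output against `G` times a conditional law built from the decoder, gives `(c ^ 2 / 4) ∑ E[e_i ^ 2] ≤
n J - log |C| +` decoding terms. This is `sum_sq_extrinsic_le`, specialised in
`sum_sq_extrinsic_gaussian_le`; `gaussMean_lt` supplies `c > 0`. Continuity of `J` allows `s₃` to
approach the threshold from above, where decoding is assumed.

Above the threshold. A single received value changes the odds of its bit only by a finite factor. If
`e_i` were not close to `±1`, both values of the bit would keep a sizeable posterior weight given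
all outputs, and every decoder would err with non-vanishing probability (`noiseFactor_mul_le`). -/

theorem measurable_update_prod {ι U : Type*} [DecidableEq ι] [MeasurableSpace U] (i : ι) :
    Measurable (fun p : (ι → U) × U => Function.update p.1 i p.2) := by
  rw [measurable_pi_iff]
  intro j
  by_cases h : j = i
  · subst h; simpa using measurable_snd
  · simp only [Function.update_of_ne h]
    exact (measurable_pi_apply j).comp measurable_fst

/-- Resampling one coordinate changes the law of this coordinate only. -/
theorem measurePreserving_update_pi_of_ne (ν ν' : ι → Measure U) [∀ i, IsProbabilityMeasure (ν i)]
    [∀ i, IsProbabilityMeasure (ν' i)] (i : ι) (h : ∀ j, j ≠ i → ν j = ν' j) :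
    MeasurePreserving (fun p : (ι → U) × U => Function.update p.1 i p.2)
      ((Measure.pi ν).prod (ν' i)) (Measure.pi ν') := by
  have hm := measurable_update_prod (U := U) i
  refine ⟨hm, ?_⟩
  symm
  apply Measure.pi_eq
  intro s hs
  rw [Measure.map_apply hm (MeasurableSet.univ_pi hs)]
  have : (fun p : (ι → U) × U => Function.update p.1 i p.2) ⁻¹' (Set.univ.pi s)
      = (Set.univ.pi (Function.update s i Set.univ)) ×ˢ s i := by
    ext p
    simp only [Set.mem_preimage, Set.mem_pi, Set.mem_univ, true_imp_iff, Set.mem_prod]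
    constructor
    · intro h
      refine ⟨fun j => ?_, by simpa using h i⟩
      by_cases hj : j = i
      · subst hj; simp
      · simpa [hj] using h j
    · rintro ⟨h1, h2⟩ j
      by_cases hj : j = i
      · subst hj; simpa using h2
      · simpa [hj] using h1 j
  rw [this, Measure.prod_prod, Measure.pi_pi, ← Finset.mul_prod_erase _ _ (Finset.mem_univ i),
    ← Finset.mul_prod_erase Finset.univ (fun j => ν' j (s j)) (Finset.mem_univ i)]
  simp only [Function.update_self, measure_univ, one_mul]
  rw [mul_comm]
  congr 1
  refine Finset.prod_congr rfl fun j hj => ?_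
  rw [Function.update_of_ne (Finset.ne_of_mem_erase hj), h j (Finset.ne_of_mem_erase hj)]

theorem measurePreserving_update_pi (ν : ι → Measure U) [∀ i, IsProbabilityMeasure (ν i)] (i : ι) :
    MeasurePreserving (fun p : (ι → U) × U => Function.update p.1 i p.2)
      ((Measure.pi ν).prod (ν i)) (Measure.pi ν) :=
  measurePreserving_update_pi_of_ne ν ν i fun _ _ => rfl

/-- The mean of a function not depending on a coordinate does not depend on the law of this
coordinate. -/
theorem integral_pi_congr_of_ne (ν ν' : ι → Measure U) [∀ i, IsProbabilityMeasure (ν i)]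
    [∀ i, IsProbabilityMeasure (ν' i)] (i : ι) (h : ∀ j, j ≠ i → ν j = ν' j) {E : (ι → U) → ℝ}
    (hE : ∀ u v, E (Function.update u i v) = E u) (hEm : Measurable E) :
    ∫ u, E u ∂(Measure.pi ν) = ∫ u, E u ∂(Measure.pi ν') := by
  have hp := measurePreserving_update_pi_of_ne ν ν' i h
  rw [← hp.map_eq, integral_map hp.measurable.aemeasurable hEm.aestronglyMeasurable]
  simp only [hE]
  rw [integral_fun_fst (μ := Measure.pi ν) (ν := ν' i) E]
  simp

theorem integral_pi_eq_integral_update (ν : ι → Measure U) [∀ i, IsProbabilityMeasure (ν i)]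
    (i : ι) {F : (ι → U) → ℝ} (hF : Integrable F (Measure.pi ν)) :
    ∫ u, F u ∂(Measure.pi ν) = ∫ u, ∫ v, F (Function.update u i v) ∂(ν i) ∂(Measure.pi ν) := by
  have hp := measurePreserving_update_pi ν i
  rw [← integral_prod (f := fun p : (ι → U) × U => F (Function.update p.1 i p.2))
    (hp.integrable_comp_of_integrable hF)]
  conv_lhs => rw [← hp.map_eq]
  rw [integral_map hp.measurable.aemeasurable]
  rw [hp.map_eq]
  exact hF.aestronglyMeasurable

/-- A function not depending on a coordinate is independent of that coordinate. -/
theorem integral_pi_mul_coord (ν : ι → Measure U) [∀ i, IsProbabilityMeasure (ν i)]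
    (i : ι) {E : (ι → U) → ℝ} {h : U → ℝ} (hE : ∀ u v, E (Function.update u i v) = E u)
    (hint : Integrable (fun u => E u * h (u i)) (Measure.pi ν)) :
    ∫ u, E u * h (u i) ∂(Measure.pi ν) = (∫ u, E u ∂(Measure.pi ν)) * ∫ v, h v ∂(ν i) := by
  rw [integral_pi_eq_integral_update ν i hint]
  simp only [hE, Function.update_self, integral_const_mul, integral_mul_const]

/-- On a box, the indicator times the product density is a product of functions of one coordinate,
so its integral factors; boxes determine a product measure. -/
theorem pi_withDensity_ofReal {ι U : Type*} [Fintype ι] [MeasurableSpace U] (ν : ι → Measure U) [∀ i, IsProbabilityMeasure (ν i)]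
    (r : ι → U → ℝ) (hr0 : ∀ i u, 0 ≤ r i u)
    (hri : ∀ i, Integrable (r i) (ν i))
    [∀ i, SigmaFinite ((ν i).withDensity (fun u => ENNReal.ofReal (r i u)))] :
    Measure.pi (fun i => (ν i).withDensity (fun u => ENNReal.ofReal (r i u)))
      = (Measure.pi ν).withDensity (fun u => ENNReal.ofReal (∏ i, r i (u i))) := by
  apply Measure.pi_eq
  intro s hs
  have hf : ∀ i, Integrable ((s i).indicator (r i)) (ν i) := fun i => (hri i).indicator (hs i)
  have h0 : ∀ i u, 0 ≤ (s i).indicator (r i) u :=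
    fun i u => Set.indicator_nonneg (fun x _ => hr0 i x) u
  have key : ∀ u : ι → U, (Set.univ.pi s).indicator (fun u => ENNReal.ofReal (∏ i, r i (u i))) u
      = ENNReal.ofReal (∏ i, (s i).indicator (r i) (u i)) := by
    intro u
    by_cases hu : u ∈ Set.univ.pi s
    · rw [Set.indicator_of_mem hu]
      congr 1
      refine Finset.prod_congr rfl fun i _ => ?_
      rw [Set.indicator_of_mem (hu i (Set.mem_univ i))]
    · rw [Set.indicator_of_notMem hu]
      simp only [Set.mem_pi, Set.mem_univ, true_imp_iff, not_forall] at hu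
      obtain ⟨i, hi⟩ := hu
      rw [Finset.prod_eq_zero (Finset.mem_univ i) (Set.indicator_of_notMem hi _)]
      simp
  rw [withDensity_apply _ (MeasurableSet.univ_pi hs), ← lintegral_indicator (MeasurableSet.univ_pi hs)]
  simp only [key]
  rw [← ofReal_integral_eq_lintegral_ofReal (Integrable.fintype_prod_dep hf)
    (ae_of_all _ fun u => Finset.prod_nonneg fun i _ => h0 i _), integral_fintype_prod_eq_prod,
    ENNReal.ofReal_prod_of_nonneg (fun i _ => integral_nonneg (h0 i))]
  refine Finset.prod_congr rfl fun i _ => ?_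
  rw [withDensity_apply _ (hs i), ← lintegral_indicator (hs i),
    ofReal_integral_eq_lintegral_ofReal (hf i) (ae_of_all _ (h0 i))]
  refine lintegral_congr fun u => ?_
  by_cases hu : u ∈ s i <;> simp [hu]

end ProductMeasure

/-- A bounded measurable function is integrable for a finite measure. -/
theorem integrable_of_abs_le {α : Type*} [MeasurableSpace α] {μ : Measure α} [IsFiniteMeasure μ]
    {f : α → ℝ} (hf : Measurable f) {K : ℝ} (hK : ∀ a, |f a| ≤ K) : Integrable f μ :=
  Integrable.of_bound hf.aestronglyMeasurable K (ae_of_all _ hK)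

theorem integral_withDensity_ofReal {α : Type*} [MeasurableSpace α] {μ : Measure α} {r : α → ℝ}
    (hr : Measurable r) (hr0 : ∀ a, 0 ≤ r a) (f : α → ℝ) :
    ∫ a, f a ∂(μ.withDensity (fun a => ENNReal.ofReal (r a))) = ∫ a, r a * f a ∂μ := by
  rw [integral_withDensity_eq_integral_toReal_smul hr.ennreal_ofReal
    (ae_of_all _ fun _ => ENNReal.ofReal_lt_top)]
  simp [ENNReal.toReal_ofReal (hr0 _)]

/-! ### The key inequality for a memoryless binary-input channel -/

/-- The average of a function over the codewords. -/
noncomputable def codeAvg {n : ℕ} (C : Finset (Fin n → Bool)) (f : (Fin n → Bool) → ℝ) : ℝ :=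
  (∑ x ∈ C, f x) / C.card

theorem codeAvg_mono {n : ℕ} {C : Finset (Fin n → Bool)} {f g : (Fin n → Bool) → ℝ}
    (h : ∀ x ∈ C, f x ≤ g x) : codeAvg C f ≤ codeAvg C g :=
  div_le_div_of_nonneg_right (Finset.sum_le_sum h) (Nat.cast_nonneg _)

theorem codeAvg_const {n : ℕ} {C : Finset (Fin n → Bool)} (hne : C.Nonempty) (a : ℝ) :
    codeAvg C (fun _ => a) = a := by
  have : (C.card : ℝ) ≠ 0 := by exact_mod_cast hne.card_pos.ne'
  simp [codeAvg, this]

theorem codeAvg_add {n : ℕ} {C : Finset (Fin n → Bool)} (f g : (Fin n → Bool) → ℝ) :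
    codeAvg C (fun x => f x + g x) = codeAvg C f + codeAvg C g := by
  simp [codeAvg, Finset.sum_add_distrib, add_div]

theorem codeAvg_sub {n : ℕ} {C : Finset (Fin n → Bool)} (f g : (Fin n → Bool) → ℝ) :
    codeAvg C (fun x => f x - g x) = codeAvg C f - codeAvg C g := by
  simp [codeAvg, Finset.sum_sub_distrib, sub_div]

theorem codeAvg_const_mul {n : ℕ} {C : Finset (Fin n → Bool)} (a : ℝ) (f : (Fin n → Bool) → ℝ) :
    codeAvg C (fun x => a * f x) = a * codeAvg C f := by
  simp [codeAvg, ← Finset.mul_sum, mul_div_assoc]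

theorem codeAvg_sum {n : ℕ} {ι : Type*} {C : Finset (Fin n → Bool)} (s : Finset ι)
    (f : ι → (Fin n → Bool) → ℝ) :
    codeAvg C (fun x => ∑ i ∈ s, f i x) = ∑ i ∈ s, codeAvg C (f i) := by
  simp [codeAvg, Finset.sum_comm (s := C), Finset.sum_div]

/-- Taylor expansion to second order, with `x ^ 2 / 2` to spare for the remainder. It bounds the
logarithm of the tilting density from below. -/
theorem sub_sq_le_log_one_add {x : ℝ} (hx : |x| ≤ 1 / 4) : x - x ^ 2 ≤ Real.log (1 + x) := by
  have h3 := Real.abs_log_sub_add_sum_range_le (x := -x) (by rw [abs_neg]; linarith) 2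
  have h5 := (abs_le.1 h3).1
  simp only [Finset.sum_range_succ, Finset.sum_range_zero, abs_neg, sub_neg_eq_add] at h5
  norm_num at h5
  have h6 : |x| ^ 3 / (1 - |x|) ≤ x ^ 2 / 2 := by
    rw [div_le_iff₀ (by linarith), ← sq_abs x]
    nlinarith [mul_nonneg (sq_nonneg |x|) (abs_nonneg x), mul_nonneg (sq_nonneg |x|)
      (sub_nonneg.2 hx)]
  linarith

theorem abs_prod_le_pow_card {ι : Type*} (s : Finset ι) (f : ι → ℝ) {K : ℝ}
    (h : ∀ i ∈ s, |f i| ≤ K) : |∏ i ∈ s, f i| ≤ K ^ s.card := by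
  rw [Finset.abs_prod, ← Finset.prod_const]
  exact Finset.prod_le_prod (fun _ _ => abs_nonneg _) h

section Channel

variable {U V : Type*} [MeasurableSpace U] [MeasurableSpace V] {n : ℕ}

/-- The tilted product is a probability density although each `e i` may depend on all coordinates
but the `i`-th. The factors are removed one at a time: as functions of coordinate `k`, all the other
factors see only `π (u k)`, and `h (u k)` is orthogonal to bounded functions of `π (u k)`. This is
why the means `e i` are computed from degraded outputs. -/
theorem integral_prod_one_add_eq_one (Q : Measure U) [IsProbabilityMeasure Q] {π : U → V}
    (hπ : Measurable π) {h : U → ℝ} (hh : Measurable h) (hh1 : ∀ u, |h u| ≤ 1)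
    (hcond : ∀ ψ : V → ℝ, Measurable ψ → (∃ K, ∀ v, |ψ v| ≤ K) → ∫ u, h u * ψ (π u) ∂Q = 0)
    {e : Fin n → (Fin n → V) → ℝ} (he : ∀ i, Measurable (e i)) (he1 : ∀ i v, |e i v| ≤ 1)
    (hupd : ∀ i v t, e i (Function.update v i t) = e i v) (lam : ℝ) (S : Finset (Fin n)) :
    ∫ u, ∏ i ∈ S, (1 + lam * e i (fun j => π (u j)) * h (u i)) ∂(Measure.pi fun _ : Fin n => Q)
      = 1 := by
  have hEm : ∀ i, Measurable (fun u : Fin n → U => e i (fun j => π (u j))) := fun i =>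
    (he i).comp (measurable_pi_lambda _ fun j => hπ.comp (measurable_pi_apply j))
  have hmeas : ∀ S : Finset (Fin n), Measurable (fun u : Fin n → U =>
      ∏ i ∈ S, (1 + lam * e i (fun j => π (u j)) * h (u i))) := fun S =>
    Finset.measurable_prod _ fun i _ =>
      (((hEm i).const_mul lam).mul (hh.comp (measurable_pi_apply i))).const_add 1
  have hfac : ∀ a b : ℝ, |a| ≤ 1 → |b| ≤ 1 → |1 + lam * a * b| ≤ 1 + |lam| := by
    intro a b ha hb
    refine (abs_add_le _ _).trans ?_
    rw [abs_one, abs_mul, abs_mul, mul_assoc]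
    have : |a| * |b| ≤ 1 := mul_le_one₀ ha (abs_nonneg _) hb
    nlinarith [abs_nonneg lam]
  have hbd : ∀ (S : Finset (Fin n)) (f : Fin n → ℝ) (g : Fin n → ℝ), (∀ i, |f i| ≤ 1) →
      (∀ i, |g i| ≤ 1) → |∏ i ∈ S, (1 + lam * f i * g i)| ≤ (1 + |lam|) ^ S.card := by
    intro S f g hf hg
    exact abs_prod_le_pow_card _ _ fun i _ => hfac _ _ (hf i) (hg i)
  induction S using Finset.induction_on with
  | empty => simp
  | insert k S hk ih =>
    have hint : Integrable (fun u : Fin n → U =>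
        ∏ i ∈ S, (1 + lam * e i (fun j => π (u j)) * h (u i))) (Measure.pi fun _ : Fin n => Q) :=
      integrable_of_abs_le (hmeas S) fun u => hbd S _ _ (fun i => he1 i _) (fun i => hh1 _)
    have hint2 : Integrable (fun u : Fin n → U =>
        (∏ i ∈ S, (1 + lam * e i (fun j => π (u j)) * h (u i))) *
          (lam * e k (fun j => π (u j)) * h (u k))) (Measure.pi fun _ : Fin n => Q) := by
      refine integrable_of_abs_le (K := (1 + |lam|) ^ S.card * |lam|)
        ((hmeas S).mul (((hEm k).const_mul lam).mul (hh.comp (measurable_pi_apply k)))) fun u => ?_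
      rw [abs_mul]
      refine mul_le_mul (hbd S _ _ (fun i => he1 i _) (fun i => hh1 _)) ?_ (abs_nonneg _)
        (by positivity)
      rw [abs_mul, abs_mul, mul_assoc]
      exact mul_le_of_le_one_right (abs_nonneg _)
        (mul_le_one₀ (he1 _ _) (abs_nonneg _) (hh1 _))
    simp only [Finset.prod_insert hk]
    have : ∀ u : Fin n → U, (1 + lam * e k (fun j => π (u j)) * h (u k)) *
        ∏ i ∈ S, (1 + lam * e i (fun j => π (u j)) * h (u i))
        = (∏ i ∈ S, (1 + lam * e i (fun j => π (u j)) * h (u i))) +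
        (∏ i ∈ S, (1 + lam * e i (fun j => π (u j)) * h (u i))) *
          (lam * e k (fun j => π (u j)) * h (u k)) := fun u => by ring
    simp only [this]
    rw [integral_add hint hint2, ih, integral_pi_eq_integral_update _ k hint2]
    -- Only coordinate `k` is integrated here. Besides `h`, the integrand depends on it through `π`
    -- alone, since `e k` ignores position `k` and the other `h (u i)` do not involve it.
    have hz : ∀ u : Fin n → U, ∫ v, (∏ i ∈ S, (1 + lam *
        e i (fun j => π (Function.update u k v j)) * h (Function.update u k v i))) *
          (lam * e k (fun j => π (Function.update u k v j)) * h (Function.update u k v k)) ∂Q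
          = 0 := by
      intro u
      have hu : ∀ v, (fun j => π (Function.update u k v j))
          = Function.update (fun j => π (u j)) k (π v) := by
        intro v; ext j
        by_cases hj : j = k
        · subst hj; simp
        · simp [hj]
      set ψ : V → ℝ := fun t => (∏ i ∈ S, (1 + lam *
        e i (Function.update (fun j => π (u j)) k t) * h (u i))) * (lam * e k (fun j => π (u j)))
      have hψm : Measurable ψ := by
        refine Measurable.mul_const (Finset.measurable_prod _ fun i _ => ?_) _
        exact ((((he i).comp (measurable_update _)).const_mul lam).mul_const _).const_add 1
      have hψ := hcond ψ hψm ⟨(1 + |lam|) ^ S.card * |lam|, fun t => by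
        rw [abs_mul]
        refine mul_le_mul (hbd S _ _ (fun i => he1 i _) (fun i => hh1 _)) ?_ (abs_nonneg _)
          (by positivity)
        rw [abs_mul]
        exact mul_le_of_le_one_right (abs_nonneg _) (he1 _ _)⟩
      rw [← hψ]
      refine integral_congr_ae (ae_of_all _ fun v => ?_)
      simp only [hu, hupd, Function.update_self, ψ]
      rw [Finset.prod_congr rfl fun i hi => ?_]
      · ring
      · have : i ≠ k := fun hik => hk (hik ▸ hi)
        rw [Function.update_of_ne this]
    rw [integral_congr_ae (ae_of_all _ hz)]
    simp

/-- A code that can be decoded with small error probability and whose rate is close to the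
symmetric information of the channel has small extrinsic means over a degraded channel. -/
theorem sum_sq_extrinsic_le (Q : Measure U) [IsProbabilityMeasure Q] (P : Bool → Measure U)
    [∀ b, IsProbabilityMeasure (P b)] {r : Bool → U → ℝ} (hr : ∀ b, Measurable (r b))
    (hr0 : ∀ b u, 0 < r b u) (hr2 : ∀ b u, r b u ≤ 2)
    (hP : ∀ b, P b = Q.withDensity (fun u => ENNReal.ofReal (r b u))) {J : ℝ}
    (hJi : ∀ b, Integrable (fun u => Real.log (r b u)) (P b))
    (hJ : ∀ b, ∫ u, Real.log (r b u) ∂(P b) = J)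
    {h : U → ℝ} (hh : Measurable h) (hh1 : ∀ u, |h u| ≤ 1) {c : ℝ} (hc0 : 0 ≤ c) (hc1 : c ≤ 1 / 2)
    (hhc : ∀ b, ∫ u, h u ∂(P b) = bpsk b * c)
    {E : Fin n → (Fin n → U) → ℝ} (hE : ∀ i, Measurable (E i)) (hE1 : ∀ i u, |E i u| ≤ 1)
    (hupd : ∀ i u t, E i (Function.update u i t) = E i u)
    (hG : ∫ u, ∏ i, (1 + c / 2 * E i u * h (u i)) ∂(Measure.pi fun _ : Fin n => Q) = 1)
    {C : Finset (Fin n → Bool)} (hne : C.Nonempty)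
    (hEE : ∀ i, codeAvg C (fun x => bpsk (x i) * ∫ u, E i u ∂(Measure.pi fun j => P (x j)))
      = codeAvg C (fun x => ∫ u, E i u ^ 2 ∂(Measure.pi fun j => P (x j))))
    {dec : (Fin n → U) → Fin n → Bool} (hdec : Measurable dec) {ε : ℝ} (hε0 : 0 < ε) (hε1 : ε < 1) :
    c ^ 2 / 4 * ∑ i, codeAvg C (fun x => ∫ u, E i u ^ 2 ∂(Measure.pi fun j => P (x j)))
      ≤ n * J - Real.log C.card - Real.log (1 - ε)
        + codeAvg C (fun x => (Measure.pi fun j => P (x j)).real {u | dec u ≠ x})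
          * (Real.log C.card - Real.log ε) := by
  have hcard : (0 : ℝ) < C.card := by exact_mod_cast hne.card_pos
  -- A tilt of strength `λ` gains `λ c` and loses at most `λ ^ 2` per unit of `E i ^ 2`; `λ = c / 2`
  -- is optimal and leaves `c ^ 2 / 4`. With `c ≤ 1 / 2` each perturbation is at most `1 / 4` in
  -- absolute value, as the logarithmic bound requires.
  set G : (Fin n → U) → ℝ := fun u => ∏ i, (1 + c / 2 * E i u * h (u i)) with hGdef
  set R : (Fin n → Bool) → (Fin n → U) → ℝ := fun x u => ∏ i, r (x i) (u i) with hRdef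
  -- A guess of the posterior law of the codeword: mass `1 - ε` on the decoded word and `ε` spread
  -- evenly, so that its logarithm stays finite when the decoder errs. Its total mass over `C` is at
  -- most 1.
  set q : (Fin n → Bool) → (Fin n → U) → ℝ :=
    fun x u => if dec u = x then 1 - ε else ε / C.card with hqdef
  have hfac : ∀ i u, |c / 2 * E i u * h (u i)| ≤ 1 / 4 := by
    intro i u
    rw [abs_mul, abs_mul, mul_assoc, abs_of_nonneg (by positivity)]
    have := mul_le_one₀ (hE1 i u) (abs_nonneg _) (hh1 (u i))
    have h0 : 0 ≤ |E i u| * |h (u i)| := by positivity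
    nlinarith
  have hfac0 : ∀ i u, 0 < 1 + c / 2 * E i u * h (u i) := fun i u => by
    have := (abs_le.1 (hfac i u)).1; linarith
  have hG0 : ∀ u, 0 < G u := fun u => Finset.prod_pos fun i _ => hfac0 i u
  have hR0 : ∀ x u, 0 < R x u := fun x u => Finset.prod_pos fun i _ => hr0 _ _
  have hq0 : ∀ x u, 0 < q x u := fun x u => by
    simp only [hqdef]; split_ifs
    · linarith
    · positivity
  have hGm : Measurable G := Finset.measurable_prod _ fun i _ =>
    (((hE i).const_mul _).mul (hh.comp (measurable_pi_apply i))).const_add 1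
  have hRm : ∀ x, Measurable (R x) := fun x => Finset.measurable_prod _ fun i _ =>
    (hr _).comp (measurable_pi_apply i)
  have hSm : ∀ x, MeasurableSet {u | dec u = x} := fun x => hdec (measurableSet_singleton x)
  have hqm : ∀ x, Measurable (q x) := fun x =>
    Measurable.ite (hSm x) measurable_const measurable_const
  have hGb : ∀ u, |G u| ≤ 2 ^ n := by
    intro u
    refine (abs_prod_le_pow_card _ _ (K := 2) fun i _ => ?_).trans (by simp)
    rw [abs_of_pos (hfac0 i u)]
    have := (abs_le.1 (hfac i u)).2; linarith
  have hPpi : ∀ x : Fin n → Bool, Measure.pi (fun j => P (x j))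
      = (Measure.pi fun _ : Fin n => Q).withDensity (fun u => ENNReal.ofReal (R x u)) := by
    intro x
    have : (fun j => P (x j)) = fun j => Q.withDensity (fun u => ENNReal.ofReal (r (x j) u)) := by
      ext1 j; exact hP _
    rw [this]
    have : ∀ j, SigmaFinite (Q.withDensity (fun u => ENNReal.ofReal (r (x j) u))) := fun j => by
      rw [← hP]; infer_instance
    exact pi_withDensity_ofReal (fun _ => Q) (fun i => r (x i))
      (fun i u => (hr0 _ _).le) fun i => integrable_of_abs_le (hr _) (K := 2) fun u => by
        rw [abs_of_pos (hr0 _ _)]; exact hr2 _ _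
  have hqb : ∀ x u, |q x u| ≤ 1 + ε / C.card := by
    intro x u
    rw [abs_of_pos (hq0 x u)]
    have : 0 < ε / C.card := by positivity
    simp only [hqdef]; split_ifs <;> linarith
  -- the ratio integrates to the reference measure
  have hratio : ∀ x, ∫ u, C.card * (G u * q x u / R x u) ∂(Measure.pi fun j => P (x j))
      = C.card * ∫ u, G u * q x u ∂(Measure.pi fun _ : Fin n => Q) := by
    intro x
    rw [integral_const_mul, hPpi x, integral_withDensity_ofReal (hRm x) fun u => (hR0 x u).le]
    congr 1
    refine integral_congr_ae (ae_of_all _ fun u => ?_)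
    have := (hR0 x u).ne'
    field_simp
  have hGq : ∀ x, Integrable (fun u => G u * q x u) (Measure.pi fun _ : Fin n => Q) := fun x =>
    integrable_of_abs_le (hGm.mul (hqm x)) (K := 2 ^ n * (1 + ε / C.card)) fun u => by
      rw [abs_mul]
      exact mul_le_mul (hGb u) (hqb x u) (abs_nonneg _) (by positivity)
  have hratio_int : ∀ x, Integrable (fun u => C.card * (G u * q x u / R x u))
      (Measure.pi fun j => P (x j)) := by
    intro x
    refine Integrable.const_mul ?_ _
    rw [hPpi x, integrable_withDensity_iff (hRm x).ennreal_ofReal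
      (ae_of_all _ fun _ => ENNReal.ofReal_lt_top)]
    refine (hGq x).congr (ae_of_all _ fun u => ?_)
    have := (hR0 x u).ne'
    simp only [ENNReal.toReal_ofReal (hR0 x u).le]
    field_simp
  -- the pointwise Gibbs inequality
  have hpt : ∀ x u, (∑ i, (c / 2 * (E i u * h (u i)) - c ^ 2 / 4 * E i u ^ 2))
      + (Real.log (1 - ε) + {u | dec u ≠ x}.indicator (fun _ => Real.log ε - Real.log C.card) u
      + Real.log C.card) - ∑ i, Real.log (r (x i) (u i))
      ≤ C.card * (G u * q x u / R x u) - 1 := by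
    intro x u
    have hpos : 0 < C.card * (G u * q x u / R x u) := by
      have := hG0 u; have := hq0 x u; have := hR0 x u; positivity
    refine le_trans ?_ (Real.log_le_sub_one_of_pos hpos)
    rw [Real.log_mul hcard.ne' (by have := hG0 u; have := hq0 x u; have := hR0 x u; positivity),
      Real.log_div (mul_pos (hG0 u) (hq0 x u)).ne' (hR0 x u).ne',
      Real.log_mul (hG0 u).ne' (hq0 x u).ne']
    have h1 : ∑ i, (c / 2 * (E i u * h (u i)) - c ^ 2 / 4 * E i u ^ 2) ≤ Real.log (G u) := by
      rw [hGdef, Real.log_prod fun i _ => (hfac0 i u).ne']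
      refine Finset.sum_le_sum fun i _ => ?_
      refine le_trans ?_ (sub_sq_le_log_one_add (hfac i u))
      have : h (u i) ^ 2 ≤ 1 := by
        rw [← sq_abs]; exact pow_le_one₀ (abs_nonneg _) (hh1 _)
      have h2 : (c / 2 * E i u * h (u i)) ^ 2 ≤ c ^ 2 / 4 * E i u ^ 2 := by
        have : (c / 2 * E i u * h (u i)) ^ 2 = c ^ 2 / 4 * E i u ^ 2 * h (u i) ^ 2 := by ring
        rw [this]
        exact mul_le_of_le_one_right (by positivity) ‹_›
      linarith
    have h2 : Real.log (1 - ε) + {u | dec u ≠ x}.indicator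
        (fun _ => Real.log ε - Real.log C.card) u ≤ Real.log (q x u) := by
      by_cases hx : dec u = x
      · simp [hqdef, hx]
      · simp only [hqdef, hx, if_false]
        rw [Set.indicator_of_mem (by exact hx), Real.log_div hε0.ne' hcard.ne']
        have := Real.log_nonpos (x := 1 - ε) (by linarith) (by linarith)
        linarith
    have h3 : Real.log (R x u) = ∑ i, Real.log (r (x i) (u i)) := by
      rw [hRdef, Real.log_prod fun i _ => (hr0 _ _).ne']
    rw [h3]
    linarith
  have hEh : ∀ x : Fin n → Bool, ∀ i, Integrable (fun u => E i u * h (u i))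
      (Measure.pi fun j => P (x j)) := fun x i =>
    integrable_of_abs_le ((hE i).mul (hh.comp (measurable_pi_apply i))) (K := 1) fun u => by
      rw [abs_mul]; exact mul_le_one₀ (hE1 i u) (abs_nonneg _) (hh1 _)
  have hE2 : ∀ x : Fin n → Bool, ∀ i, Integrable (fun u => E i u ^ 2)
      (Measure.pi fun j => P (x j)) := fun x i =>
    integrable_of_abs_le ((hE i).pow_const 2) (K := 1) fun u => by
      rw [abs_pow]; exact pow_le_one₀ (abs_nonneg _) (hE1 i u)
  have hlog : ∀ x : Fin n → Bool, ∀ i, Integrable (fun u : Fin n → U => Real.log (r (x i) (u i)))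
      (Measure.pi fun j => P (x j)) := fun x i =>
    (measurePreserving_eval (fun j => P (x j)) i).integrable_comp_of_integrable (hJi (x i))
  have hlogv : ∀ x : Fin n → Bool, ∀ i, ∫ u : Fin n → U, Real.log (r (x i) (u i))
      ∂(Measure.pi fun j => P (x j)) = J := by
    intro x i
    rw [← hJ (x i)]
    have hmp := measurePreserving_eval (fun j => P (x j)) i
    conv_rhs => rw [← hmp.map_eq]
    rw [integral_map hmp.measurable.aemeasurable]
    exact (Real.measurable_log.comp (hr _)).aestronglyMeasurable
  have hSne : ∀ x, MeasurableSet {u | dec u ≠ x} := fun x => (hSm x).compl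
  -- Integration of the pointwise bound given the codeword. Given `x` the coordinates are
  -- independent and `E i` ignores the `i`-th one, so the mean of `E i u * h (u i)` factors and `h`
  -- contributes `bpsk (x i) * c`.
  have hIx : ∀ x, (∑ i, (c / 2 * (bpsk (x i) * ∫ u, E i u ∂(Measure.pi fun j => P (x j))) * c
      - c ^ 2 / 4 * ∫ u, E i u ^ 2 ∂(Measure.pi fun j => P (x j))))
      + (Real.log (1 - ε) + (Measure.pi fun j => P (x j)).real {u | dec u ≠ x}
        * (Real.log ε - Real.log C.card) + Real.log C.card) - n * J
      ≤ C.card * ∫ u, G u * q x u ∂(Measure.pi fun _ : Fin n => Q) - 1 := by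
    intro x
    have hi0 : ∀ i, Integrable (fun u => c / 2 * (E i u * h (u i)) - c ^ 2 / 4 * E i u ^ 2)
        (Measure.pi fun j => P (x j)) := fun i =>
      ((hEh x i).const_mul _).sub ((hE2 x i).const_mul _)
    have hi1 : Integrable (fun u => ∑ i, (c / 2 * (E i u * h (u i)) - c ^ 2 / 4 * E i u ^ 2))
        (Measure.pi fun j => P (x j)) := integrable_finsetSum _ fun i _ => hi0 i
    have hi2 : Integrable ({u | dec u ≠ x}.indicator (fun _ => Real.log ε - Real.log C.card))
        (Measure.pi fun j => P (x j)) := (integrable_const _).indicator (hSne x)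
    have hi3 : Integrable (fun u : Fin n → U => ∑ i, Real.log (r (x i) (u i)))
        (Measure.pi fun j => P (x j)) := integrable_finsetSum _ fun i _ => hlog x i
    have hi4 : Integrable (fun u => (Real.log (1 - ε) + {u | dec u ≠ x}.indicator
        (fun _ => Real.log ε - Real.log C.card) u + Real.log C.card))
        (Measure.pi fun j => P (x j)) := ((integrable_const _).add hi2).add (integrable_const _)
    have hmono := integral_mono ((hi1.fun_add hi4).sub hi3)
      ((hratio_int x).sub (integrable_const 1)) (hpt x)
    simp only [Pi.sub_apply] at hmono
    rw [integral_sub (hratio_int x) (integrable_const 1), hratio x,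
      integral_sub (hi1.fun_add hi4) hi3, integral_add hi1 hi4, integral_finsetSum _ fun i _ => hlog x i,
      integral_finsetSum _ fun i _ => hi0 i,
      integral_add ((integrable_const _).fun_add hi2) (integrable_const _),
      integral_add (integrable_const _) hi2, integral_indicator_const _ (hSne x)] at hmono
    simp only [hlogv, integral_const, probReal_univ, smul_eq_mul, one_mul, Finset.sum_const,
      Finset.card_univ, Fintype.card_fin, nsmul_eq_mul] at hmono
    have hterm : ∀ i, ∫ u, (c / 2 * (E i u * h (u i)) - c ^ 2 / 4 * E i u ^ 2)
        ∂(Measure.pi fun j => P (x j))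
        = c / 2 * (bpsk (x i) * ∫ u, E i u ∂(Measure.pi fun j => P (x j))) * c
          - c ^ 2 / 4 * ∫ u, E i u ^ 2 ∂(Measure.pi fun j => P (x j)) := by
      intro i
      rw [integral_sub ((hEh x i).const_mul _) ((hE2 x i).const_mul _), integral_const_mul,
        integral_const_mul, integral_pi_mul_coord (fun j => P (x j)) i (hupd i) (hEh x i), hhc]
      ring
    simp only [hterm] at hmono
    linarith
  have havg := codeAvg_mono (C := C) fun x _ => hIx x
  -- Summed over the codewords, the right-hand side is `∫ G * (∑ q - 1)`, because `G` has integral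
  -- 1; it is nonpositive as `q` has mass at most 1.
  have hsumq : codeAvg C (fun x => C.card * ∫ u, G u * q x u ∂(Measure.pi fun _ : Fin n => Q) - 1)
      ≤ 0 := by
    rw [codeAvg_sub, codeAvg_const hne, codeAvg_const_mul, codeAvg, mul_div_cancel₀ _ hcard.ne',
      ← integral_finsetSum _ fun x _ => hGq x, ← hG, ← integral_sub
      (integrable_finsetSum _ fun x _ => hGq x) (integrable_of_abs_le hGm hGb)]
    refine integral_nonpos fun u => ?_
    simp only [Pi.zero_apply]
    rw [← Finset.mul_sum]
    have : ∑ x ∈ C, q x u ≤ 1 := by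
      have hle : ∀ x ∈ C, q x u ≤ (if dec u = x then 1 - ε else 0) + ε / C.card := by
        intro x _
        have : 0 < ε / C.card := by positivity
        simp only [hqdef]; split_ifs <;> linarith
      refine (Finset.sum_le_sum hle).trans ?_
      rw [Finset.sum_add_distrib, Finset.sum_ite_eq, Finset.sum_const, nsmul_eq_mul,
        mul_div_cancel₀ _ hcard.ne']
      split_ifs <;> linarith
    have := mul_le_of_le_one_right (hG0 u).le this
    linarith
  have hfin := havg.trans hsumq
  rw [codeAvg_sub, codeAvg_const hne, codeAvg_add, codeAvg_add, codeAvg_add, codeAvg_const hne,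
    codeAvg_const hne, codeAvg_sum] at hfin
  -- By `hEE` the linear term is `c ^ 2 / 2` times the mean square, and the quadratic loss is `c ^ 2
  -- / 4` times it.
  have hterm : ∀ i, codeAvg C (fun x => c / 2 * (bpsk (x i) * ∫ u, E i u
      ∂(Measure.pi fun j => P (x j))) * c - c ^ 2 / 4 * ∫ u, E i u ^ 2
      ∂(Measure.pi fun j => P (x j)))
      = c ^ 2 / 4 * codeAvg C (fun x => ∫ u, E i u ^ 2 ∂(Measure.pi fun j => P (x j))) := by
    intro i
    rw [codeAvg_sub, codeAvg_const_mul, ← hEE i]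
    have : (fun x : Fin n → Bool => c / 2 * (bpsk (x i) * ∫ u, E i u
      ∂(Measure.pi fun j => P (x j))) * c) = fun x => c ^ 2 / 2 * (bpsk (x i) * ∫ u, E i u
      ∂(Measure.pi fun j => P (x j))) := by ext x; ring
    rw [this, codeAvg_const_mul]
    ring
  simp only [hterm, ← Finset.mul_sum] at hfin
  have herr : codeAvg C (fun x => (Measure.pi fun j => P (x j)).real {u | dec u ≠ x}
        * (Real.log ε - Real.log C.card))
      = codeAvg C (fun x => (Measure.pi fun j => P (x j)).real {u | dec u ≠ x})
        * (Real.log ε - Real.log C.card) := by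
    simp only [mul_comm _ (Real.log ε - Real.log C.card), codeAvg_const_mul]
  rw [herr] at hfin
  linarith

end Channel

/-! ### The binary-input Gaussian channel -/

theorem bpsk_true : bpsk true = 1 := rfl

theorem bpsk_false : bpsk false = -1 := rfl

theorem bpsk_sq (b : Bool) : bpsk b ^ 2 = 1 := by cases b <;> simp [bpsk]

theorem abs_bpsk (b : Bool) : |bpsk b| = 1 := by cases b <;> simp [bpsk]

/-- Density of `N(s b, 1)` with respect to the mixture `(N(s,1) + N(-s,1)) / 2`. -/
noncomputable def chanDensity (s : ℝ) (b : Bool) (y : ℝ) : ℝ :=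
  2 / (1 + Real.exp (-(2 * s * bpsk b * y)))

/-- The equiprobable mixture of `N(s,1)` and `N(-s,1)`. -/
noncomputable def mixLaw (s : ℝ) : Measure ℝ :=
  volume.withDensity fun y =>
    ENNReal.ofReal ((gaussianPDFReal s 1 y + gaussianPDFReal (-s) 1 y) / 2)

theorem chanDensity_pos (s : ℝ) (b : Bool) (y : ℝ) : 0 < chanDensity s b y := by
  unfold chanDensity; positivity

theorem chanDensity_le_two (s : ℝ) (b : Bool) (y : ℝ) : chanDensity s b y ≤ 2 := by
  unfold chanDensity
  rw [div_le_iff₀ (by positivity)]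
  nlinarith [Real.exp_pos (-(2 * s * bpsk b * y))]

theorem continuous_chanDensity (b : Bool) :
    Continuous (fun p : ℝ × ℝ => chanDensity p.1 b p.2) := by
  unfold chanDensity
  exact Continuous.div (by fun_prop) (by fun_prop) fun p => by positivity

theorem measurable_chanDensity (s : ℝ) (b : Bool) : Measurable (chanDensity s b) :=
  ((continuous_chanDensity b).comp (Continuous.prodMk_right s)).measurable

theorem chanDensity_add (s y : ℝ) : chanDensity s true y + chanDensity s false y = 2 := by
  unfold chanDensity
  simp only [bpsk_true, bpsk_false, mul_one, mul_neg, neg_mul, neg_neg]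
  rw [Real.exp_neg]
  have := Real.exp_pos (2 * s * y)
  field_simp
  ring

theorem abs_chanDensity_sub_one_le (s y : ℝ) : |chanDensity s true y - 1| ≤ 1 := by
  rw [abs_le]
  constructor <;> linarith [chanDensity_pos s true y, chanDensity_le_two s true y]

theorem chanDensity_neg (s y : ℝ) : chanDensity s false (-y) = chanDensity s true y := by
  unfold chanDensity; simp [bpsk]

theorem chanDensity_injective_arg {s s' y y' : ℝ}
    (h : chanDensity s true y = chanDensity s' true y') : s * y = s' * y' := by
  unfold chanDensity at h
  rw [div_eq_div_iff (by positivity) (by positivity)] at h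
  have : Real.exp (-(2 * s * bpsk true * y)) = Real.exp (-(2 * s' * bpsk true * y')) := by linarith
  rw [Real.exp_eq_exp, bpsk_true] at this
  linarith

/-- The Gaussian densities centred at `s` and `-s` have ratio `exp (2 * s * y)`, so dividing one of
them by the mixture leaves a logistic function. -/
theorem gaussianReal_eq_mixLaw_withDensity (s : ℝ) (b : Bool) :
    gaussianReal (s * bpsk b) 1
      = (mixLaw s).withDensity fun y => ENNReal.ofReal (chanDensity s b y) := by
  rw [gaussianReal_of_var_ne_zero _ one_ne_zero, mixLaw, ← withDensity_mul _
    (by fun_prop) (measurable_chanDensity s b).ennreal_ofReal]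
  congr 1
  ext1 y
  rw [Pi.mul_apply, ← ENNReal.ofReal_mul (by
    have := gaussianPDFReal_nonneg s 1 y
    have := gaussianPDFReal_nonneg (-s) 1 y
    positivity), gaussianPDF]
  congr 1
  have h2 : gaussianPDFReal s 1 y = gaussianPDFReal (-s) 1 y * Real.exp (2 * s * y) := by
    simp only [gaussianPDFReal, mul_assoc, ← Real.exp_add]
    congr 3
    push_cast
    ring
  cases b
  · simp only [bpsk_false, mul_neg, mul_one, chanDensity, neg_mul, neg_neg, h2]
    have := Real.exp_pos (2 * s * y)
    field_simp
    ring
  · simp only [bpsk_true, mul_one, chanDensity, h2, Real.exp_neg]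
    have := Real.exp_pos (2 * s * y)
    field_simp

instance isProbabilityMeasure_mixLaw (s : ℝ) : IsProbabilityMeasure (mixLaw s) := by
  constructor
  rw [mixLaw, withDensity_apply _ MeasurableSet.univ, Measure.restrict_univ,
    ← ofReal_integral_eq_lintegral_ofReal]
  · rw [integral_div, integral_add (integrable_gaussianPDFReal _ _) (integrable_gaussianPDFReal _ _),
      integral_gaussianPDFReal_eq_one _ one_ne_zero, integral_gaussianPDFReal_eq_one _ one_ne_zero]
    norm_num
  · exact ((integrable_gaussianPDFReal _ _).add (integrable_gaussianPDFReal _ _)).div_const 2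
  · refine ae_of_all _ fun y => ?_
    have := gaussianPDFReal_nonneg s 1 y
    have := gaussianPDFReal_nonneg (-s) 1 y
    simp only [Pi.zero_apply]
    positivity

/-- Posterior mean of the symbol, averaged when the symbol `+1` is sent. -/
noncomputable def gaussMean (s : ℝ) : ℝ := ∫ y, (chanDensity s true y - 1) ∂(gaussianReal s 1)

/-- The symmetric information of the Gaussian channel, in nats. -/
noncomputable def symInfo (s : ℝ) : ℝ :=
  ∫ y, Real.log (chanDensity s true y) ∂(gaussianReal s 1)

theorem abs_log_chanDensity_le (s : ℝ) (b : Bool) (y : ℝ) :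
    |Real.log (chanDensity s b y)| ≤ Real.log 2 + 2 * |s * y| := by
  unfold chanDensity
  have he := Real.exp_pos (-(2 * s * bpsk b * y))
  have h1 : -(2 * s * bpsk b * y) ≤ 2 * |s * y| := by
    calc -(2 * s * bpsk b * y) ≤ |-(2 * s * bpsk b * y)| := le_abs_self _
      _ = 2 * |s * y| := by
        rw [abs_neg, show 2 * s * bpsk b * y = 2 * bpsk b * (s * y) by ring, abs_mul, abs_mul,
          abs_bpsk]; simp
  rw [Real.log_div two_ne_zero (by positivity)]
  have h2 : 0 ≤ Real.log (1 + Real.exp (-(2 * s * bpsk b * y))) := Real.log_nonneg (by linarith)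
  have h3 : Real.log (1 + Real.exp (-(2 * s * bpsk b * y))) ≤ Real.log 2 + 2 * |s * y| := by
    rw [← Real.log_exp (2 * |s * y|), ← Real.log_mul two_ne_zero (Real.exp_pos _).ne']
    refine Real.log_le_log (by positivity) ?_
    have := Real.exp_le_exp.2 h1
    have := Real.one_le_exp (x := 2 * |s * y|) (by positivity)
    linarith
  have h4 := Real.log_nonneg (x := 2) (by norm_num)
  rw [abs_le]
  constructor <;> nlinarith [abs_nonneg (s * y)]

theorem integrable_abs_gaussianReal (m : ℝ) : Integrable (fun y : ℝ => |y|) (gaussianReal m 1) :=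
  ((memLp_id_gaussianReal (μ := m) (v := 1) 1).integrable le_rfl).abs

theorem integrable_log_chanDensity (s : ℝ) (b : Bool) (m : ℝ) :
    Integrable (fun y => Real.log (chanDensity s b y)) (gaussianReal m 1) := by
  refine Integrable.mono' (g := fun y => Real.log 2 + 2 * |s| * |y|)
    ((integrable_const _).add ((integrable_abs_gaussianReal m).const_mul _))
    (Real.measurable_log.comp (measurable_chanDensity s b)).aestronglyMeasurable
    (ae_of_all _ fun y => ?_)
  have := abs_log_chanDensity_le s b y
  rw [abs_mul] at this
  rw [Real.norm_eq_abs]; linarith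

theorem integral_gaussianReal_neg (s : ℝ) {f : ℝ → ℝ} (hf : Measurable f) :
    ∫ y, f (-y) ∂(gaussianReal s 1) = ∫ y, f y ∂(gaussianReal (-s) 1) := by
  rw [← gaussianReal_map_neg, integral_map (by fun_prop) hf.aestronglyMeasurable]

theorem integral_log_chanDensity (s : ℝ) (b : Bool) :
    ∫ y, Real.log (chanDensity s b y) ∂(gaussianReal (s * bpsk b) 1) = symInfo s := by
  cases b
  · rw [bpsk_false, mul_neg_one, ← integral_gaussianReal_neg s
      (f := fun y => Real.log (chanDensity s false y))
      (Real.measurable_log.comp (measurable_chanDensity s false))]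
    simp only [chanDensity_neg, symInfo]
  · rw [bpsk_true, mul_one, symInfo]

theorem integral_gaussianReal_eq_mixLaw (s : ℝ) (b : Bool) (f : ℝ → ℝ) :
    ∫ y, f y ∂(gaussianReal (s * bpsk b) 1) = ∫ y, chanDensity s b y * f y ∂(mixLaw s) := by
  rw [gaussianReal_eq_mixLaw_withDensity, integral_withDensity_ofReal (measurable_chanDensity s b)
    fun y => (chanDensity_pos s b y).le]

theorem integrable_chanDensity_mul {s : ℝ} (b : Bool) {f : ℝ → ℝ} (hf : Integrable f (mixLaw s)) :
    Integrable (fun y => chanDensity s b y * f y) (mixLaw s) :=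
  hf.bdd_mul (c := 2) (measurable_chanDensity s b).aestronglyMeasurable (ae_of_all _ fun y => by
    rw [Real.norm_eq_abs, abs_of_pos (chanDensity_pos s b y)]; exact chanDensity_le_two s b y)

theorem integral_mixLaw {s : ℝ} {f : ℝ → ℝ} (hf : Integrable f (mixLaw s)) :
    ∫ y, f y ∂(mixLaw s) = (∫ y, f y ∂(gaussianReal (s * bpsk true) 1)
      + ∫ y, f y ∂(gaussianReal (s * bpsk false) 1)) / 2 := by
  rw [integral_gaussianReal_eq_mixLaw, integral_gaussianReal_eq_mixLaw,
    ← integral_add (integrable_chanDensity_mul true hf) (integrable_chanDensity_mul false hf),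
    ← integral_div]
  refine integral_congr_ae (ae_of_all _ fun y => ?_)
  have := chanDensity_add s y
  simp only
  linear_combination (-f y / 2) * this

/-- `chanDensity s true - 1` is half the difference of the two conditional densities, that is, the
posterior mean of an equiprobable symbol; this is its defining property. -/
theorem integral_mean_mul_mixLaw {s : ℝ} {f : ℝ → ℝ} (hf : Integrable f (mixLaw s)) :
    ∫ y, (chanDensity s true y - 1) * f y ∂(mixLaw s)
      = (∫ y, f y ∂(gaussianReal (s * bpsk true) 1)
        - ∫ y, f y ∂(gaussianReal (s * bpsk false) 1)) / 2 := by
  rw [integral_gaussianReal_eq_mixLaw, integral_gaussianReal_eq_mixLaw,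
    ← integral_sub (integrable_chanDensity_mul true hf) (integrable_chanDensity_mul false hf),
    ← integral_div]
  refine integral_congr_ae (ae_of_all _ fun y => ?_)
  have := chanDensity_add s y
  simp only
  linear_combination (f y / 2) * this

theorem integrable_mean_mixLaw (s s' : ℝ) :
    Integrable (fun y => chanDensity s true y - 1) (mixLaw s') :=
  integrable_of_abs_le ((measurable_chanDensity s true).sub_const 1)
    fun y => abs_chanDensity_sub_one_le s y

/-- The posterior mean is odd in the output, so its correlation with the symbol is its mean under
the symbol `+1`; by conditioning, that correlation is also its mean square. -/
theorem gaussMean_eq_integral_sq (s : ℝ) :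
    gaussMean s = ∫ y, (chanDensity s true y - 1) ^ 2 ∂(mixLaw s) := by
  have h1 := integral_mean_mul_mixLaw (integrable_mean_mixLaw s s)
  have h2 := integral_mixLaw (integrable_mean_mixLaw s s)
  have h3 := integral_gaussianReal_eq_mixLaw s true (fun y => chanDensity s true y - 1)
  have h4 : ∫ y, (chanDensity s true y - 1) ∂(gaussianReal (s * bpsk false) 1)
      = -∫ y, (chanDensity s true y - 1) ∂(gaussianReal (s * bpsk true) 1) := by
    rw [bpsk_true, bpsk_false, mul_one, mul_neg_one, ← integral_gaussianReal_neg s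
      ((measurable_chanDensity s true).sub_const 1), ← integral_neg]
    refine integral_congr_ae (ae_of_all _ fun y => ?_)
    have a1 := chanDensity_neg s (-y)
    have a2 := chanDensity_add s y
    rw [neg_neg] at a1
    simp only
    linarith
  rw [h4] at h1
  rw [bpsk_true, mul_one] at h1
  simp only [gaussMean, pow_two]
  rw [h1]; ring

theorem gaussMean_nonneg (s : ℝ) : 0 ≤ gaussMean s := by
  rw [gaussMean_eq_integral_sq]; exact integral_nonneg fun y => sq_nonneg _

theorem gaussMean_le_one (s : ℝ) : gaussMean s ≤ 1 := by
  rw [gaussMean]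
  calc _ ≤ ∫ y, (1 : ℝ) ∂(gaussianReal s 1) := by
        refine integral_mono ?_ (integrable_const _) fun y =>
          (abs_le.1 (abs_chanDensity_sub_one_le s y)).2
        exact integrable_of_abs_le ((measurable_chanDensity s true).sub_const 1)
          fun y => abs_chanDensity_sub_one_le s y
    _ = 1 := by simp

/-- Law of the channel output when the word `x` is sent with amplitude `s`. -/
noncomputable def outLaw {n : ℕ} (s : ℝ) (x : Fin n → Bool) : Measure (Fin n → ℝ) :=
  Measure.pi fun j => gaussianReal (s * bpsk (x j)) 1

instance {n : ℕ} (s : ℝ) (x : Fin n → Bool) : IsProbabilityMeasure (outLaw s x) := by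
  unfold outLaw; infer_instance

/-! ### Degradation of the Gaussian channel, and the key inequality for it -/

section Degraded

variable {s₁ s₃ : ℝ}

/-- The degradation of an output at amplitude `s₃` to an output at amplitude `s₁`, with the help
of an independent standard Gaussian variable. -/
noncomputable def degrade (s₁ s₃ : ℝ) (u : ℝ × ℝ) : ℝ :=
  s₁ / s₃ * u.1 + Real.sqrt (1 - (s₁ / s₃) ^ 2) * u.2

theorem measurable_degrade (s₁ s₃ : ℝ) : Measurable (degrade s₁ s₃) := by
  unfold degrade; fun_prop

/-- Scaling by `s₁ / s₃` moves the mean to `s₁ * bpsk b` and leaves variance `(s₁ / s₃) ^ 2`; the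
auxiliary Gaussian restores unit variance. -/
theorem map_degrade (h1 : 0 ≤ s₁) (h3 : s₁ < s₃) (b : Bool) :
    ((gaussianReal (s₃ * bpsk b) 1).prod (gaussianReal 0 1)).map (degrade s₁ s₃)
      = gaussianReal (s₁ * bpsk b) 1 := by
  have h30 : 0 < s₃ := h1.trans_lt h3
  have hle : (s₁ / s₃) ^ 2 ≤ 1 :=
    pow_le_one₀ (by positivity) ((div_le_one h30).2 h3.le)
  set μ := gaussianReal (s₃ * bpsk b) 1
  set ν := gaussianReal 0 1
  have hX : Measure.map (fun u : ℝ × ℝ => s₁ / s₃ * u.1) (μ.prod ν)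
      = gaussianReal (s₁ / s₃ * (s₃ * bpsk b)) (NNReal.mk ((s₁ / s₃) ^ 2) (sq_nonneg _) * 1) := by
    rw [← gaussianReal_map_const_mul]
    have : (fun u : ℝ × ℝ => s₁ / s₃ * u.1) = (fun y => s₁ / s₃ * y) ∘ Prod.fst := rfl
    rw [this, ← Measure.map_map (by fun_prop) measurable_fst, Measure.map_fst_prod]
    simp [μ]
  have hY : Measure.map (fun u : ℝ × ℝ => Real.sqrt (1 - (s₁ / s₃) ^ 2) * u.2) (μ.prod ν)
      = gaussianReal (Real.sqrt (1 - (s₁ / s₃) ^ 2) * 0)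
        (NNReal.mk ((Real.sqrt (1 - (s₁ / s₃) ^ 2)) ^ 2) (sq_nonneg _) * 1) := by
    rw [← gaussianReal_map_const_mul]
    have : (fun u : ℝ × ℝ => Real.sqrt (1 - (s₁ / s₃) ^ 2) * u.2)
      = (fun y => Real.sqrt (1 - (s₁ / s₃) ^ 2) * y) ∘ Prod.snd := rfl
    rw [this, ← Measure.map_map (by fun_prop) measurable_snd, Measure.map_snd_prod]
    simp [ν]
  have hind : (fun u : ℝ × ℝ => s₁ / s₃ * u.1) ⟂ᵢ[μ.prod ν]
      (fun u : ℝ × ℝ => Real.sqrt (1 - (s₁ / s₃) ^ 2) * u.2) :=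
    indepFun_prod (X := fun y : ℝ => s₁ / s₃ * y)
      (Y := fun y : ℝ => Real.sqrt (1 - (s₁ / s₃) ^ 2) * y) (by fun_prop) (by fun_prop)
  have := gaussianReal_add_gaussianReal_of_indepFun hind hX hY
  have hd : degrade s₁ s₃ = (fun u : ℝ × ℝ => s₁ / s₃ * u.1)
      + (fun u : ℝ × ℝ => Real.sqrt (1 - (s₁ / s₃) ^ 2) * u.2) := rfl
  rw [hd, this]
  congr 1
  · field_simp; ring
  · ext
    simp only [mul_one, NNReal.coe_add, NNReal.coe_mk, NNReal.coe_one]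
    have := Real.sq_sqrt (x := 1 - (s₁ / s₃) ^ 2) (by linarith)
    linarith

/-- Mixture law of an output and the auxiliary Gaussian variable. -/
noncomputable def mixPair (s : ℝ) : Measure (ℝ × ℝ) := (mixLaw s).prod (gaussianReal 0 1)

instance (s : ℝ) : IsProbabilityMeasure (mixPair s) := by unfold mixPair; infer_instance

/-- Law of an output and the auxiliary Gaussian variable given the bit. -/
noncomputable def bitPair (s : ℝ) (b : Bool) : Measure (ℝ × ℝ) :=
  (gaussianReal (s * bpsk b) 1).prod (gaussianReal 0 1)

instance (s : ℝ) (b : Bool) : IsProbabilityMeasure (bitPair s b) := by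
  unfold bitPair; infer_instance

theorem bitPair_eq_withDensity (s : ℝ) (b : Bool) :
    bitPair s b = (mixPair s).withDensity fun u => ENNReal.ofReal (chanDensity s b u.1) := by
  have hs : SigmaFinite ((mixLaw s).withDensity fun y => ENNReal.ofReal (chanDensity s b y)) := by
    rw [← gaussianReal_eq_mixLaw_withDensity]; infer_instance
  rw [bitPair, mixPair, gaussianReal_eq_mixLaw_withDensity,
    prod_withDensity_left (measurable_chanDensity s b).ennreal_ofReal]

theorem integral_bitPair (s : ℝ) (b : Bool) (f : ℝ × ℝ → ℝ) :
    ∫ u, f u ∂(bitPair s b) = ∫ u, chanDensity s b u.1 * f u ∂(mixPair s) := by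
  rw [bitPair_eq_withDensity, integral_withDensity_ofReal
    (r := fun u : ℝ × ℝ => chanDensity s b u.1)
    ((measurable_chanDensity s b).comp measurable_fst) fun u => (chanDensity_pos s b u.1).le]

theorem integrable_chanDensity_mul_pair {s : ℝ} (b : Bool) {f : ℝ × ℝ → ℝ}
    (hf : Integrable f (mixPair s)) :
    Integrable (fun u => chanDensity s b u.1 * f u) (mixPair s) :=
  hf.bdd_mul (c := 2) ((measurable_chanDensity s b).comp measurable_fst).aestronglyMeasurable
    (ae_of_all _ fun u => by
      rw [Real.norm_eq_abs, abs_of_pos (chanDensity_pos s b _)]; exact chanDensity_le_two s b _)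

theorem integral_mixPair {s : ℝ} {f : ℝ × ℝ → ℝ} (hf : Integrable f (mixPair s)) :
    ∫ u, f u ∂(mixPair s)
      = (∫ u, f u ∂(bitPair s true) + ∫ u, f u ∂(bitPair s false)) / 2 := by
  rw [integral_bitPair, integral_bitPair, ← integral_add (integrable_chanDensity_mul_pair true hf)
    (integrable_chanDensity_mul_pair false hf), ← integral_div]
  refine integral_congr_ae (ae_of_all _ fun u => ?_)
  have := chanDensity_add s u.1
  simp only
  linear_combination (-f u / 2) * this

theorem integral_mean_mul_mixPair {s : ℝ} {f : ℝ × ℝ → ℝ} (hf : Integrable f (mixPair s)) :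
    ∫ u, (chanDensity s true u.1 - 1) * f u ∂(mixPair s)
      = (∫ u, f u ∂(bitPair s true) - ∫ u, f u ∂(bitPair s false)) / 2 := by
  rw [integral_bitPair, integral_bitPair, ← integral_sub (integrable_chanDensity_mul_pair true hf)
    (integrable_chanDensity_mul_pair false hf), ← integral_div]
  refine integral_congr_ae (ae_of_all _ fun u => ?_)
  have := chanDensity_add s u.1
  simp only
  linear_combination (f u / 2) * this

/-- Half the difference between the posterior means before and after the degradation. -/
noncomputable def meanGap (s₁ s₃ : ℝ) (u : ℝ × ℝ) : ℝ :=
  ((chanDensity s₃ true u.1 - 1) - (chanDensity s₁ true (degrade s₁ s₃ u) - 1)) / 2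

theorem measurable_meanGap (s₁ s₃ : ℝ) : Measurable (meanGap s₁ s₃) :=
  ((((measurable_chanDensity s₃ true).comp measurable_fst).sub_const 1).sub
    (((measurable_chanDensity s₁ true).comp (measurable_degrade s₁ s₃)).sub_const 1)).div_const 2

theorem abs_meanGap_le (s₁ s₃ : ℝ) (u : ℝ × ℝ) : |meanGap s₁ s₃ u| ≤ 1 := by
  have h1 := abs_le.1 (abs_chanDensity_sub_one_le s₃ u.1)
  have h2 := abs_le.1 (abs_chanDensity_sub_one_le s₁ (degrade s₁ s₃ u))
  unfold meanGap
  rw [abs_le]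
  constructor <;> linarith

theorem integral_comp_degrade (h1 : 0 ≤ s₁) (h3 : s₁ < s₃) (b : Bool) {f : ℝ → ℝ}
    (hf : Measurable f) : ∫ u, f (degrade s₁ s₃ u) ∂(bitPair s₃ b)
      = ∫ y, f y ∂(gaussianReal (s₁ * bpsk b) 1) := by
  rw [← map_degrade h1 h3, integral_map (measurable_degrade _ _).aemeasurable
    hf.aestronglyMeasurable, bitPair]

/-- Tower property. Against a function of the degraded output, both posterior means give half the
difference of the two conditional means of that function, and the degraded output has exactly the
law of the channel at `s₁`. -/
theorem integral_meanGap_mul (h1 : 0 ≤ s₁) (h3 : s₁ < s₃) {ψ : ℝ → ℝ} (hψ : Measurable ψ)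
    (hb : ∃ K, ∀ v, |ψ v| ≤ K) :
    ∫ u, meanGap s₁ s₃ u * ψ (degrade s₁ s₃ u) ∂(mixPair s₃) = 0 := by
  obtain ⟨K, hK⟩ := hb
  have hψi : ∀ s, Integrable ψ (mixLaw s) := fun s => integrable_of_abs_le hψ hK
  have hψd : Integrable (fun u => ψ (degrade s₁ s₃ u)) (mixPair s₃) :=
    integrable_of_abs_le (hψ.comp (measurable_degrade _ _)) fun u => hK _
  set T : ℝ → ℝ := fun y => (chanDensity s₁ true y - 1) * ψ y with hT
  have hTm : Measurable T := ((measurable_chanDensity s₁ true).sub_const 1).mul hψ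
  have hTb : ∀ y, |T y| ≤ K := fun y => by
    rw [hT, abs_mul]
    have := mul_le_mul_of_nonneg_right (abs_chanDensity_sub_one_le s₁ y) (abs_nonneg (ψ y))
    linarith [hK y]
  have hTd : Integrable (fun u => T (degrade s₁ s₃ u)) (mixPair s₃) :=
    integrable_of_abs_le (hTm.comp (measurable_degrade _ _)) fun u => hTb _
  have e1 := integral_mean_mul_mixPair hψd
  have e2 := integral_mixPair hTd
  have e3 := integral_mean_mul_mixLaw (hψi s₁)
  have e4 := integral_mixLaw (f := T) (s := s₁) (integrable_of_abs_le hTm hTb)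
  have hi1 : Integrable (fun u : ℝ × ℝ => (chanDensity s₃ true u.1 - 1) * ψ (degrade s₁ s₃ u))
      (mixPair s₃) := by
    refine integrable_of_abs_le ((((measurable_chanDensity s₃ true).comp measurable_fst).sub_const
      1).mul (hψ.comp (measurable_degrade _ _))) (K := K) fun u => ?_
    rw [abs_mul]
    have := mul_le_mul_of_nonneg_right (abs_chanDensity_sub_one_le s₃ u.1)
      (abs_nonneg (ψ (degrade s₁ s₃ u)))
    linarith [hK (degrade s₁ s₃ u)]
  rw [integral_comp_degrade h1 h3 _ hψ, integral_comp_degrade h1 h3 _ hψ] at e1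
  rw [integral_comp_degrade h1 h3 _ hTm, integral_comp_degrade h1 h3 _ hTm] at e2
  calc ∫ u, meanGap s₁ s₃ u * ψ (degrade s₁ s₃ u) ∂(mixPair s₃)
      = ∫ u, ((chanDensity s₃ true u.1 - 1) * ψ (degrade s₁ s₃ u) - T (degrade s₁ s₃ u)) / 2
        ∂(mixPair s₃) := by
        refine integral_congr_ae (ae_of_all _ fun u => ?_)
        simp only [meanGap, hT]; ring
    _ = 0 := by
        rw [integral_div, integral_sub hi1 hTd, e1, e2, ← e3, ← e4]
        simp [hT]

/-- The bit `true` is a direct computation. For `false`, orthogonality to constants says that the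
gap has mean zero under the mixture, so the two conditional means are opposite. -/
theorem integral_meanGap_bitPair (h1 : 0 ≤ s₁) (h3 : s₁ < s₃) (b : Bool) :
    ∫ u, meanGap s₁ s₃ u ∂(bitPair s₃ b) = bpsk b * ((gaussMean s₃ - gaussMean s₁) / 2) := by
  have ht : ∫ u, meanGap s₁ s₃ u ∂(bitPair s₃ true) = (gaussMean s₃ - gaussMean s₁) / 2 := by
    have hm1 := (measurable_chanDensity s₁ true).sub_const 1
    have hm3 := (measurable_chanDensity s₃ true).sub_const 1
    simp only [meanGap]
    rw [integral_div, integral_sub, integral_comp_degrade h1 h3 true hm1]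
    · simp only [bpsk_true, mul_one, gaussMean]
      congr 2
      rw [bitPair, bpsk_true, mul_one]
      have := integral_fun_fst (μ := gaussianReal s₃ 1) (ν := gaussianReal 0 1)
        (fun y => chanDensity s₃ true y - 1)
      simpa using this
    · exact integrable_of_abs_le (hm3.comp measurable_fst) fun u => abs_chanDensity_sub_one_le _ _
    · exact integrable_of_abs_le (hm1.comp (measurable_degrade _ _))
        fun u => abs_chanDensity_sub_one_le _ _
  have h0 := integral_meanGap_mul h1 h3 (ψ := fun _ => 1) measurable_const ⟨1, fun _ => by simp⟩
  simp only [mul_one] at h0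
  rw [integral_mixPair (integrable_of_abs_le (measurable_meanGap _ _) (abs_meanGap_le _ _)), ht] at h0
  cases b
  · rw [bpsk_false]; linarith
  · rw [bpsk_true, ht]; ring

/-- Pythagoras: the posterior mean after degradation is a projection of the one before, so the mean
squares differ by the mean square of the difference, which is `2 * meanGap`. -/
theorem gaussMean_sub_eq (h1 : 0 ≤ s₁) (h3 : s₁ < s₃) :
    gaussMean s₃ - gaussMean s₁ = 4 * ∫ u, meanGap s₁ s₃ u ^ 2 ∂(mixPair s₃) := by
  have hi := integrable_of_abs_le (μ := mixPair s₃) (measurable_meanGap s₁ s₃) (abs_meanGap_le s₁ s₃)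
  have e1 := integral_mean_mul_mixPair hi
  rw [integral_meanGap_bitPair h1 h3, integral_meanGap_bitPair h1 h3, bpsk_true, bpsk_false] at e1
  have e2 := integral_meanGap_mul h1 h3 (ψ := fun y => chanDensity s₁ true y - 1)
    ((measurable_chanDensity s₁ true).sub_const 1) ⟨1, fun y => abs_chanDensity_sub_one_le _ _⟩
  have hm : ∀ s, ∀ f : ℝ × ℝ → ℝ, Measurable f →
      Integrable (fun u => (chanDensity s true (f u) - 1) * meanGap s₁ s₃ u) (mixPair s₃) := by
    intro s f hf
    refine integrable_of_abs_le ((((measurable_chanDensity s true).comp hf).sub_const 1).mul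
      (measurable_meanGap _ _)) (K := 1) fun u => ?_
    rw [abs_mul]
    exact mul_le_one₀ (abs_chanDensity_sub_one_le _ _) (abs_nonneg _) (abs_meanGap_le _ _ _)
  have e3 : ∫ u, meanGap s₁ s₃ u ^ 2 ∂(mixPair s₃)
      = ∫ u, ((chanDensity s₃ true u.1 - 1) * meanGap s₁ s₃ u
        - (chanDensity s₁ true (degrade s₁ s₃ u) - 1) * meanGap s₁ s₃ u) / 2 ∂(mixPair s₃) := by
    refine integral_congr_ae (ae_of_all _ fun u => ?_)
    simp only [meanGap]; ring
  rw [e3, integral_div, integral_sub (hm _ _ measurable_fst) (hm _ _ (measurable_degrade _ _)), e1]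
  simp only [mul_comm _ (meanGap s₁ s₃ _)]
  rw [e2]; ring

/-- Equality would force the gap to vanish almost surely. As the posterior mean is injective in `s *
y`, this is a linear relation between the output and the independent auxiliary Gaussian whose
coefficient at the output is nonzero. For a fixed nonzero output, either that relation is false, or
it confines an atomless variable to one point. -/
theorem gaussMean_lt (h1 : 0 ≤ s₁) (h3 : s₁ < s₃) : gaussMean s₁ < gaussMean s₃ := by
  have h30 : 0 < s₃ := h1.trans_lt h3
  rw [← sub_pos, gaussMean_sub_eq h1 h3]
  refine mul_pos (by norm_num) (lt_of_le_of_ne (integral_nonneg fun u => sq_nonneg _) fun h0 => ?_)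
  rw [eq_comm, integral_eq_zero_iff_of_nonneg (fun u => sq_nonneg _)
    (integrable_of_abs_le ((measurable_meanGap _ _).pow_const 2) (K := 1) fun u => by
      rw [abs_pow]; exact pow_le_one₀ (abs_nonneg _) (abs_meanGap_le _ _ _))] at h0
  have hae : ∀ᵐ u ∂(mixPair s₃), (s₃ - s₁ * (s₁ / s₃)) * u.1
      = s₁ * Real.sqrt (1 - (s₁ / s₃) ^ 2) * u.2 := by
    filter_upwards [h0] with u hu
    have : meanGap s₁ s₃ u = 0 := by simpa using hu
    have h2 : chanDensity s₃ true u.1 = chanDensity s₁ true (degrade s₁ s₃ u) := by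
      unfold meanGap at this; linarith
    have h4 := chanDensity_injective_arg h2
    unfold degrade at h4
    linear_combination h4
  have hk : 0 < s₃ - s₁ * (s₁ / s₃) := by
    have : s₁ / s₃ < 1 := (div_lt_one h30).2 h3
    have h5 : s₁ * (s₁ / s₃) ≤ s₁ := mul_le_of_le_one_right h1 this.le
    linarith
  have hae2 := Measure.ae_ae_of_ae_prod hae
  have hne : ∀ᵐ y ∂(mixLaw s₃), y ≠ 0 := by
    have : ∀ᵐ y ∂(volume : Measure ℝ), y ≠ 0 := by
      simp [ae_iff]
    exact (withDensity_absolutelyContinuous _ _).ae_le this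
  obtain ⟨y, hy, hy0⟩ := (hae2.and hne).exists
  set m := s₁ * Real.sqrt (1 - (s₁ / s₃) ^ 2)
  have hno := nullSingletonClass_gaussianReal (μ := 0) (v := 1) one_ne_zero
  by_cases hm : m = 0
  · obtain ⟨w, hw⟩ := hy.exists
    simp only [hm, zero_mul, mul_eq_zero] at hw
    rcases hw with hw | hw
    · exact hk.ne' hw
    · exact hy0 hw
  · have hz : ∀ᵐ w ∂(gaussianReal 0 1), w ≠ (s₃ - s₁ * (s₁ / s₃)) * y / m := by
      simp [ae_iff]
    obtain ⟨w, hw, hw2⟩ := (hy.and hz).exists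
    apply hw2
    rw [eq_div_iff hm, mul_comm]
    exact hw.symm

/-- The key inequality for the Gaussian channel. -/
theorem sum_sq_extrinsic_gaussian_le {n : ℕ} (h1 : 0 ≤ s₁) (h3 : s₁ < s₃)
    {C : Finset (Fin n → Bool)} (hne : C.Nonempty)
    {e : Fin n → (Fin n → ℝ) → ℝ} (he : ∀ i, Measurable (e i)) (he1 : ∀ i v, |e i v| ≤ 1)
    (hupd : ∀ i v t, e i (Function.update v i t) = e i v)
    (hee : ∀ i, codeAvg C (fun x => bpsk (x i) * ∫ y, e i y ∂(outLaw s₁ x))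
      = codeAvg C (fun x => ∫ y, e i y ^ 2 ∂(outLaw s₁ x)))
    {dec : (Fin n → ℝ) → Fin n → Bool} (hdec : Measurable dec) {ε : ℝ} (hε0 : 0 < ε)
    (hε1 : ε < 1) :
    ((gaussMean s₃ - gaussMean s₁) / 2) ^ 2 / 4
        * ∑ i, codeAvg C (fun x => ∫ y, e i y ^ 2 ∂(outLaw s₁ x))
      ≤ n * symInfo s₃ - Real.log C.card - Real.log (1 - ε)
        + codeAvg C (fun x => (outLaw s₃ x).real {y | dec y ≠ x})
          * (Real.log C.card - Real.log ε) := by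
  have hd : Measurable (fun (u : Fin n → ℝ × ℝ) (j : Fin n) => degrade s₁ s₃ (u j)) :=
    measurable_pi_lambda _ fun j => (measurable_degrade _ _).comp (measurable_pi_apply j)
  have hf : Measurable (fun (u : Fin n → ℝ × ℝ) (j : Fin n) => (u j).1) :=
    measurable_pi_lambda _ fun j => measurable_fst.comp (measurable_pi_apply j)
  have hmap1 : ∀ x : Fin n → Bool, (Measure.pi fun j => bitPair s₃ (x j)).map
      (fun (u : Fin n → ℝ × ℝ) (j : Fin n) => degrade s₁ s₃ (u j)) = outLaw s₁ x := by
    intro x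
    have : ∀ i, SigmaFinite ((bitPair s₃ (x i)).map (degrade s₁ s₃)) := fun i => by
      rw [bitPair, map_degrade h1 h3]; infer_instance
    rw [Measure.pi_map_pi (f := fun _ => degrade s₁ s₃)
      fun i => (measurable_degrade _ _).aemeasurable]
    simp only [bitPair, map_degrade h1 h3, outLaw]
  have hmap3 : ∀ x : Fin n → Bool, (Measure.pi fun j => bitPair s₃ (x j)).map
      (fun (u : Fin n → ℝ × ℝ) (j : Fin n) => (u j).1) = outLaw s₃ x := by
    intro x
    have hfst : ∀ b, (bitPair s₃ b).map Prod.fst = gaussianReal (s₃ * bpsk b) 1 := fun b => by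
      rw [bitPair, Measure.map_fst_prod]; simp
    have : ∀ i, SigmaFinite ((bitPair s₃ (x i)).map Prod.fst) := fun i => by
      rw [hfst]; infer_instance
    rw [Measure.pi_map_pi (f := fun _ => Prod.fst) fun i => measurable_fst.aemeasurable]
    simp only [hfst, outLaw]
  have hint : ∀ x : Fin n → Bool, ∀ f : (Fin n → ℝ) → ℝ, Measurable f →
      ∫ u, f (fun j => degrade s₁ s₃ (u j)) ∂(Measure.pi fun j => bitPair s₃ (x j))
        = ∫ y, f y ∂(outLaw s₁ x) := by
    intro x f hfm
    rw [← hmap1, integral_map hd.aemeasurable hfm.aestronglyMeasurable]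
  have hupd' : ∀ i (u : Fin n → ℝ × ℝ) t, e i (fun j => degrade s₁ s₃ (Function.update u i t j))
      = e i (fun j => degrade s₁ s₃ (u j)) := by
    intro i u t
    rw [← hupd i (fun j => degrade s₁ s₃ (u j)) (degrade s₁ s₃ t)]
    congr 1
    ext j
    by_cases hj : j = i
    · subst hj; simp
    · simp [hj]
  have hlogint : ∀ b, Integrable (fun u : ℝ × ℝ => Real.log (chanDensity s₃ b u.1))
      (bitPair s₃ b) := fun b => (integrable_log_chanDensity s₃ b _).comp_fst _
  have key := sum_sq_extrinsic_le (mixPair s₃) (bitPair s₃) (r := fun b u => chanDensity s₃ b u.1)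
    (fun b => (measurable_chanDensity s₃ b).comp measurable_fst)
    (fun b u => chanDensity_pos _ _ _) (fun b u => chanDensity_le_two _ _ _)
    (fun b => bitPair_eq_withDensity s₃ b) (J := symInfo s₃) hlogint
    (fun b => by
      rw [bitPair, integral_fun_fst (μ := gaussianReal (s₃ * bpsk b) 1)
        (fun y => Real.log (chanDensity s₃ b y)), integral_log_chanDensity]
      simp)
    (measurable_meanGap s₁ s₃) (abs_meanGap_le s₁ s₃)
    (c := (gaussMean s₃ - gaussMean s₁) / 2) (by linarith [gaussMean_lt h1 h3])
    (by linarith [gaussMean_nonneg s₁, gaussMean_le_one s₃])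
    (integral_meanGap_bitPair h1 h3)
    (E := fun i u => e i (fun j => degrade s₁ s₃ (u j)))
    (fun i => (he i).comp hd) (fun i u => he1 i _) hupd'
    (integral_prod_one_add_eq_one (mixPair s₃) (measurable_degrade s₁ s₃) (measurable_meanGap _ _)
      (abs_meanGap_le _ _) (fun ψ hψ hb => integral_meanGap_mul h1 h3 hψ hb) he he1 hupd _ _)
    hne (fun i => by
      simp only [hint _ _ (he i), hint _ (fun y => e i y ^ 2) ((he i).pow_const 2)]
      exact hee i)
    (dec := fun u => dec (fun j => (u j).1)) (hdec.comp hf) hε0 hε1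
  simp only [hint _ (fun y => e _ y ^ 2) ((he _).pow_const 2)] at key
  have herr : ∀ x : Fin n → Bool, (Measure.pi fun j => bitPair s₃ (x j)).real
      {u | dec (fun j => (u j).1) ≠ x} = (outLaw s₃ x).real {y | dec y ≠ x} := by
    intro x
    have hS : MeasurableSet {y | dec y ≠ x} := (hdec (measurableSet_singleton x)).compl
    rw [← hmap3, map_measureReal_apply hf hS]
    rfl
  simp only [herr] at key
  exact key

end Degraded

/-! ### The law of the code, posterior probabilities and extrinsic means -/

section Posterior

variable {n : ℕ}

/-- Law of the output when `x` is sent with amplitude `s j` at position `j`. -/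
noncomputable def outLawVec (s : Fin n → ℝ) (x : Fin n → Bool) : Measure (Fin n → ℝ) :=
  Measure.pi fun j => gaussianReal (s j * bpsk (x j)) 1

instance (s : Fin n → ℝ) (x : Fin n → Bool) : IsProbabilityMeasure (outLawVec s x) := by
  unfold outLawVec; infer_instance

/-- Density of the output law with respect to the product of the mixtures. -/
noncomputable def codeDensity (s : Fin n → ℝ) (x : Fin n → Bool) (y : Fin n → ℝ) : ℝ :=
  ∏ j, chanDensity (s j) (x j) (y j)

theorem codeDensity_pos (s : Fin n → ℝ) (x : Fin n → Bool) (y : Fin n → ℝ) :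
    0 < codeDensity s x y := Finset.prod_pos fun _ _ => chanDensity_pos _ _ _

theorem continuous_codeDensity (x : Fin n → Bool) :
    Continuous (fun p : (Fin n → ℝ) × (Fin n → ℝ) => codeDensity p.1 x p.2) := by
  unfold codeDensity
  refine continuous_finsetProd _ fun j _ => ?_
  exact (continuous_chanDensity (x j)).comp
    (f := fun p : (Fin n → ℝ) × (Fin n → ℝ) => (p.1 j, p.2 j)) (by fun_prop)

theorem outLawVec_eq_withDensity (s : Fin n → ℝ) (x : Fin n → Bool) :
    outLawVec s x = (Measure.pi fun j => mixLaw (s j)).withDensity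
      fun y => ENNReal.ofReal (codeDensity s x y) := by
  unfold outLawVec codeDensity
  have : ∀ j, SigmaFinite ((mixLaw (s j)).withDensity
      fun y => ENNReal.ofReal (chanDensity (s j) (x j) y)) := fun j => by
    rw [← gaussianReal_eq_mixLaw_withDensity]; infer_instance
  simp only [gaussianReal_eq_mixLaw_withDensity]
  exact pi_withDensity_ofReal (fun j => mixLaw (s j)) (fun j => chanDensity (s j) (x j))
    (fun j u => (chanDensity_pos _ _ _).le) fun j =>
      integrable_of_abs_le (measurable_chanDensity _ _) (K := 2) fun u => by
        rw [abs_of_pos (chanDensity_pos _ _ _)]; exact chanDensity_le_two _ _ _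

/-- Posterior probability of the codeword `x` given the output `y`. -/
noncomputable def codePost (C : Finset (Fin n → Bool)) (s y : Fin n → ℝ) (x : Fin n → Bool) : ℝ :=
  codeDensity s x y / ∑ x' ∈ C, codeDensity s x' y

theorem sum_codeDensity_pos {C : Finset (Fin n → Bool)} (hne : C.Nonempty) (s y : Fin n → ℝ) :
    0 < ∑ x' ∈ C, codeDensity s x' y := Finset.sum_pos (fun x _ => codeDensity_pos s x y) hne

theorem codePost_nonneg (C : Finset (Fin n → Bool)) (s y : Fin n → ℝ) (x : Fin n → Bool) :
    0 ≤ codePost C s y x :=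
  div_nonneg (codeDensity_pos s x y).le (Finset.sum_nonneg fun x _ => (codeDensity_pos s x y).le)

theorem sum_codePost {C : Finset (Fin n → Bool)} (hne : C.Nonempty) (s y : Fin n → ℝ) :
    ∑ x ∈ C, codePost C s y x = 1 := by
  unfold codePost
  rw [← Finset.sum_div, div_self (sum_codeDensity_pos hne s y).ne']

theorem abs_sum_codePost_mul_le {C : Finset (Fin n → Bool)} (hne : C.Nonempty) (s y : Fin n → ℝ)
    {f : (Fin n → Bool) → ℝ} {K : ℝ} (hf : ∀ x, |f x| ≤ K) :
    |∑ x ∈ C, codePost C s y x * f x| ≤ K := by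
  refine (Finset.abs_sum_le_sum_abs _ _).trans ?_
  calc ∑ x ∈ C, |codePost C s y x * f x| ≤ ∑ x ∈ C, codePost C s y x * K :=
        Finset.sum_le_sum fun x _ => by
          rw [abs_mul, abs_of_nonneg (codePost_nonneg C s y x)]
          exact mul_le_mul_of_nonneg_left (hf x) (codePost_nonneg C s y x)
    _ = K := by rw [← Finset.sum_mul, sum_codePost hne, one_mul]

theorem continuous_codePost {C : Finset (Fin n → Bool)} (hne : C.Nonempty) (x : Fin n → Bool) :
    Continuous (fun p : (Fin n → ℝ) × (Fin n → ℝ) => codePost C p.1 p.2 x) :=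
  (continuous_codeDensity x).div (continuous_finsetSum _ fun x _ => continuous_codeDensity x)
    fun p => (sum_codeDensity_pos hne p.1 p.2).ne'

theorem measurable_codePost {C : Finset (Fin n → Bool)} (hne : C.Nonempty) (s : Fin n → ℝ)
    (x : Fin n → Bool) : Measurable (fun y => codePost C s y x) :=
  ((continuous_codePost hne x).comp (Continuous.prodMk_right s)).measurable

/-- Averaging over the posterior does not change a mean. -/
theorem codeAvg_integral_codePost {C : Finset (Fin n → Bool)} (hne : C.Nonempty)
    (s : Fin n → ℝ) {F : (Fin n → Bool) → (Fin n → ℝ) → ℝ} (hF : ∀ x, Measurable (F x)) {K : ℝ}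
    (hK : ∀ x y, |F x y| ≤ K) :
    codeAvg C (fun x => ∫ y, F x y ∂(outLawVec s x))
      = codeAvg C (fun x => ∫ y, ∑ x' ∈ C, codePost C s y x' * F x' y ∂(outLawVec s x)) := by
  set M := Measure.pi fun j => mixLaw (s j)
  have hm : ∀ x, Measurable (codeDensity s x) := fun x =>
    ((continuous_codeDensity x).comp (Continuous.prodMk_right s)).measurable
  have hb : ∀ x y, |codeDensity s x y| ≤ 2 ^ n := fun x y => by
    refine (abs_prod_le_pow_card _ _ (K := 2) fun i _ => ?_).trans (by simp)
    rw [abs_of_pos (chanDensity_pos _ _ _)]; exact chanDensity_le_two _ _ _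
  have hchg : ∀ x, ∀ f : (Fin n → ℝ) → ℝ, ∫ y, f y ∂(outLawVec s x)
      = ∫ y, codeDensity s x y * f y ∂M := fun x f => by
    rw [outLawVec_eq_withDensity, integral_withDensity_ofReal (hm x)
      fun y => (codeDensity_pos s x y).le]
  have hSm : Measurable (fun y => ∑ x' ∈ C, codePost C s y x' * F x' y) :=
    Finset.measurable_sum _ fun x' _ => (measurable_codePost hne s x').mul (hF x')
  simp only [hchg]
  unfold codeAvg
  congr 1
  rw [← integral_finsetSum, ← integral_finsetSum]
  · refine integral_congr_ae (ae_of_all _ fun y => ?_)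
    simp only
    rw [← Finset.sum_mul, Finset.mul_sum]
    refine Finset.sum_congr rfl fun x _ => ?_
    have := (sum_codeDensity_pos hne s y).ne'
    unfold codePost
    field_simp
  · intro x _
    refine integrable_of_abs_le ((hm x).mul hSm) (K := 2 ^ n * K) fun y => ?_
    rw [abs_mul]
    exact mul_le_mul (hb x y) (abs_sum_codePost_mul_le hne s y fun x' => hK x' y) (abs_nonneg _)
      (by positivity)
  · intro x _
    refine integrable_of_abs_le ((hm x).mul (hF x)) (K := 2 ^ n * K) fun y => ?_
    rw [abs_mul]
    exact mul_le_mul (hb x y) (hK x y) (abs_nonneg _) (by positivity)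

/-- The amplitudes of the channel that erases position `i`. -/
noncomputable def extAmp (s : ℝ) (i : Fin n) : Fin n → ℝ := Function.update (fun _ => s) i 0

/-- Conditional mean of the `i`-th symbol given the other outputs. -/
noncomputable def extMean (C : Finset (Fin n → Bool)) (s : ℝ) (i : Fin n) (y : Fin n → ℝ) : ℝ :=
  ∑ x ∈ C, codePost C (extAmp s i) y x * bpsk (x i)

/-- At amplitude 0 the likelihood is flat, so the position counts as erased. Extrinsic posteriors
thus become ordinary posteriors for the amplitudes `extAmp`. -/
theorem chanDensity_zero (b : Bool) (y : ℝ) : chanDensity 0 b y = 1 := by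
  unfold chanDensity; norm_num

theorem codeDensity_extAmp_mul (s : ℝ) (i : Fin n) (x : Fin n → Bool) (y : Fin n → ℝ) :
    codeDensity (fun _ => s) x y = codeDensity (extAmp s i) x y * chanDensity s (x i) (y i) := by
  unfold codeDensity
  rw [← Finset.mul_prod_erase _ _ (Finset.mem_univ i),
    ← Finset.mul_prod_erase Finset.univ (fun j => chanDensity (extAmp s i j) (x j) (y j))
      (Finset.mem_univ i)]
  have : ∏ j ∈ Finset.univ.erase i, chanDensity (extAmp s i j) (x j) (y j)
      = ∏ j ∈ Finset.univ.erase i, chanDensity s (x j) (y j) :=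
    Finset.prod_congr rfl fun j hj => by
      rw [extAmp, Function.update_of_ne (Finset.ne_of_mem_erase hj)]
  rw [this, extAmp, Function.update_self, chanDensity_zero]
  ring

theorem codeDensity_extAmp_update (s : ℝ) (i : Fin n) (x : Fin n → Bool) (y : Fin n → ℝ) (t : ℝ) :
    codeDensity (extAmp s i) x (Function.update y i t) = codeDensity (extAmp s i) x y := by
  unfold codeDensity
  refine Finset.prod_congr rfl fun j _ => ?_
  by_cases hj : j = i
  · subst hj; simp [extAmp, chanDensity_zero]
  · rw [Function.update_of_ne hj]

theorem extMean_update (C : Finset (Fin n → Bool)) (s : ℝ) (i : Fin n) (y : Fin n → ℝ) (t : ℝ) :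
    extMean C s i (Function.update y i t) = extMean C s i y := by
  simp only [extMean, codePost, codeDensity_extAmp_update]

theorem abs_extMean_le {C : Finset (Fin n → Bool)} (hne : C.Nonempty) (s : ℝ) (i : Fin n)
    (y : Fin n → ℝ) : |extMean C s i y| ≤ 1 :=
  abs_sum_codePost_mul_le hne _ _ fun _ => (abs_bpsk _).le

theorem continuous_extAmp (i : Fin n) : Continuous (fun s : ℝ => extAmp s i) := by
  refine continuous_pi fun j => ?_
  by_cases hj : j = i
  · subst hj; simpa [extAmp] using continuous_const
  · simpa [extAmp, hj] using continuous_id'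

theorem continuous_extMean {C : Finset (Fin n → Bool)} (hne : C.Nonempty) (i : Fin n) :
    Continuous (fun p : ℝ × (Fin n → ℝ) => extMean C p.1 i p.2) := by
  have h : Continuous (fun p : ℝ × (Fin n → ℝ) => (extAmp p.1 i, p.2)) :=
    ((continuous_extAmp i).comp continuous_fst).prodMk continuous_snd
  have h2 : ∀ x : Fin n → Bool,
      Continuous (fun p : ℝ × (Fin n → ℝ) => codePost C (extAmp p.1 i) p.2 x) := by
    intro x
    have h1 := continuous_codePost hne x
    have h3 := h1.comp h
    exact h3
  unfold extMean
  exact continuous_finsetSum _ fun x _ => (h2 x).mul_const _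

theorem measurable_extMean {C : Finset (Fin n → Bool)} (hne : C.Nonempty) (s : ℝ) (i : Fin n) :
    Measurable (extMean C s i) :=
  ((continuous_extMean hne i).comp (Continuous.prodMk_right s)).measurable

/-- Passes between the true channel and the one that erases position `i`, for functions that ignore
this position; Bayes' rule is applied on the erased side. -/
theorem integral_outLaw_eq_extAmp (s : ℝ) (i : Fin n) (x : Fin n → Bool) {E : (Fin n → ℝ) → ℝ}
    (hE : ∀ y t, E (Function.update y i t) = E y) (hEm : Measurable E) :
    ∫ y, E y ∂(outLaw s x) = ∫ y, E y ∂(outLawVec (extAmp s i) x) := by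
  refine integral_pi_congr_of_ne _ _ i (fun j hj => ?_) hE hEm
  rw [extAmp, Function.update_of_ne hj]

/-- The extrinsic mean is the conditional mean of the symbol given the other outputs. -/
theorem codeAvg_bpsk_mul {C : Finset (Fin n → Bool)} (hne : C.Nonempty) (s : ℝ) (i : Fin n)
    {ψ : (Fin n → ℝ) → ℝ} (hψ : ∀ y t, ψ (Function.update y i t) = ψ y) (hψm : Measurable ψ) {K : ℝ}
    (hK : ∀ y, |ψ y| ≤ K) :
    codeAvg C (fun x => bpsk (x i) * ∫ y, ψ y ∂(outLaw s x))
      = codeAvg C (fun x => ∫ y, extMean C s i y * ψ y ∂(outLaw s x)) := by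
  have h := codeAvg_integral_codePost hne (extAmp s i) (F := fun x y => bpsk (x i) * ψ y)
    (fun x => hψm.const_mul _) (K := K) (fun x y => by rw [abs_mul, abs_bpsk, one_mul]; exact hK y)
  have e1 : ∀ x : Fin n → Bool, ∫ y, extMean C s i y * ψ y ∂(outLaw s x)
      = ∫ y, ∑ x' ∈ C, codePost C (extAmp s i) y x' * (bpsk (x' i) * ψ y)
        ∂(outLawVec (extAmp s i) x) := by
    intro x
    rw [integral_outLaw_eq_extAmp s i x (E := fun y => extMean C s i y * ψ y) (fun y t => by rw [extMean_update, hψ])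
      ((measurable_extMean hne s i).mul hψm)]
    refine integral_congr_ae (ae_of_all _ fun y => ?_)
    simp only [extMean, Finset.sum_mul, mul_assoc]
  simp only [e1, integral_outLaw_eq_extAmp s i _ hψ hψm, ← integral_const_mul]
  exact h

/-- Mean square of the extrinsic mean. -/
noncomputable def sqExtMean (C : Finset (Fin n → Bool)) (s : ℝ) (i : Fin n) : ℝ :=
  codeAvg C (fun x => ∫ y, extMean C s i y ^ 2 ∂(outLaw s x))

theorem codeAvg_bpsk_mul_extMean {C : Finset (Fin n → Bool)} (hne : C.Nonempty) (s : ℝ)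
    (i : Fin n) : codeAvg C (fun x => bpsk (x i) * ∫ y, extMean C s i y ∂(outLaw s x))
      = sqExtMean C s i := by
  rw [codeAvg_bpsk_mul hne s i (extMean_update C s i) (measurable_extMean hne s i)
    (abs_extMean_le hne s i), sqExtMean]
  simp only [pow_two]

theorem sum_sqExtMean_le {s₁ s₃ : ℝ} (h1 : 0 ≤ s₁) (h3 : s₁ < s₃) {C : Finset (Fin n → Bool)}
    (hne : C.Nonempty) {dec : (Fin n → ℝ) → Fin n → Bool} (hdec : Measurable dec) {ε : ℝ}
    (hε0 : 0 < ε) (hε1 : ε < 1) :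
    ((gaussMean s₃ - gaussMean s₁) / 2) ^ 2 / 4 * ∑ i, sqExtMean C s₁ i
      ≤ n * symInfo s₃ - Real.log C.card - Real.log (1 - ε)
        + codeAvg C (fun x => (outLaw s₃ x).real {y | dec y ≠ x})
          * (Real.log C.card - Real.log ε) :=
  sum_sq_extrinsic_gaussian_le h1 h3 hne (fun i => measurable_extMean hne s₁ i)
    (fun i => abs_extMean_le hne s₁ i) (fun i => extMean_update C s₁ i)
    (fun i => codeAvg_bpsk_mul_extMean hne s₁ i) hdec hε0 hε1

/-- Posterior weight of the bit value `b` at position `i`, given the other outputs. -/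
theorem sum_codePost_bit {C : Finset (Fin n → Bool)} (hne : C.Nonempty) (s : ℝ) (i : Fin n)
    (y : Fin n → ℝ) (b : Bool) :
    ∑ x ∈ C, codePost C (extAmp s i) y x * (if x i = b then 1 else 0)
      = (1 + bpsk b * extMean C s i y) / 2 := by
  have hind : ∀ x : Fin n → Bool, (if x i = b then (1 : ℝ) else 0)
      = (1 + bpsk b * bpsk (x i)) / 2 := by
    intro x
    cases b <;> cases hx : x i <;> simp [bpsk]
  have h1 := sum_codePost hne (extAmp s i) y
  simp only [hind, extMean, Finset.mul_sum]
  conv_rhs => rw [← h1]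
  rw [← Finset.sum_add_distrib, Finset.sum_div]
  refine Finset.sum_congr rfl fun x _ => ?_
  ring

theorem exp_le_chanDensity (s : ℝ) (b : Bool) (y : ℝ) :
    Real.exp (-(2 * |s| * |y|)) ≤ chanDensity s b y := by
  have h1 : -(2 * s * bpsk b * y) ≤ 2 * |s| * |y| := by
    refine (le_abs_self _).trans_eq ?_
    rw [abs_neg, abs_mul, abs_mul, abs_mul, abs_bpsk]; simp
  have h2 := Real.exp_le_exp.2 h1
  have h3 := Real.one_le_exp (x := 2 * |s| * |y|) (by positivity)
  rw [chanDensity, le_div_iff₀ (by positivity), Real.exp_neg, inv_mul_le_iff₀ (Real.exp_pos _)]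
  linarith

/-- Adding the observation `y i` multiplies the extrinsic weight of `b` by `chanDensity s b (y i)`
and renormalises by a factor at most 2. The likelihood is at least `exp (-(2 * |s| * |y i|))`, so no
value of the bit is excluded. -/
theorem le_sum_codePost_bit {C : Finset (Fin n → Bool)} (hne : C.Nonempty) (s : ℝ) (i : Fin n)
    (y : Fin n → ℝ) (b : Bool) :
    (1 - extMean C s i y ^ 2) / 4 * (Real.exp (-(2 * |s| * |y i|)) / 2)
      ≤ ∑ x ∈ C, codePost C (fun _ => s) y x * (if x i = b then 1 else 0) := by
  set e := extMean C s i y with he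
  have he1 := abs_le.1 (abs_extMean_le hne s i y)
  set W := ∑ x ∈ C, codeDensity (extAmp s i) x y with hW
  have hWpos : 0 < W := sum_codeDensity_pos hne _ _
  have hden : ∑ x ∈ C, codeDensity (fun _ => s) x y ≤ 2 * W := by
    rw [hW, Finset.mul_sum]
    refine Finset.sum_le_sum fun x _ => ?_
    rw [codeDensity_extAmp_mul s i, mul_comm]
    exact mul_le_mul_of_nonneg_right (chanDensity_le_two _ _ _) (codeDensity_pos _ _ _).le
  have hdpos := sum_codeDensity_pos hne (fun _ => s) y
  -- `(1 - e ^ 2) / 4` is the product of the extrinsic probabilities of the two bit values, hence at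
  -- most either of them.
  have hp : 0 ≤ (1 + bpsk b * e) / 2 ∧ (1 - e ^ 2) / 4 ≤ (1 + bpsk b * e) / 2 := by
    cases b
    · rw [bpsk_false]; constructor <;> nlinarith
    · rw [bpsk_true]; constructor <;> nlinarith
  calc (1 - e ^ 2) / 4 * (Real.exp (-(2 * |s| * |y i|)) / 2)
      ≤ (1 + bpsk b * e) / 2 * (chanDensity s b (y i) / 2) := by
        refine mul_le_mul hp.2 ?_ (by positivity) hp.1
        linarith [exp_le_chanDensity s b (y i)]
    _ = ∑ x ∈ C, codePost C (extAmp s i) y x * (if x i = b then 1 else 0)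
          * (chanDensity s b (y i) / 2) := by
        rw [← Finset.sum_mul, sum_codePost_bit hne]
    _ ≤ _ := by
        refine Finset.sum_le_sum fun x _ => ?_
        by_cases hx : x i = b
        · simp only [hx, if_true, mul_one, codePost]
          rw [codeDensity_extAmp_mul s i x y, hx, ← hW, div_mul_div_comm, mul_comm W 2]
          exact div_le_div_of_nonneg_left
            (mul_pos (codeDensity_pos _ _ _) (chanDensity_pos _ _ _)).le hdpos hden
        · simp [hx]

/-- The chance that the noise at a position keeps the two bit values comparable. -/
noncomputable def noiseFactor (s : ℝ) : ℝ :=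
  ∫ y, Real.exp (-(2 * |s| * |y|)) / 2 ∂(gaussianReal s 1)

theorem measurable_noise (s : ℝ) : Measurable fun y : ℝ => Real.exp (-(2 * |s| * |y|)) / 2 := by
  fun_prop

theorem abs_noise_le (s y : ℝ) : |Real.exp (-(2 * |s| * |y|)) / 2| ≤ 1 := by
  rw [abs_of_pos (by positivity)]
  have := Real.exp_le_one_iff.2 (show -(2 * |s| * |y|) ≤ 0 by
    rw [neg_nonpos]; positivity)
  linarith

theorem noiseFactor_pos (s : ℝ) : 0 < noiseFactor s := by
  unfold noiseFactor
  rw [integral_pos_iff_support_of_nonneg (fun y => by positivity)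
    (integrable_of_abs_le (measurable_noise s) (abs_noise_le s))]
  have : Function.support (fun y : ℝ => Real.exp (-(2 * |s| * |y|)) / 2) = Set.univ := by
    ext y; simp
  rw [this]; simp

theorem integral_noise (s : ℝ) (b : Bool) :
    ∫ y, Real.exp (-(2 * |s| * |y|)) / 2 ∂(gaussianReal (s * bpsk b) 1) = noiseFactor s := by
  cases b
  · rw [bpsk_false, mul_neg_one, ← integral_gaussianReal_neg s (measurable_noise s)]
    simp only [abs_neg, noiseFactor]
  · rw [bpsk_true, mul_one, noiseFactor]

/-- Good decoding forces the extrinsic means to be close to `±1`. -/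
theorem noiseFactor_mul_le {C : Finset (Fin n → Bool)} (hne : C.Nonempty) (s : ℝ) (i : Fin n)
    {dec : (Fin n → ℝ) → Fin n → Bool} (hdec : Measurable dec) :
    noiseFactor s * ((1 - sqExtMean C s i) / 4)
      ≤ codeAvg C (fun x => (outLaw s x).real {y | dec y ≠ x}) := by
  have hdi : Measurable (fun y => dec y i) := (measurable_pi_apply i).comp hdec
  have hbS : ∀ b, MeasurableSet {y | dec y i ≠ b} := fun b =>
    (hdi (measurableSet_singleton b)).compl
  have hFm : ∀ x : Fin n → Bool, Measurable (fun y => if dec y i ≠ x i then (1 : ℝ) else 0) :=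
    fun x => Measurable.ite (hbS (x i)) measurable_const measurable_const
  have hB := codeAvg_integral_codePost hne (fun _ => s)
    (F := fun x y => if dec y i ≠ x i then (1 : ℝ) else 0) hFm (K := 1)
    (fun x y => by split_ifs <;> simp)
  have hpt : ∀ y, (1 - extMean C s i y ^ 2) / 4 * (Real.exp (-(2 * |s| * |y i|)) / 2)
      ≤ ∑ x' ∈ C, codePost C (fun _ => s) y x' * (if dec y i ≠ x' i then (1 : ℝ) else 0) := by
    intro y
    -- The posterior probability of an error at position `i` is the posterior weight of the bit
    -- opposite to the decoded one.
    refine (le_sum_codePost_bit hne s i y (!(dec y i))).trans_eq ?_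
    refine Finset.sum_congr rfl fun x _ => ?_
    cases dec y i <;> cases x i <;> simp
  have hEm : Measurable (fun y => (1 - extMean C s i y ^ 2) / 4) :=
    (((measurable_extMean hne s i).pow_const 2).const_sub 1).div_const 4
  have hsq : ∀ y, 0 ≤ extMean C s i y ^ 2 ∧ extMean C s i y ^ 2 ≤ 1 := fun y => by
    refine ⟨sq_nonneg _, ?_⟩
    rw [← sq_abs]; exact pow_le_one₀ (abs_nonneg _) (abs_extMean_le hne s i y)
  have hEb : ∀ y, |(1 - extMean C s i y ^ 2) / 4| ≤ 1 := fun y => by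
    have := hsq y
    rw [abs_le]; constructor <;> linarith
  have hint : ∀ x : Fin n → Bool, Integrable (fun y : Fin n → ℝ => (1 - extMean C s i y ^ 2) / 4
      * (Real.exp (-(2 * |s| * |y i|)) / 2)) (outLaw s x) := fun x =>
    integrable_of_abs_le (hEm.mul ((measurable_noise s).comp (measurable_pi_apply i))) (K := 1)
      fun y => by
        rw [abs_mul]; exact mul_le_one₀ (hEb y) (abs_nonneg _) (abs_noise_le _ _)
  have hprod : ∀ x : Fin n → Bool, ∫ y, (1 - extMean C s i y ^ 2) / 4
      * (Real.exp (-(2 * |s| * |y i|)) / 2) ∂(outLaw s x)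
      = noiseFactor s * ((1 - ∫ y, extMean C s i y ^ 2 ∂(outLaw s x)) / 4) := by
    intro x
    -- Given the codeword, the extrinsic mean and the noise factor at position `i` are independent.
    have := integral_pi_mul_coord (fun j => gaussianReal (s * bpsk (x j)) 1) i
      (E := fun y => (1 - extMean C s i y ^ 2) / 4) (h := fun t => Real.exp (-(2 * |s| * |t|)) / 2)
      (fun y t => by rw [extMean_update]) (hint x)
    rw [outLaw, this, integral_noise, integral_div, integral_sub (integrable_const _)]
    · simp [mul_comm]
    · exact integrable_of_abs_le ((measurable_extMean hne s i).pow_const 2) (K := 1) fun y => by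
        rw [abs_of_nonneg (hsq y).1]; exact (hsq y).2
  calc noiseFactor s * ((1 - sqExtMean C s i) / 4)
      = codeAvg C (fun x => noiseFactor s
          * ((1 - ∫ y, extMean C s i y ^ 2 ∂(outLaw s x)) / 4)) := by
        rw [codeAvg_const_mul]
        simp only [div_eq_inv_mul]
        rw [codeAvg_const_mul, codeAvg_sub, codeAvg_const hne, sqExtMean]
    _ ≤ codeAvg C (fun x => ∫ y, ∑ x' ∈ C, codePost C (fun _ => s) y x'
          * (if dec y i ≠ x' i then (1 : ℝ) else 0) ∂(outLawVec (fun _ => s) x)) := by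
        refine codeAvg_mono fun x _ => ?_
        rw [← hprod]
        refine integral_mono (hint x) ?_ hpt
        refine integrable_of_abs_le (Finset.measurable_sum _ fun x' _ =>
          (measurable_codePost hne _ x').mul (hFm x')) (K := 1) fun y => ?_
        exact abs_sum_codePost_mul_le hne _ y fun x' => by split_ifs <;> simp
    _ = codeAvg C (fun x => ∫ y, (if dec y i ≠ x i then (1 : ℝ) else 0)
          ∂(outLawVec (fun _ => s) x)) := hB.symm
    _ ≤ _ := by
        refine codeAvg_mono fun x _ => ?_
        have : ∀ y, (if dec y i ≠ x i then (1 : ℝ) else 0)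
            = {y | dec y i ≠ x i}.indicator (fun _ => (1 : ℝ)) y := fun y => by
          simp [Set.indicator_apply]
        simp only [this]
        rw [integral_indicator_const _ (hbS (x i)), smul_eq_mul, mul_one]
        exact measureReal_mono fun y hy hyx => hy (by simp [hyx])

end Posterior

/-! ### The probability space of the code: extrinsic probabilities and LLRs as functions of the
extrinsic mean -/

section CodeLaw

open BinaryCode

variable {n : ℕ}

theorem integral_uniformOn_finset {α : Type*} [Fintype α] [MeasurableSpace α]
    [MeasurableSingletonClass α] {C : Finset α} (f : α → ℝ) :
    ∫ x, f x ∂(uniformOn (C : Set α)) = (∑ x ∈ C, f x) / C.card := by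
  classical
  rw [integral_fintype (by
    rcases C.eq_empty_or_nonempty with h | h
    · subst h; simp
    · have := isProbabilityMeasure_uniformOn C.finite_toSet h
      exact Integrable.of_finite)]
  have : ∀ x, (uniformOn (C : Set α)).real {x} = if x ∈ C then (C.card : ℝ)⁻¹ else 0 := by
    intro x
    have h := uniformOn_apply_finset (Ω := α) (s := C) (t := {x})
    rw [Finset.coe_singleton] at h
    rw [measureReal_def, h]
    split_ifs with hx
    · rw [Finset.inter_singleton_of_mem hx]; simp
    · rw [Finset.inter_singleton_of_notMem hx]; simp
  simp only [this, smul_eq_mul, ite_mul, zero_mul]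
  rw [Finset.sum_ite_mem, Finset.univ_inter, ← Finset.mul_sum, div_eq_inv_mul]

theorem isProbabilityMeasure_law {C : Finset (Fin n → Bool)} (hne : C.Nonempty) :
    IsProbabilityMeasure (law C) := by
  have := isProbabilityMeasure_uniformOn C.finite_toSet hne
  unfold law; infer_instance

/-- The vector of all received values. -/
noncomputable def recv (γ : ℝ) (ω : (Fin n → Bool) × (Fin n → ℝ)) : Fin n → ℝ :=
  fun j => received γ j ω

theorem measurable_bit (i : Fin n) : Measurable (bit i) :=
  (measurable_pi_apply i).comp measurable_fst

theorem measurable_received (γ : ℝ) (i : Fin n) : Measurable (received (n := n) γ i) :=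
  (((measurable_of_countable bpsk).comp (measurable_bit i)).const_mul _).add
    ((measurable_pi_apply i).comp measurable_snd)

theorem measurable_recv (γ : ℝ) : Measurable (recv (n := n) γ) :=
  measurable_pi_lambda _ fun i => measurable_received γ i

theorem map_add_noise (s : ℝ) (x : Fin n → Bool) :
    (Measure.pi fun _ : Fin n => gaussianReal 0 1).map (fun N j => s * bpsk (x j) + N j)
      = outLaw s x := by
  have h : ∀ b, (gaussianReal 0 1).map (fun y => s * bpsk b + y) = gaussianReal (s * bpsk b) 1 :=
    fun b => by rw [gaussianReal_map_const_add, zero_add]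
  have : ∀ j, SigmaFinite ((gaussianReal 0 1).map (fun y => s * bpsk (x j) + y)) := fun j => by
    rw [h]; infer_instance
  rw [Measure.pi_map_pi (f := fun j y => s * bpsk (x j) + y) fun i => by fun_prop]
  simp only [h, outLaw]

/-- Means under the law of the code, as averages over the codewords. -/
theorem integral_law_recv {C : Finset (Fin n → Bool)} (hne : C.Nonempty) (γ : ℝ)
    {F : (Fin n → Bool) → (Fin n → ℝ) → ℝ} (hF : ∀ x, Measurable (F x)) {K : ℝ}
    (hK : ∀ x y, |F x y| ≤ K) :
    ∫ ω, F ω.1 (recv γ ω) ∂(law C)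
      = codeAvg C (fun x => ∫ y, F x y ∂(outLaw (Real.sqrt γ) x)) := by
  have := isProbabilityMeasure_law hne
  have hFm : Measurable (fun p : (Fin n → Bool) × (Fin n → ℝ) => F p.1 p.2) :=
    measurable_from_prod_countable_right hF
  have hm : Measurable (fun ω : (Fin n → Bool) × (Fin n → ℝ) => F ω.1 (recv γ ω)) :=
    hFm.comp (measurable_fst.prodMk (measurable_recv γ))
  have hi : Integrable (fun ω : (Fin n → Bool) × (Fin n → ℝ) => F ω.1 (recv γ ω)) (law C) :=
    integrable_of_abs_le hm fun ω => hK _ _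
  unfold law at hi ⊢
  rw [integral_prod _ hi, integral_uniformOn_finset]
  unfold codeAvg
  congr 1
  refine Finset.sum_congr rfl fun x _ => ?_
  simp only
  rw [← map_add_noise, integral_map (Measurable.aemeasurable (measurable_pi_lambda _
    fun j => (measurable_pi_apply j).const_add _)) (hF x).aestronglyMeasurable]
  rfl

theorem errorProb_eq {C : Finset (Fin n → Bool)} (hne : C.Nonempty) (γ : ℝ)
    {dec : (Fin n → ℝ) → Fin n → Bool} (hdec : Measurable dec) :
    errorProb C γ dec
      = codeAvg C (fun x => (outLaw (Real.sqrt γ) x).real {y | dec y ≠ x}) := by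
  have hS : ∀ x, MeasurableSet {y | dec y ≠ x} := fun x =>
    (hdec (measurableSet_singleton x)).compl
  have h := integral_law_recv hne γ (F := fun x y => {y | dec y ≠ x}.indicator (fun _ => (1 : ℝ)) y)
    (fun x => measurable_const.indicator (hS x)) (K := 1) (fun x y => by
      rw [Set.indicator_apply]; split_ifs <;> simp)
  simp only [integral_indicator_const _ (hS _), smul_eq_mul, mul_one] at h
  rw [← h]
  have hT : MeasurableSet {ω : (Fin n → Bool) × (Fin n → ℝ) | dec (recv γ ω) ≠ ω.1} :=
    (measurableSet_eq_fun (hdec.comp (measurable_recv γ)) measurable_fst).compl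
  have := integral_indicator_const (μ := law C) (1 : ℝ) hT
  rw [smul_eq_mul, mul_one] at this
  unfold errorProb
  rw [show {ω : (Fin n → Bool) × (Fin n → ℝ) | dec (fun i => received γ i ω) ≠ ω.1}
    = {ω | dec (recv γ ω) ≠ ω.1} from rfl, ← this]
  refine integral_congr_ae (ae_of_all _ fun ω => ?_)
  simp [Set.indicator_apply]

theorem othersSigma_le (γ : ℝ) (i : Fin n) :
    othersSigma γ i ≤ (inferInstance : MeasurableSpace ((Fin n → Bool) × (Fin n → ℝ))) :=
  Measurable.comap_le (measurable_pi_lambda _ fun j => measurable_received γ j.1)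

/-- Completes the outputs at the other positions by `0` at position `i`. -/
noncomputable def fillIn (i : Fin n) (z : {j : Fin n // j ≠ i} → ℝ) : Fin n → ℝ :=
  fun j => if h : j ≠ i then z ⟨j, h⟩ else 0

theorem measurable_fillIn (i : Fin n) : Measurable (fillIn i) := by
  refine measurable_pi_lambda _ fun j => ?_
  by_cases h : j = i
  · simp only [fillIn, h, ne_eq, not_true_eq_false, dite_false]; exact measurable_const
  · simp only [fillIn, ne_eq, h, not_false_eq_true, dite_true]; exact measurable_pi_apply _

theorem extMean_fillIn (C : Finset (Fin n → Bool)) (s : ℝ) (i : Fin n) (y : Fin n → ℝ) :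
    extMean C s i (fillIn i fun j => y j.1) = extMean C s i y := by
  rw [← extMean_update C s i y 0]
  congr 1
  ext j
  by_cases h : j = i
  · subst h; simp [fillIn]
  · simp [fillIn, h]

/-- The extrinsic mean, as a random variable. -/
noncomputable def extVar (C : Finset (Fin n → Bool)) (γ : ℝ) (i : Fin n)
    (ω : (Fin n → Bool) × (Fin n → ℝ)) : ℝ := extMean C (Real.sqrt γ) i (recv γ ω)

theorem measurable_extVar_others {C : Finset (Fin n → Bool)} (hne : C.Nonempty) (γ : ℝ)
    (i : Fin n) : Measurable[othersSigma γ i] (extVar C γ i) := by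
  have h : extVar C γ i = (fun z => extMean C (Real.sqrt γ) i (fillIn i z)) ∘
      (fun ω (j : {j : Fin n // j ≠ i}) => received γ j.1 ω) := by
    ext ω
    exact (extMean_fillIn C _ i (recv γ ω)).symm
  rw [h]
  exact ((measurable_extMean hne _ i).comp (measurable_fillIn i)).comp
    (comap_measurable _)

theorem measurable_extVar {C : Finset (Fin n → Bool)} (hne : C.Nonempty) (γ : ℝ)
    (i : Fin n) : Measurable (extVar C γ i) :=
  (measurable_extVar_others hne γ i).mono (othersSigma_le γ i) le_rfl

theorem abs_extVar_le {C : Finset (Fin n → Bool)} (hne : C.Nonempty) (γ : ℝ) (i : Fin n)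
    (ω : (Fin n → Bool) × (Fin n → ℝ)) : |extVar C γ i ω| ≤ 1 := abs_extMean_le hne _ _ _

theorem measurable_bpsk_bit (i : Fin n) : Measurable (fun ω => bpsk (bit (n := n) i ω)) :=
  (measurable_of_countable bpsk).comp (measurable_bit i)

theorem integral_extVar_sq {C : Finset (Fin n → Bool)} (hne : C.Nonempty) (γ : ℝ) (i : Fin n) :
    ∫ ω, extVar C γ i ω ^ 2 ∂(law C) = sqExtMean C (Real.sqrt γ) i :=
  integral_law_recv hne γ (F := fun _ y => extMean C (Real.sqrt γ) i y ^ 2)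
    (fun _ => (measurable_extMean hne _ i).pow_const 2) (K := 1) fun _ y => by
      rw [abs_pow]; exact pow_le_one₀ (abs_nonneg _) (abs_extMean_le hne _ i y)

/-- An event of `othersSigma` is the preimage of a set in the other outputs; its indicator is a
bounded function of the output vector ignoring position `i`, to which `codeAvg_bpsk_mul` applies. So
`extVar` is a version of the conditional mean of the symbol. -/
theorem setIntegral_bpsk_eq {C : Finset (Fin n → Bool)} (hne : C.Nonempty) (γ : ℝ) (i : Fin n)
    {S : Set ((Fin n → Bool) × (Fin n → ℝ))} (hS : MeasurableSet[othersSigma γ i] S) :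
    ∫ ω in S, bpsk (bit i ω) ∂(law C) = ∫ ω in S, extVar C γ i ω ∂(law C) := by
  obtain ⟨B, hB, rfl⟩ := hS
  set S := (fun ω (j : {j : Fin n // j ≠ i}) => received γ j.1 ω) ⁻¹' B with hSdef
  have hSm : MeasurableSet S := othersSigma_le γ i _ ⟨B, hB, rfl⟩
  set ψ : (Fin n → ℝ) → ℝ := fun y => B.indicator (fun _ => 1) (fun j => y j.1) with hψdef
  have hψm : Measurable ψ := (measurable_const.indicator hB).comp
    (measurable_pi_lambda _ fun j => measurable_pi_apply j.1)
  have hψ1 : ∀ y, |ψ y| ≤ 1 := fun y => by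
    classical
    simp only [hψdef, Set.indicator_apply]; split_ifs <;> simp
  have hψu : ∀ y t, ψ (Function.update y i t) = ψ y := fun y t => by
    have : (fun j : {j : Fin n // j ≠ i} => Function.update y i t j.1) = fun j => y j.1 := by
      ext j; exact Function.update_of_ne j.2 _ _
    simp only [hψdef, this]
  have hconv : ∀ f : (Fin n → Bool) × (Fin n → ℝ) → ℝ, ∫ ω in S, f ω ∂(law C)
      = ∫ ω, f ω * ψ (recv γ ω) ∂(law C) := by
    intro f
    classical
    rw [← integral_indicator hSm]
    refine integral_congr_ae (ae_of_all _ fun ω => ?_)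
    have h0 : ω ∈ S ↔ (fun j : {j : Fin n // j ≠ i} => recv γ ω j.1) ∈ B := Iff.rfl
    simp only [hψdef, Set.indicator_apply, ← h0]
    split_ifs <;> simp
  rw [hconv, hconv]
  have e1 := integral_law_recv hne γ (F := fun x y => bpsk (x i) * ψ y)
    (fun x => hψm.const_mul _) (K := 1) (fun x y => by
      rw [abs_mul, abs_bpsk, one_mul]; exact hψ1 y)
  have e2 := integral_law_recv hne γ (F := fun _ y => extMean C (Real.sqrt γ) i y * ψ y)
    (fun x => (measurable_extMean hne _ i).mul hψm) (K := 1) (fun x y => by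
      rw [abs_mul]; exact mul_le_one₀ (abs_extMean_le hne _ i y) (abs_nonneg _) (hψ1 y))
  simp only [integral_const_mul] at e1
  rw [codeAvg_bpsk_mul hne _ i hψu hψm hψ1] at e1
  exact e1.trans e2.symm

theorem indicator_bit_eq (i : Fin n) (b : Bool) :
    {ω | bit (n := n) i ω = b}.indicator (fun _ => (1 : ℝ))
      = fun ω => (1 + bpsk b * bpsk (bit i ω)) / 2 := by
  ext ω
  by_cases h : bit i ω = b
  · rw [Set.indicator_of_mem (by exact h), h, ← pow_two, bpsk_sq]; norm_num
  · rw [Set.indicator_of_notMem (by exact h)]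
    have h2 : bit i ω = !b := by rwa [Bool.eq_not]
    rw [h2]
    cases b <;> simp [bpsk]

/-- The extrinsic probabilities in terms of the extrinsic mean. -/
theorem extrinsicProb_ae_eq {C : Finset (Fin n → Bool)} (hne : C.Nonempty) (γ : ℝ) (i : Fin n)
    (b : Bool) : extrinsicProb C γ i b =ᵐ[law C] fun ω => (1 + bpsk b * extVar C γ i ω) / 2 := by
  have := isProbabilityMeasure_law hne
  unfold extrinsicProb
  have hb : Integrable (fun ω => bpsk (bit i ω)) (law C) :=
    integrable_of_abs_le (measurable_bpsk_bit i) fun ω => (abs_bpsk _).le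
  have he : Integrable (extVar C γ i) (law C) :=
    integrable_of_abs_le (measurable_extVar hne γ i) (abs_extVar_le hne γ i)
  have hg : Integrable (fun ω => (1 + bpsk b * extVar C γ i ω) / 2) (law C) :=
    ((integrable_const _).add (he.const_mul _)).div_const 2
  symm
  refine ae_eq_condExp_of_forall_setIntegral_eq (othersSigma_le γ i) ?_ ?_ ?_ ?_
  · rw [indicator_bit_eq]
    exact ((integrable_const _).add (hb.const_mul _)).div_const 2
  · exact fun s _ _ => hg.integrableOn
  · intro s hs _
    rw [indicator_bit_eq]
    simp only [integral_div]
    rw [integral_add (integrable_const _) (he.const_mul _).integrableOn,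
      integral_add (integrable_const _) (hb.const_mul _).integrableOn, integral_const_mul,
      integral_const_mul, setIntegral_bpsk_eq hne γ i hs]
  · exact (((measurable_extVar_others hne γ i).const_mul _).const_add 1).div_const 2
      |>.aestronglyMeasurable

/-- The log-likelihood ratio of a bit of mean `e`. -/
noncomputable def llrOfMean (e : ℝ) : EReal :=
  ENNReal.log (ENNReal.ofReal ((1 + e) / 2) / ENNReal.ofReal ((1 - e) / 2))

theorem extrinsicLLR_ae_eq {C : Finset (Fin n → Bool)} (hne : C.Nonempty) (γ : ℝ) (i : Fin n) :
    extrinsicLLR C γ i =ᵐ[law C] fun ω => llrOfMean (extVar C γ i ω) := by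
  filter_upwards [extrinsicProb_ae_eq hne γ i true, extrinsicProb_ae_eq hne γ i false] with ω h1 h2
  rw [extrinsicLLR, h1, h2, llrOfMean, bpsk_true, bpsk_false]
  congr 4 <;> ring

theorem measurable_extrinsicLLR_others {C : Finset (Fin n → Bool)} (γ : ℝ) (i : Fin n) :
    Measurable[othersSigma γ i] (extrinsicLLR C γ i) := by
  have h : ∀ b, Measurable[othersSigma γ i] (extrinsicProb C γ i b) := fun b =>
    stronglyMeasurable_condExp.measurable
  exact ENNReal.measurable_log.comp ((h true).ennreal_ofReal.div (h false).ennreal_ofReal)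

theorem measurable_extrinsicLLR {C : Finset (Fin n → Bool)} (γ : ℝ) (i : Fin n) :
    Measurable (extrinsicLLR C γ i) :=
  (measurable_extrinsicLLR_others γ i).mono (othersSigma_le γ i) le_rfl

/-- The mean of a bit of given log-likelihood ratio. -/
noncomputable def meanOfLLR (l : EReal) : ℝ := 1 - 2 * ((1 + EReal.exp l)⁻¹).toReal

theorem measurable_meanOfLLR : Measurable meanOfLLR :=
  (((EReal.measurable_exp.const_add 1).inv.ennreal_toReal).const_mul 2).const_sub 1

theorem abs_meanOfLLR_le (l : EReal) : |meanOfLLR l| ≤ 1 := by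
  have h0 : 0 ≤ ((1 + EReal.exp l)⁻¹).toReal := ENNReal.toReal_nonneg
  have h1 : ((1 + EReal.exp l)⁻¹).toReal ≤ 1 := by
    have : (1 + EReal.exp l)⁻¹ ≤ 1 := ENNReal.inv_le_one.2 le_self_add
    simpa using ENNReal.toReal_mono ENNReal.one_ne_top this
  unfold meanOfLLR
  rw [abs_le]; constructor <;> linarith

/-- The extrinsic mean can be recovered from the LLR, so passing to the LLR loses no information
about the bit. The extreme means `±1` correspond to the infinite LLRs. -/
theorem meanOfLLR_llrOfMean {e : ℝ} (he : |e| ≤ 1) : meanOfLLR (llrOfMean e) = e := by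
  obtain ⟨h1, h2⟩ := abs_le.1 he
  unfold meanOfLLR llrOfMean
  rw [ENNReal.exp_log]
  have hsum : ENNReal.ofReal ((1 - e) / 2) + ENNReal.ofReal ((1 + e) / 2) = 1 := by
    rw [← ENNReal.ofReal_add (by linarith) (by linarith)]
    norm_num
    ring
  -- For `e = 1` the odds are `1 / 0 = ⊤`, and the inverse of `1 + ⊤` is 0.
  rcases eq_or_lt_of_le h2 with h | h
  · subst h; simp
  · have hpos : 0 < ENNReal.ofReal ((1 - e) / 2) := ENNReal.ofReal_pos.2 (by linarith)
    have : (1 + ENNReal.ofReal ((1 + e) / 2) / ENNReal.ofReal ((1 - e) / 2))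
        = (ENNReal.ofReal ((1 - e) / 2))⁻¹ := by
      conv_lhs => rw [← ENNReal.div_self hpos.ne' ENNReal.ofReal_ne_top, ← ENNReal.add_div, hsum]
      rw [one_div]
    rw [this, inv_inv, ENNReal.toReal_ofReal (by linarith)]
    ring

end CodeLaw

/-! ### Mutual information of a bit and an observation -/

section MutualInfo

open InformationTheory

variable {Ω β : Type*} [MeasurableSpace Ω] [MeasurableSpace β]

/-- The hypothesis says that `e (Y)` is the conditional mean of the symbol, so `(1 + bpsk b * e) /
2` is the conditional probability of the bit value `b`. -/
theorem setIntegral_indicator_bpsk {μ : Measure Ω} [IsProbabilityMeasure μ] {X : Ω → Bool}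
    (hX : Measurable X) {Y : Ω → β} (hY : Measurable Y) {e : β → ℝ} (he : Measurable e)
    (he1 : ∀ y, |e y| ≤ 1)
    (hXe : ∀ B, MeasurableSet B → ∫ ω in Y ⁻¹' B, bpsk (X ω) ∂μ = ∫ ω in Y ⁻¹' B, e (Y ω) ∂μ)
    (b : Bool) {B : Set β} (hB : MeasurableSet B) :
    μ (X ⁻¹' {b} ∩ Y ⁻¹' B) = ∫⁻ y in B, ENNReal.ofReal ((1 + bpsk b * e y) / 2) ∂(μ.map Y) := by
  have hb : Integrable (fun ω => bpsk (X ω)) μ :=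
    integrable_of_abs_le ((measurable_of_countable bpsk).comp hX) fun ω => (abs_bpsk _).le
  have hei : Integrable (fun ω => e (Y ω)) μ := integrable_of_abs_le (he.comp hY) fun ω => he1 _
  have hint : Integrable (fun ω => (1 + bpsk b * e (Y ω)) / 2) μ :=
    ((integrable_const (1 : ℝ)).add (hei.const_mul _)).div_const 2
  have h0 : ∀ y, 0 ≤ (1 + bpsk b * e y) / 2 := fun y => by
    have := abs_le.1 (he1 y)
    cases b
    · rw [bpsk_false]; linarith
    · rw [bpsk_true]; linarith
  have hXb : MeasurableSet (X ⁻¹' {b}) := hX (measurableSet_singleton b)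
  have hYB : MeasurableSet (Y ⁻¹' B) := hY hB
  have hm : Measurable fun y => ENNReal.ofReal ((1 + bpsk b * e y) / 2) :=
    (((he.const_mul _).const_add 1).div_const 2).ennreal_ofReal
  rw [setLIntegral_map hB hm hY, ← ofReal_integral_eq_lintegral_ofReal
    hint.integrableOn
    (ae_of_all _ fun ω => h0 _), integral_div, integral_add (integrable_const _)
    (hei.const_mul _).integrableOn, integral_const_mul, ← hXe B hB, ← integral_const_mul,
    ← integral_add (integrable_const _) (hb.const_mul _).integrableOn, ← integral_div]
  have : ∀ ω, (1 + bpsk b * bpsk (X ω)) / 2 = (X ⁻¹' {b}).indicator (fun _ => (1 : ℝ)) ω := by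
    intro ω
    by_cases h : X ω = b
    · rw [Set.indicator_of_mem (by exact h), h, ← pow_two, bpsk_sq]; norm_num
    · rw [Set.indicator_of_notMem (by exact h)]
      have h2 : X ω = !b := by rwa [Bool.eq_not]
      rw [h2]
      cases b <;> simp [bpsk]
  simp only [this]
  rw [integral_indicator_const _ hXb, smul_eq_mul, mul_one, ofReal_measureReal,
    Measure.restrict_apply hXb]

/-- The mutual information of a bit and an observation is the drop of the binary entropy. -/
theorem mutualInfoBits_eq {μ : Measure Ω} [IsProbabilityMeasure μ] {X : Ω → Bool}
    (hX : Measurable X) {Y : Ω → β} (hY : Measurable Y) {e : β → ℝ} (he : Measurable e)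
    (he1 : ∀ y, |e y| ≤ 1)
    (hXe : ∀ B, MeasurableSet B → ∫ ω in Y ⁻¹' B, bpsk (X ω) ∂μ = ∫ ω in Y ⁻¹' B, e (Y ω) ∂μ) :
    mutualInfoBits μ X Y = (Real.binEntropy (μ.real {ω | X ω = true})
      - ∫ ω, Real.binEntropy ((1 + e (Y ω)) / 2) ∂μ) / Real.log 2 := by
  have hPX : IsProbabilityMeasure (μ.map X) := Measure.isProbabilityMeasure_map hX.aemeasurable
  have hPY : IsProbabilityMeasure (μ.map Y) := Measure.isProbabilityMeasure_map hY.aemeasurable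
  have hPXY : IsProbabilityMeasure (μ.map fun ω => (X ω, Y ω)) :=
    Measure.isProbabilityMeasure_map (hX.prodMk hY).aemeasurable
  set p : Bool → β → ℝ := fun b y => (1 + bpsk b * e y) / 2 with hp
  have hp0 : ∀ b y, 0 ≤ p b y := fun b y => by
    have := abs_le.1 (he1 y)
    cases b
    · simp only [hp, bpsk_false]; linarith
    · simp only [hp, bpsk_true]; linarith
  have hp1 : ∀ b y, p b y ≤ 1 := fun b y => by
    have := abs_le.1 (he1 y)
    cases b
    · simp only [hp, bpsk_false]; linarith
    · simp only [hp, bpsk_true]; linarith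
  have hpm : ∀ b, Measurable (p b) := fun b => ((he.const_mul _).const_add 1).div_const 2
  have hpi : ∀ b, Integrable (p b) (μ.map Y) := fun b =>
    integrable_of_abs_le (hpm b) (K := 1) fun y => by rw [abs_of_nonneg (hp0 b y)]; exact hp1 b y
  set q : Bool → ℝ := fun b => (μ.map X).real {b} with hq
  have hjoint : ∀ b B, MeasurableSet B →
      μ (X ⁻¹' {b} ∩ Y ⁻¹' B) = ∫⁻ y in B, ENNReal.ofReal (p b y) ∂(μ.map Y) := fun b B hB =>
    setIntegral_indicator_bpsk hX hY he he1 hXe b hB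
  have hqp : ∀ b, q b = ∫ y, p b y ∂(μ.map Y) := by
    intro b
    have h := hjoint b Set.univ MeasurableSet.univ
    rw [Set.preimage_univ, Set.inter_univ, Measure.restrict_univ,
      ← ofReal_integral_eq_lintegral_ofReal (hpi b) (ae_of_all _ (hp0 b))] at h
    simp only [hq, measureReal_def, Measure.map_apply hX (measurableSet_singleton b), h]
    rw [ENNReal.toReal_ofReal (integral_nonneg (hp0 b))]
  have hq0 : ∀ b, 0 ≤ q b := fun b => measureReal_nonneg
  have hpz : ∀ b, q b = 0 → p b =ᵐ[μ.map Y] 0 := fun b hb => by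
    rw [hqp, integral_eq_zero_iff_of_nonneg (hp0 b) (hpi b)] at hb
    exact hb
  -- Conditional over marginal probability of the bit. If `q b = 0` the quotient is 0 by convention,
  -- which is harmless: `p b` then vanishes almost everywhere.
  set ρ : Bool × β → ℝ := fun z => p z.1 z.2 / q z.1 with hρ
  have hρm : Measurable ρ := measurable_from_prod_countable_right fun b => by
    change Measurable fun y => p b y / q b
    exact (hpm b).div_const _
  have hρ0 : ∀ z, 0 ≤ ρ z := fun z => div_nonneg (hp0 _ _) (hq0 _)
  have hdens : μ.map (fun ω => (X ω, Y ω))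
      = ((μ.map X).prod (μ.map Y)).withDensity (fun z => ENNReal.ofReal (ρ z)) := by
    ext S hS
    have hSb : ∀ b, MeasurableSet (Prod.mk b ⁻¹' S) := fun b => measurable_prodMk_left hS
    rw [Measure.map_apply (hX.prodMk hY) hS, withDensity_apply _ hS, ← lintegral_indicator hS,
      lintegral_prod _ (hρm.ennreal_ofReal.indicator hS).aemeasurable, lintegral_fintype]
    have hsplit : (fun ω => (X ω, Y ω)) ⁻¹' S
        = ⋃ b, (X ⁻¹' {b} ∩ Y ⁻¹' (Prod.mk b ⁻¹' S)) := by
      ext ω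
      simp
    rw [hsplit, measure_iUnion, tsum_fintype]
    · refine Finset.sum_congr rfl fun b _ => ?_
      rw [hjoint b _ (hSb b), ← lintegral_indicator (hSb b),
        ← ofReal_measureReal (μ := μ.map X) (s := {b}), ← lintegral_mul_const']
      · by_cases hb : q b = 0
        · refine lintegral_congr_ae ?_
          filter_upwards [hpz b hb] with y hy
          have : (μ.map X).real {b} = 0 := hb
          rw [this, ENNReal.ofReal_zero, mul_zero]
          simp only [Set.indicator_apply_eq_zero]
          intro _
          rw [hy]; simp
        · refine lintegral_congr fun y => ?_
          have hbp : 0 < q b := lt_of_le_of_ne (hq0 b) (Ne.symm hb)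
          by_cases hy : (b, y) ∈ S
          · rw [Set.indicator_of_mem (by exact hy), Set.indicator_of_mem hy,
              ← ENNReal.ofReal_mul (hρ0 _)]
            congr 1
            change p b y = p b y / q b * q b
            field_simp
          · rw [Set.indicator_of_notMem (by exact hy), Set.indicator_of_notMem hy, zero_mul]
      · exact ENNReal.ofReal_ne_top
    · intro b b' hbb'
      refine Set.disjoint_left.2 fun ω h1 h2 => hbb' ?_
      rw [← h1.1, ← h2.1]
    · exact fun b => (hX (measurableSet_singleton b)).inter (hY (hSb b))
  have hac : μ.map (fun ω => (X ω, Y ω)) ≪ (μ.map X).prod (μ.map Y) := by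
    rw [hdens]; exact withDensity_absolutelyContinuous _ _
  -- bounds for the density
  have hρb : ∃ K : ℝ, ∀ z, |klFun (ρ z)| ≤ K := by
    have hcomp : IsCompact (klFun '' Set.Icc 0 (max (1 / q true) (1 / q false))) :=
      isCompact_Icc.image continuous_klFun
    obtain ⟨K, hK⟩ := hcomp.isBounded.exists_norm_le
    refine ⟨K, fun z => hK _ ⟨ρ z, ⟨hρ0 z, ?_⟩, rfl⟩⟩
    have h1 : ρ z ≤ 1 / q z.1 := div_le_div_of_nonneg_right (hp1 _ _) (hq0 _)
    refine h1.trans ?_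
    cases z.1
    · exact le_max_right _ _
    · exact le_max_left _ _
  obtain ⟨K, hK⟩ := hρb
  have hkm : Measurable fun z => klFun (ρ z) := measurable_klFun.comp hρm
  have hkl : (klDiv (μ.map fun ω => (X ω, Y ω)) ((μ.map X).prod (μ.map Y))).toReal
      = ∫ z, klFun (ρ z) ∂((μ.map X).prod (μ.map Y)) := by
    rw [toReal_klDiv_eq_integral_klFun hac]
    refine integral_congr_ae ?_
    rw [hdens]
    filter_upwards [Measure.rnDeriv_withDensity ((μ.map X).prod (μ.map Y)) hρm.ennreal_ofReal]
      with z hz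
    rw [hz, ENNReal.toReal_ofReal (hρ0 z)]
  -- The weight `q b` cancels the denominator of `ρ`; the terms `q b - p b` then integrate to zero,
  -- by `hqp`.
  have hterm : ∀ b, q b * ∫ y, klFun (ρ (b, y)) ∂(μ.map Y)
      = ∫ y, (p b y * Real.log (p b y) - p b y * Real.log (q b) + q b - p b y) ∂(μ.map Y) := by
    intro b
    rw [← integral_const_mul]
    by_cases hb : q b = 0
    · refine integral_congr_ae ?_
      filter_upwards [hpz b hb] with y hy
      have hy' : p b y = 0 := hy
      rw [hb, hy']; simp
    · refine integral_congr_ae (ae_of_all _ fun y => ?_)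
      simp only [klFun, hρ]
      by_cases hy : p b y = 0
      · rw [hy]; simp
      · rw [Real.log_div hy hb]
        field_simp
  have hplog : ∀ b, Integrable (fun y => p b y * Real.log (p b y)) (μ.map Y) := by
    intro b
    have : Continuous fun t : ℝ => t * Real.log t := Real.continuous_mul_log
    obtain ⟨K', hK'⟩ := ((isCompact_Icc (a := (0 : ℝ)) (b := 1)).image this).isBounded.exists_norm_le
    exact integrable_of_abs_le (this.measurable.comp (hpm b))
      fun y => hK' _ ⟨p b y, ⟨hp0 b y, hp1 b y⟩, rfl⟩
  have hterm2 : ∀ b, q b * ∫ y, klFun (ρ (b, y)) ∂(μ.map Y)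
      = ∫ y, p b y * Real.log (p b y) ∂(μ.map Y) - q b * Real.log (q b) := by
    intro b
    have i1 : Integrable (fun y => p b y * Real.log (p b y) - p b y * Real.log (q b)) (μ.map Y) :=
      (hplog b).sub ((hpi b).mul_const _)
    have i2 : Integrable (fun y => p b y * Real.log (p b y) - p b y * Real.log (q b) + q b)
      (μ.map Y) := i1.add (integrable_const _)
    rw [hterm b, integral_sub i2 (hpi b), integral_add i1 (integrable_const _),
      integral_sub (hplog b) ((hpi b).mul_const _), integral_mul_const, ← hqp]
    simp
  have hqt : q true = μ.real {ω | X ω = true} := by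
    simp only [hq, measureReal_def, Measure.map_apply hX (measurableSet_singleton true)]; rfl
  have hqf : q false = 1 - q true := by
    rw [hqp, hqp, eq_sub_iff_add_eq, ← integral_add (hpi _) (hpi _)]
    have : ∀ y, p false y + p true y = 1 := fun y => by
      simp only [hp, bpsk_true, bpsk_false]; ring
    simp [this]
  have hent : ∀ t : ℝ, Real.binEntropy t = -(t * Real.log t + (1 - t) * Real.log (1 - t)) := by
    intro t
    rw [Real.binEntropy_eq_negMulLog_add_negMulLog_one_sub, Real.negMulLog, Real.negMulLog]
    ring
  have hEY : ∫ ω, Real.binEntropy ((1 + e (Y ω)) / 2) ∂μ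
      = -(∫ y, p true y * Real.log (p true y) ∂(μ.map Y)
        + ∫ y, p false y * Real.log (p false y) ∂(μ.map Y)) := by
    rw [← integral_add (hplog _) (hplog _), ← integral_neg, integral_map hY.aemeasurable]
    · refine integral_congr_ae (ae_of_all _ fun ω => ?_)
      simp only [hent, hp, bpsk_true, bpsk_false]
      rw [show 1 - (1 + e (Y ω)) / 2 = (1 + -1 * e (Y ω)) / 2 by ring, one_mul]
    · exact ((hplog _).add (hplog _)).neg.aestronglyMeasurable
  unfold mutualInfoBits
  rw [hkl, integral_prod _ (integrable_of_abs_le hkm hK), integral_fintype Integrable.of_finite,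
    hEY, ← hqt, hent (q true), ← hqf]
  simp only [smul_eq_mul, Fintype.sum_bool]
  congr 1
  have e1 := hterm2 true
  have e2 := hterm2 false
  simp only [hq] at e1 e2 ⊢
  rw [e1, e2]
  ring

end MutualInfo

/-! ### Extrinsic information and channel information as entropy drops -/

section Info

open BinaryCode

variable {n : ℕ}

/-- The general formula with the LLR as observation and `meanOfLLR` as conditional mean, which
agrees almost surely with `extVar`. -/
theorem mutualInfoBits_extrinsicLLR {C : Finset (Fin n → Bool)} (hne : C.Nonempty) (γ : ℝ)
    (i : Fin n) : mutualInfoBits (law C) (bit i) (extrinsicLLR C γ i)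
      = (Real.binEntropy ((law C).real {ω | bit i ω = true})
        - ∫ ω, Real.binEntropy ((1 + extVar C γ i ω) / 2) ∂(law C)) / Real.log 2 := by
  have := isProbabilityMeasure_law hne
  have hae : ∀ᵐ ω ∂(law C), meanOfLLR (extrinsicLLR C γ i ω) = extVar C γ i ω := by
    filter_upwards [extrinsicLLR_ae_eq hne γ i] with ω hω
    rw [hω, meanOfLLR_llrOfMean (abs_extVar_le hne γ i ω)]
  rw [mutualInfoBits_eq (measurable_bit i) (measurable_extrinsicLLR γ i) measurable_meanOfLLR
    abs_meanOfLLR_le]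
  · congr 2
    refine integral_congr_ae ?_
    filter_upwards [hae] with ω hω
    rw [hω]
  · intro B hB
    rw [setIntegral_bpsk_eq hne γ i (measurable_extrinsicLLR_others γ i hB)]
    refine integral_congr_ae (ae_restrict_of_ae ?_)
    filter_upwards [hae] with ω hω
    rw [hω]

theorem binEntropy_eq_neg (t : ℝ) :
    Real.binEntropy t = -(t * Real.log t + (1 - t) * Real.log (1 - t)) := by
  rw [Real.binEntropy_eq_negMulLog_add_negMulLog_one_sub, Real.negMulLog, Real.negMulLog]
  ring

theorem abs_binEntropy_le {t : ℝ} (h0 : 0 ≤ t) (h1 : t ≤ 1) : |Real.binEntropy t| ≤ Real.log 2 := by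
  rw [abs_of_nonneg (Real.binEntropy_nonneg h0 h1)]
  exact Real.binEntropy_le_log_two

/-- Half of each density is a posterior probability under the uniform prior. Averaging the logarithm
of the density over the two inputs gives `log 2` minus the posterior entropy. -/
theorem symInfo_eq (s : ℝ) : symInfo s
    = Real.log 2 - ∫ y, Real.binEntropy (chanDensity s true y / 2) ∂(mixLaw s) := by
  have hd : ∀ b, Integrable (fun y => chanDensity s b y * Real.log (chanDensity s b y))
      (mixLaw s) := by
    intro b
    obtain ⟨K, hK⟩ := ((isCompact_Icc (a := (0 : ℝ)) (b := 2)).image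
      Real.continuous_mul_log).isBounded.exists_norm_le
    exact integrable_of_abs_le (Real.continuous_mul_log.measurable.comp (measurable_chanDensity s b))
      fun y => hK _ ⟨_, ⟨(chanDensity_pos s b y).le, chanDensity_le_two s b y⟩, rfl⟩
  have h1 := integral_log_chanDensity s true
  have h2 := integral_log_chanDensity s false
  rw [integral_gaussianReal_eq_mixLaw] at h1 h2
  have h3 : symInfo s = (∫ y, chanDensity s true y * Real.log (chanDensity s true y) ∂(mixLaw s)
      + ∫ y, chanDensity s false y * Real.log (chanDensity s false y) ∂(mixLaw s)) / 2 := by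
    rw [h1, h2]; ring
  have hb : Integrable (fun y => Real.binEntropy (chanDensity s true y / 2)) (mixLaw s) :=
    integrable_of_abs_le (Real.binEntropy_continuous.measurable.comp
      ((measurable_chanDensity s true).div_const 2)) fun y => abs_binEntropy_le
        (by linarith [chanDensity_pos s true y]) (by linarith [chanDensity_le_two s true y])
  have h4 : Real.log 2 = ∫ _, Real.log 2 ∂(mixLaw s) := by simp
  rw [h3, h4, ← integral_sub (integrable_const _) hb, ← integral_add (hd _) (hd _), ← integral_div]
  refine integral_congr_ae (ae_of_all _ fun y => ?_)
  simp only
  have hf : chanDensity s false y = 2 - chanDensity s true y := by linarith [chanDensity_add s y]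
  have hp1 := chanDensity_pos s true y
  have hp2 := chanDensity_pos s false y
  rw [hf] at hp2
  rw [binEntropy_eq_neg, hf, show 1 - chanDensity s true y / 2 = (2 - chanDensity s true y) / 2 by
    ring, Real.log_div hp1.ne' two_ne_zero, Real.log_div hp2.ne' two_ne_zero]
  ring

theorem biAwgnInfo_eq (γ : ℝ) : biAwgnInfo γ = symInfo (Real.sqrt γ) / Real.log 2 := by
  set s := Real.sqrt γ with hs
  have hU : IsProbabilityMeasure (uniformOn (Set.univ : Set Bool)) :=
    isProbabilityMeasure_uniformOn Set.finite_univ Set.univ_nonempty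
  set μ := (uniformOn (Set.univ : Set Bool)).prod (gaussianReal 0 1) with hμ
  have hX : Measurable (fun ω : Bool × ℝ => ω.1) := measurable_fst
  have hY : Measurable (fun ω : Bool × ℝ => s * bpsk ω.1 + ω.2) :=
    (((measurable_of_countable bpsk).comp measurable_fst).const_mul _).add measurable_snd
  have hmean : ∀ F : Bool → ℝ → ℝ, (∀ b, Measurable (F b)) → (∃ K, ∀ b y, |F b y| ≤ K) →
      ∫ ω, F ω.1 (s * bpsk ω.1 + ω.2) ∂μ
        = (∫ y, F true y ∂(gaussianReal (s * bpsk true) 1)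
          + ∫ y, F false y ∂(gaussianReal (s * bpsk false) 1)) / 2 := by
    intro F hF ⟨K, hK⟩
    have hFm : Measurable (fun p : Bool × ℝ => F p.1 p.2) := measurable_from_prod_countable_right hF
    have hb : ∀ b, ∫ N, F b (s * bpsk b + N) ∂(gaussianReal 0 1)
        = ∫ y, F b y ∂(gaussianReal (s * bpsk b) 1) := by
      intro b
      have : gaussianReal (s * bpsk b) 1 = (gaussianReal 0 1).map (fun y => s * bpsk b + y) := by
        rw [gaussianReal_map_const_add, zero_add]
      rw [this, integral_map (by fun_prop) (hF b).aestronglyMeasurable]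
    have hi : Integrable (fun ω : Bool × ℝ => F ω.1 (s * bpsk ω.1 + ω.2)) μ :=
      integrable_of_abs_le (hFm.comp (measurable_fst.prodMk hY)) fun ω => hK _ _
    rw [hμ, integral_prod _ hi]
    have := integral_uniformOn_finset (C := (Finset.univ : Finset Bool))
      (fun b => ∫ N, F b (s * bpsk b + N) ∂(gaussianReal 0 1))
    rw [Finset.coe_univ] at this
    rw [this]
    simp [hb]
  have hem : Measurable fun y => chanDensity s true y - 1 := (measurable_chanDensity s true).sub_const 1
  have hind : ∀ (f : Bool → ℝ → ℝ) (B : Set ℝ), (∀ b, Measurable (f b)) → (∀ b y, |f b y| ≤ 1) →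
      MeasurableSet B → ∫ ω in (fun ω : Bool × ℝ => s * bpsk ω.1 + ω.2) ⁻¹' B,
        f ω.1 (s * bpsk ω.1 + ω.2) ∂μ
      = (∫ y, B.indicator (f true) y ∂(gaussianReal (s * bpsk true) 1)
          + ∫ y, B.indicator (f false) y ∂(gaussianReal (s * bpsk false) 1)) / 2 := by
    intro f B hf hf1 hB
    rw [← hmean (fun b => B.indicator (f b)) (fun b => (hf b).indicator hB) ⟨1, fun b y => by
      by_cases hy : y ∈ B
      · rw [Set.indicator_of_mem hy]; exact hf1 b y
      · rw [Set.indicator_of_notMem hy]; simp⟩, ← integral_indicator (hY hB)]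
    rfl
  unfold biAwgnInfo
  rw [mutualInfoBits_eq (e := fun y => chanDensity s true y - 1) hX hY hem
    (abs_chanDensity_sub_one_le s)]
  · rw [symInfo_eq]
    congr 2
    · have h := hmean (fun b _ => if b = true then 1 else 0) (fun b => measurable_const)
        ⟨1, fun b y => by split_ifs <;> simp⟩
      have hS : MeasurableSet {ω : Bool × ℝ | ω.1 = true} := hX (measurableSet_singleton true)
      have h2 := integral_indicator_const (μ := μ) (1 : ℝ) hS
      rw [smul_eq_mul, mul_one] at h2
      rw [← h2, show (fun ω => {ω : Bool × ℝ | ω.1 = true}.indicator (fun _ => (1 : ℝ)) ω)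
        = fun ω => if ω.1 = true then 1 else 0 from by ext ω; simp [Set.indicator_apply], h]
      simp
    · have hbm : Measurable fun y => Real.binEntropy (chanDensity s true y / 2) :=
        Real.binEntropy_continuous.measurable.comp ((measurable_chanDensity s true).div_const 2)
      have hbb : ∀ y, |Real.binEntropy (chanDensity s true y / 2)| ≤ Real.log 2 := fun y =>
        abs_binEntropy_le (by linarith [chanDensity_pos s true y])
          (by linarith [chanDensity_le_two s true y])
      rw [integral_mixLaw (integrable_of_abs_le hbm hbb),
        ← hmean (fun _ y => Real.binEntropy (chanDensity s true y / 2)) (fun _ => hbm)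
          ⟨_, fun _ => hbb⟩]
      simp only [add_sub_cancel, hμ]
  · intro B hB
    rw [hind (fun b _ => bpsk b) B (fun _ => measurable_const) (fun b _ => (abs_bpsk b).le) hB,
      hind (fun _ y => chanDensity s true y - 1) B (fun _ => hem)
        (fun _ y => abs_chanDensity_sub_one_le s y) hB]
    have hT : Integrable (B.indicator fun y => chanDensity s true y - 1) (mixLaw s) :=
      (integrable_mean_mixLaw s s).indicator hB
    have h1 : Integrable (B.indicator fun _ => (1 : ℝ)) (mixLaw s) :=
      (integrable_const _).indicator hB
    rw [← integral_mixLaw hT]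
    have h3 := integral_mean_mul_mixLaw h1
    have h4 : ∀ y, (chanDensity s true y - 1) * B.indicator (fun _ => (1 : ℝ)) y
        = B.indicator (fun y => chanDensity s true y - 1) y := fun y => by
      by_cases hy : y ∈ B <;> simp [hy]
    simp only [h4] at h3
    rw [h3]
    have h5 : ∀ y, B.indicator (fun _ => bpsk false) y = -B.indicator (fun _ => (1 : ℝ)) y :=
      fun y => by by_cases hy : y ∈ B <;> simp [hy, bpsk]
    simp only [h5, integral_neg, bpsk_true]
    ring

end Info

/-! ### The symmetric information as a function of the signal to noise ratio -/

/-- After centring, the measure no longer depends on `s`, which makes dominated convergence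
available. -/
theorem symInfo_eq_integral_noise (s : ℝ) :
    symInfo s = ∫ N, Real.log (chanDensity s true (s + N)) ∂(gaussianReal 0 1) := by
  have h : gaussianReal s 1 = (gaussianReal 0 1).map (fun y => s + y) := by
    rw [gaussianReal_map_const_add, zero_add]
  rw [symInfo, h, integral_map (f := fun y => Real.log (chanDensity s true y)) (by fun_prop)
    (Real.measurable_log.comp (measurable_chanDensity s true)).aestronglyMeasurable]

theorem continuous_symInfo : Continuous symInfo := by
  have hfun : symInfo = fun s => ∫ N, Real.log (chanDensity s true (s + N)) ∂(gaussianReal 0 1) := by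
    ext s; exact symInfo_eq_integral_noise s
  rw [hfun, continuous_iff_continuousAt]
  intro s₀
  set M := |s₀| + 1 with hM
  have hcont : ∀ N, Continuous fun s => Real.log (chanDensity s true (s + N)) := fun N =>
    ((continuous_chanDensity true).comp (f := fun s : ℝ => (s, s + N)) (by fun_prop)).log
      fun s => (chanDensity_pos _ _ _).ne'
  refine continuousAt_of_dominated (bound := fun N => Real.log 2 + 2 * M ^ 2 + 2 * M * |N|)
    (Eventually.of_forall fun s => ?_) ?_ ?_ ?_
  · exact (Real.measurable_log.comp ((measurable_chanDensity s true).comp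
      (measurable_const_add s))).aestronglyMeasurable
  · have hev : ∀ᶠ s in 𝓝 s₀, |s| < M :=
      continuous_abs.continuousAt.eventually_lt continuousAt_const (by simp [hM])
    filter_upwards [hev] with s hs
    refine ae_of_all _ fun N => ?_
    have h1 := abs_log_chanDensity_le s true (s + N)
    have h2 : |s * (s + N)| ≤ M * (M + |N|) := by
      rw [abs_mul]
      exact mul_le_mul hs.le ((abs_add_le _ _).trans (by linarith)) (abs_nonneg _)
        ((abs_nonneg s).trans hs.le)
    rw [Real.norm_eq_abs]
    nlinarith
  · exact (integrable_const _).add ((integrable_abs_gaussianReal 0).const_mul _)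
  · exact ae_of_all _ fun N => (hcont N).continuousAt

theorem symInfo_le_log_two (s : ℝ) : symInfo s ≤ Real.log 2 := by
  rw [symInfo_eq]
  have : 0 ≤ ∫ y, Real.binEntropy (chanDensity s true y / 2) ∂(mixLaw s) :=
    integral_nonneg fun y => Real.binEntropy_nonneg (by linarith [chanDensity_pos s true y])
      (by linarith [chanDensity_le_two s true y])
  linarith

/-- Data processing: for each bit apply `log t ≤ t - 1` to the ratio of the degraded density to the
original one. The two bounds add up to zero because the densities for the two bits sum to 2. -/
theorem symInfo_le_of_lt {s₁ s₃ : ℝ} (h1 : 0 ≤ s₁) (h3 : s₁ < s₃) : symInfo s₁ ≤ symInfo s₃ := by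
  have hm1 : ∀ b, Measurable fun u => chanDensity s₁ b (degrade s₁ s₃ u) := fun b =>
    (measurable_chanDensity s₁ b).comp (measurable_degrade s₁ s₃)
  have hi1 : ∀ b, Integrable (fun u => chanDensity s₁ b (degrade s₁ s₃ u)) (mixPair s₃) := fun b =>
    integrable_of_abs_le (hm1 b) (K := 2) fun u => by
      rw [abs_of_pos (chanDensity_pos _ _ _)]; exact chanDensity_le_two _ _ _
  have key : ∀ b, symInfo s₁ - symInfo s₃
      ≤ ∫ u, chanDensity s₁ b (degrade s₁ s₃ u) ∂(mixPair s₃) - 1 := by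
    intro b
    have l1 : Integrable (fun u => Real.log (chanDensity s₁ b (degrade s₁ s₃ u)))
        (bitPair s₃ b) := by
      have h := integrable_log_chanDensity s₁ b (s₁ * bpsk b)
      rw [← map_degrade h1 h3 b] at h
      exact h.comp_measurable (measurable_degrade s₁ s₃)
    have l3 : Integrable (fun u : ℝ × ℝ => Real.log (chanDensity s₃ b u.1)) (bitPair s₃ b) :=
      (integrable_log_chanDensity s₃ b _).comp_fst _
    have e1 : ∫ u, Real.log (chanDensity s₁ b (degrade s₁ s₃ u)) ∂(bitPair s₃ b) = symInfo s₁ := by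
      rw [integral_comp_degrade h1 h3 b (f := fun y => Real.log (chanDensity s₁ b y))
        (Real.measurable_log.comp (measurable_chanDensity s₁ b)), integral_log_chanDensity]
    have e3 : ∫ u : ℝ × ℝ, Real.log (chanDensity s₃ b u.1) ∂(bitPair s₃ b) = symInfo s₃ := by
      rw [bitPair, integral_fun_fst (μ := gaussianReal (s₃ * bpsk b) 1)
        (fun y => Real.log (chanDensity s₃ b y)), integral_log_chanDensity]
      simp
    have eR : ∫ u : ℝ × ℝ, chanDensity s₁ b (degrade s₁ s₃ u) / chanDensity s₃ b u.1
        ∂(bitPair s₃ b) = ∫ u, chanDensity s₁ b (degrade s₁ s₃ u) ∂(mixPair s₃) := by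
      rw [integral_bitPair]
      refine integral_congr_ae (ae_of_all _ fun u => ?_)
      have := (chanDensity_pos s₃ b u.1).ne'
      field_simp
    have iR : Integrable (fun u : ℝ × ℝ => chanDensity s₁ b (degrade s₁ s₃ u)
        / chanDensity s₃ b u.1) (bitPair s₃ b) := by
      have hm3 : Measurable fun u : ℝ × ℝ => ENNReal.ofReal (chanDensity s₃ b u.1) :=
        ((measurable_chanDensity s₃ b).comp measurable_fst).ennreal_ofReal
      rw [bitPair_eq_withDensity, integrable_withDensity_iff hm3
        (ae_of_all _ fun _ => ENNReal.ofReal_lt_top)]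
      refine (hi1 b).congr (ae_of_all _ fun u => ?_)
      have := chanDensity_pos s₃ b u.1
      simp only [ENNReal.toReal_ofReal this.le]
      field_simp
    have hle := integral_mono (l1.sub l3) (iR.sub (integrable_const 1)) fun u => by
      have p1 := chanDensity_pos s₁ b (degrade s₁ s₃ u)
      have p3 := chanDensity_pos s₃ b u.1
      have := Real.log_le_sub_one_of_pos (div_pos p1 p3)
      rw [Real.log_div p1.ne' p3.ne'] at this
      exact this
    simp only [Pi.sub_apply] at hle
    rw [integral_sub l1 l3, integral_sub iR (integrable_const 1), e1, e3, eR] at hle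
    simpa using hle
  have k1 := key true
  have k2 := key false
  have hsum : ∫ u, chanDensity s₁ true (degrade s₁ s₃ u) ∂(mixPair s₃)
      + ∫ u, chanDensity s₁ false (degrade s₁ s₃ u) ∂(mixPair s₃) = 2 := by
    rw [← integral_add (hi1 true) (hi1 false)]
    simp [chanDensity_add]
  linarith

/-- The key inequality applied to the one-word code of length 1. Its rate is 0, its extrinsic mean
is identically 1 and the constant decoder never errs, so the symmetric information must pay for the
positive left-hand side. -/
theorem symInfo_pos {s : ℝ} (hs : 0 < s) : 0 < symInfo s := by
  set C : Finset (Fin 1 → Bool) := {fun _ => true} with hC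
  have hne : C.Nonempty := Finset.singleton_nonempty _
  have hext : ∀ i y, extMean C 0 i y = 1 := by
    intro i y
    have h := sum_codePost hne (extAmp 0 i) y
    rw [hC, Finset.sum_singleton] at h
    rw [extMean, hC, Finset.sum_singleton, h, bpsk_true, one_mul]
  have hsq : ∀ i, sqExtMean C 0 i = 1 := by
    intro i
    simp only [sqExtMean, hext]
    simp [codeAvg_const hne]
  have hc : 0 < ((gaussMean s - gaussMean 0) / 2) ^ 2 / 4 := by
    have := gaussMean_lt le_rfl hs
    have : 0 < (gaussMean s - gaussMean 0) / 2 := by linarith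
    positivity
  set c := ((gaussMean s - gaussMean 0) / 2) ^ 2 / 4
  have herr : codeAvg C (fun x => (outLaw s x).real {y | (fun _ : Fin 1 => true) ≠ x}) = 0 := by
    simp [codeAvg, hC]
  -- This `ε` makes `-log (1 - ε) = c / 2`, half of the left-hand side `c`.
  have key := sum_sqExtMean_le le_rfl hs hne (dec := fun _ _ => true) measurable_const
    (ε := 1 - Real.exp (-(c / 2))) (by
      rw [sub_pos, Real.exp_lt_one_iff]; linarith) (by linarith [Real.exp_pos (-(c / 2))])
  rw [herr, sub_sub_cancel, Real.log_exp] at key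
  simp only [hsq] at key
  simp [hC] at key
  change c ≤ _ at key
  linarith

theorem tendsto_symInfo_atTop : Tendsto symInfo atTop (𝓝 (Real.log 2)) := by
  have hfun : symInfo = fun s => ∫ N, Real.log (chanDensity s true (s + N)) ∂(gaussianReal 0 1) := by
    ext s; exact symInfo_eq_integral_noise s
  have hlim : Real.log 2 = ∫ _, Real.log 2 ∂(gaussianReal 0 1) := by simp
  rw [hfun, hlim]
  refine tendsto_integral_filter_of_dominated_convergence
    (fun N => 2 * Real.log 2 + N ^ 2 / 2) ?_ ?_ ?_ ?_
  · exact Eventually.of_forall fun s => (Real.measurable_log.comp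
      ((measurable_chanDensity s true).comp (measurable_const_add s))).aestronglyMeasurable
  · refine Eventually.of_forall fun s => ae_of_all _ fun N => ?_
    -- Completing the square removes `s`, which yields a dominating function valid for all
    -- amplitudes.
    have hx : -(2 * s * bpsk true * (s + N)) ≤ N ^ 2 / 2 := by
      rw [bpsk_true]; nlinarith [sq_nonneg (s + N / 2)]
    have h0 : 0 ≤ Real.log (1 + Real.exp (-(2 * s * bpsk true * (s + N)))) :=
      Real.log_nonneg (by linarith [Real.exp_pos (-(2 * s * bpsk true * (s + N)))])
    have h1 : Real.log (1 + Real.exp (-(2 * s * bpsk true * (s + N)))) ≤ Real.log 2 + N ^ 2 / 2 := by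
      rw [← Real.log_exp (N ^ 2 / 2), ← Real.log_mul two_ne_zero (Real.exp_pos _).ne']
      refine Real.log_le_log (by positivity) ?_
      have := Real.exp_le_exp.2 hx
      have := Real.one_le_exp (x := N ^ 2 / 2) (by positivity)
      linarith
    have h2 := Real.log_nonneg (x := 2) (by norm_num)
    rw [Real.norm_eq_abs, chanDensity, Real.log_div two_ne_zero (by positivity), abs_le]
    have := sq_nonneg N
    constructor <;> linarith
  · refine (integrable_const _).add (Integrable.div_const ?_ 2)
    exact (memLp_id_gaussianReal (μ := 0) (v := 1) 2).integrable_sq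
  · refine ae_of_all _ fun N => ?_
    have h1 : Tendsto (fun s : ℝ => 2 * s * bpsk true * (s + N)) atTop atTop := by
      simp only [bpsk_true, mul_one]
      exact (tendsto_id.const_mul_atTop two_pos).atTop_mul_atTop₀
        (tendsto_atTop_add_const_right _ N tendsto_id)
    have h2 : Tendsto (fun s : ℝ => chanDensity s true (s + N)) atTop (𝓝 (2 / (1 + 0))) :=
      tendsto_const_nhds.div (tendsto_const_nhds.add
        (Real.tendsto_exp_neg_atTop_nhds_zero.comp h1)) (by norm_num)
    rw [add_zero, div_one] at h2
    exact h2.log two_ne_zero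

theorem log_two_pos : 0 < Real.log 2 := Real.log_pos (by norm_num)

theorem continuous_biAwgnInfo : Continuous biAwgnInfo := by
  have : biAwgnInfo = fun γ => symInfo (Real.sqrt γ) / Real.log 2 := by ext γ; exact biAwgnInfo_eq γ
  rw [this]
  exact (continuous_symInfo.comp Real.continuous_sqrt).div_const _

theorem monotone_biAwgnInfo : Monotone biAwgnInfo := by
  intro γ γ' h
  rw [biAwgnInfo_eq, biAwgnInfo_eq]
  refine div_le_div_of_nonneg_right ?_ log_two_pos.le
  rcases (Real.sqrt_le_sqrt h).eq_or_lt with he | hl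
  · rw [he]
  · exact symInfo_le_of_lt (Real.sqrt_nonneg _) hl

theorem biAwgnInfo_pos {γ : ℝ} (h : 0 < γ) : 0 < biAwgnInfo γ := by
  rw [biAwgnInfo_eq]; exact div_pos (symInfo_pos (Real.sqrt_pos.2 h)) log_two_pos

theorem biAwgnInfo_le_one (γ : ℝ) : biAwgnInfo γ ≤ 1 := by
  rw [biAwgnInfo_eq, div_le_one log_two_pos]; exact symInfo_le_log_two _

theorem exists_le_biAwgnInfo {a : ℝ} (ha : a < 1) : ∃ γ, 0 ≤ γ ∧ a ≤ biAwgnInfo γ := by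
  have h : Tendsto (fun γ => symInfo (Real.sqrt γ) / Real.log 2) atTop (𝓝 1) := by
    have := (tendsto_symInfo_atTop.comp Real.tendsto_sqrt_atTop).div_const (Real.log 2)
    rwa [div_self log_two_pos.ne'] at this
  obtain ⟨γ, hγ, h0⟩ := ((h.eventually (lt_mem_nhds ha)).and (eventually_ge_atTop 0)).exists
  exact ⟨γ, h0, by rw [biAwgnInfo_eq]; exact hγ.le⟩

theorem snrOfInfo_nonneg (a : ℝ) : 0 ≤ snrOfInfo a := Real.sInf_nonneg fun _ h => h.1

/-- By continuity the level `a` is still exceeded slightly below `SNR`, at a positive SNR because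
`SNR > 0`. That point belongs to the set whose infimum is taken. -/
theorem snrOfInfo_lt {a SNR : ℝ} (hSNR : 0 < SNR) (ha : a < biAwgnInfo SNR) : snrOfInfo a < SNR := by
  have h1 : ∀ᶠ γ in 𝓝[<] SNR, a < biAwgnInfo γ :=
    (continuous_biAwgnInfo.continuousAt.eventually (lt_mem_nhds ha)).filter_mono nhdsWithin_le_nhds
  have h2 : ∀ᶠ γ in 𝓝[<] SNR, 0 < γ := (lt_mem_nhds hSNR).filter_mono nhdsWithin_le_nhds
  obtain ⟨γ, ⟨hγ, h0⟩, hlt⟩ := ((h1.and h2).and self_mem_nhdsWithin).exists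
  have hb : BddBelow {γ : ℝ | 0 ≤ γ ∧ a ≤ biAwgnInfo γ} := ⟨0, fun _ h => h.1⟩
  exact (csInf_le hb ⟨h0.le, hγ.le⟩).trans_lt hlt

/-- By continuity the information stays below `a` up to some `γ > SNR`, and monotonicity makes `γ` a
lower bound. The condition `a < 1` keeps the set nonempty, so its infimum is not the default value
0. -/
theorem lt_snrOfInfo {a SNR : ℝ} (ha : biAwgnInfo SNR < a) (ha1 : a < 1) : SNR < snrOfInfo a := by
  have h1 : ∀ᶠ γ in 𝓝[>] SNR, biAwgnInfo γ < a :=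
    (continuous_biAwgnInfo.continuousAt.eventually (gt_mem_nhds ha)).filter_mono nhdsWithin_le_nhds
  obtain ⟨γ, hγ, hlt⟩ := (h1.and self_mem_nhdsWithin).exists
  refine lt_of_lt_of_le hlt (le_csInf (exists_le_biAwgnInfo ha1) fun γ' hγ' => ?_)
  by_contra hc
  push Not at hc
  exact absurd (hγ'.2.trans (monotone_biAwgnInfo hc.le)) (not_le.2 hγ)

theorem monotoneOn_snrOfInfo : MonotoneOn snrOfInfo (Set.Iio 1) := fun _ _ _ hb hab =>
  csInf_le_csInf ⟨0, fun _ h => h.1⟩ (exists_le_biAwgnInfo hb) fun _ h => ⟨h.1, hab.trans h.2⟩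

/-! ### Bounds for the binary entropy -/

/-- From `log (1 + t) ≤ t` at `t = e` and `t = -e`: the linear terms cancel and `e ^ 2` remains. -/
theorem log_two_sub_sq_le_binEntropy {e : ℝ} (he : |e| ≤ 1) :
    Real.log 2 - e ^ 2 ≤ Real.binEntropy ((1 + e) / 2) := by
  obtain ⟨h1, h2⟩ := abs_le.1 he
  have key : ∀ t : ℝ, -1 ≤ t → (1 + t) / 2 * Real.log ((1 + t) / 2)
      ≤ (1 + t) / 2 * (t - Real.log 2) := by
    intro t ht
    rcases ht.eq_or_lt with h | h
    · rw [← h]; norm_num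
    · refine mul_le_mul_of_nonneg_left ?_ (by linarith)
      rw [Real.log_div (by linarith) two_ne_zero]
      have := Real.log_le_sub_one_of_pos (x := 1 + t) (by linarith)
      linarith
  have k1 := key e h1
  have k2 := key (-e) (by linarith)
  rw [binEntropy_eq_neg, show 1 - (1 + e) / 2 = (1 + -e) / 2 by ring]
  nlinarith

/-- Near `e = ±1` the entropy is below `δ` by continuity; elsewhere `1 - e ^ 2` is bounded away from
0 and a large `K` absorbs `log 2`. -/
theorem exists_binEntropy_le {δ : ℝ} (hδ : 0 < δ) : ∃ K : ℝ, 0 ≤ K ∧ ∀ e : ℝ, |e| ≤ 1 →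
    Real.binEntropy ((1 + e) / 2) ≤ δ + K * (1 - e ^ 2) := by
  have h0 : ∀ᶠ p in 𝓝 (0 : ℝ), Real.binEntropy p < δ :=
    Real.binEntropy_continuous.continuousAt.eventually (gt_mem_nhds (by simpa using hδ))
  obtain ⟨η, hη, hηp⟩ := Metric.eventually_nhds_iff.1 h0
  set η' := min η (1 / 2) with hη'
  have hη'0 : 0 < η' := lt_min hη (by norm_num)
  have hη'1 : η' ≤ 1 / 2 := min_le_right _ _
  have hsmall : ∀ p, 0 ≤ p → p < η' → Real.binEntropy p < δ := fun p hp hpη => hηp (by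
    rw [Real.dist_eq, sub_zero, abs_of_nonneg hp]; exact hpη.trans_le (min_le_left _ _))
  refine ⟨Real.log 2 / η', div_nonneg log_two_pos.le hη'0.le, fun e he => ?_⟩
  obtain ⟨h1, h2⟩ := abs_le.1 he
  have hK : 0 ≤ Real.log 2 / η' := div_nonneg log_two_pos.le hη'0.le
  have hsq : 0 ≤ 1 - e ^ 2 := by nlinarith
  by_cases ha : (1 + e) / 2 < η'
  · have := hsmall _ (by linarith) ha
    nlinarith [mul_nonneg hK hsq]
  by_cases hb : (1 - e) / 2 < η'
  · have := hsmall _ (by linarith) hb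
    rw [← Real.binEntropy_one_sub, show 1 - (1 - e) / 2 = (1 + e) / 2 by ring] at this
    nlinarith [mul_nonneg hK hsq]
  push Not at ha hb
  have h3 : η' ≤ 1 - e ^ 2 := by nlinarith
  have h4 : Real.log 2 ≤ Real.log 2 / η' * (1 - e ^ 2) := by
    rw [div_mul_eq_mul_div, le_div_iff₀ hη'0]
    exact mul_le_mul_of_nonneg_left h3 log_two_pos.le
  linarith [Real.binEntropy_le_log_two (p := (1 + e) / 2)]

/-! ### Bounds by the mean squares of the extrinsic means -/

section Averages

open BinaryCode

variable {n : ℕ}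

theorem sqExtMean_nonneg {C : Finset (Fin n → Bool)} (hne : C.Nonempty) (γ : ℝ) (i : Fin n) :
    0 ≤ sqExtMean C (Real.sqrt γ) i := by
  rw [← integral_extVar_sq hne]
  exact integral_nonneg fun ω => sq_nonneg _

theorem integrable_extVar_sq {C : Finset (Fin n → Bool)} (hne : C.Nonempty) (γ : ℝ) (i : Fin n) :
    Integrable (fun ω => extVar C γ i ω ^ 2) (law C) := by
  have := isProbabilityMeasure_law hne
  exact integrable_of_abs_le ((measurable_extVar hne γ i).pow_const 2) (K := 1) fun ω => by
    rw [abs_pow]; exact pow_le_one₀ (abs_nonneg _) (abs_extVar_le hne γ i ω)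

/-- The average over the positions of the mean square of the extrinsic mean. -/
noncomputable def avgSqExtMean (C : Finset (Fin n → Bool)) (γ : ℝ) : ℝ :=
  (∑ i, sqExtMean C (Real.sqrt γ) i) / n

theorem avgSqExtMean_nonneg {C : Finset (Fin n → Bool)} (hne : C.Nonempty) (γ : ℝ) :
    0 ≤ avgSqExtMean C γ :=
  div_nonneg (Finset.sum_nonneg fun i _ => sqExtMean_nonneg hne γ i) (Nat.cast_nonneg _)

theorem real_bit_eq {C : Finset (Fin n → Bool)} (hne : C.Nonempty) (γ : ℝ) (i : Fin n) :
    (law C).real {ω | bit i ω = true} = (1 + ∫ ω, extVar C γ i ω ∂(law C)) / 2 := by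
  have := isProbabilityMeasure_law hne
  have hS : MeasurableSet {ω : (Fin n → Bool) × (Fin n → ℝ) | bit i ω = true} :=
    measurable_bit i (measurableSet_singleton true)
  have h := integral_indicator_const (μ := law C) (1 : ℝ) hS
  rw [smul_eq_mul, mul_one] at h
  have hb : Integrable (fun ω => bpsk (bit i ω)) (law C) :=
    integrable_of_abs_le (measurable_bpsk_bit i) fun ω => (abs_bpsk _).le
  have h2 := setIntegral_bpsk_eq hne γ i (S := Set.univ) MeasurableSet.univ
  rw [setIntegral_univ, setIntegral_univ] at h2
  rw [← h, ← h2, indicator_bit_eq, integral_div, integral_add (integrable_const _) (hb.const_mul _),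
    integral_const_mul, bpsk_true]
  simp

theorem sq_integral_extVar_le {C : Finset (Fin n → Bool)} (hne : C.Nonempty) (γ : ℝ) (i : Fin n) :
    (∫ ω, extVar C γ i ω ∂(law C)) ^ 2 ≤ sqExtMean C (Real.sqrt γ) i := by
  have := isProbabilityMeasure_law hne
  rw [← integral_extVar_sq hne]
  have he : Integrable (extVar C γ i) (law C) :=
    integrable_of_abs_le (measurable_extVar hne γ i) (abs_extVar_le hne γ i)
  set m := ∫ ω, extVar C γ i ω ∂(law C) with hm
  have h := integral_mono (μ := law C) ((he.const_mul (2 * m)).sub (integrable_const (m ^ 2)))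
    (integrable_extVar_sq hne γ i) fun ω => by
      simp only [Pi.sub_apply]; nlinarith [sq_nonneg (extVar C γ i ω - m)]
  simp only [Pi.sub_apply] at h
  rw [integral_sub (he.const_mul _) (integrable_const _), integral_const_mul, ← hm] at h
  simp at h
  linarith

/-- The bias of a bit is half the mean of its extrinsic mean, so its square is at most the mean
square; Cauchy-Schwarz over the positions does the rest. -/
theorem avg_abs_bit_sub_half_le {C : Finset (Fin n → Bool)} (hne : C.Nonempty) (γ : ℝ) :
    (∑ i, |(law C).real {ω | bit i ω = true} - 1 / 2|) / n
      ≤ Real.sqrt (avgSqExtMean C γ) := by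
  refine Real.le_sqrt_of_sq_le ?_
  rcases Nat.eq_zero_or_pos n with h0 | hn
  · subst h0; simpa using avgSqExtMean_nonneg hne γ
  have hn' : (0 : ℝ) < n := Nat.cast_pos.2 hn
  have h1 := sq_sum_le_card_mul_sum_sq (s := Finset.univ)
    (f := fun i : Fin n => |(law C).real {ω | bit i ω = true} - 1 / 2|)
  have h2 : ∑ i : Fin n, |(law C).real {ω | bit i ω = true} - 1 / 2| ^ 2
      ≤ ∑ i, sqExtMean C (Real.sqrt γ) i := by
    refine Finset.sum_le_sum fun i _ => ?_
    rw [sq_abs, real_bit_eq hne γ i]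
    nlinarith [sq_integral_extVar_le hne γ i, sq_nonneg (∫ ω, extVar C γ i ω ∂(law C))]
  rw [Finset.card_univ, Fintype.card_fin] at h1
  rw [avgSqExtMean, div_pow, div_le_div_iff₀ (by positivity) hn']
  nlinarith [mul_le_mul_of_nonneg_left h2 hn'.le]

theorem llrOfMean_eq_log {e : ℝ} (h1 : -1 < e) (h2 : e < 1) :
    llrOfMean e = (Real.log ((1 + e) / (1 - e)) : ℝ) := by
  have p1 : 0 < (1 + e) / 2 := by linarith
  have p2 : 0 < (1 - e) / 2 := by linarith
  rw [llrOfMean, ← ENNReal.ofReal_div_of_pos p2, ENNReal.log_ofReal_of_pos (div_pos p1 p2)]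
  congr 2
  have : 1 - e ≠ 0 := by linarith
  field_simp

/-- The threshold is `tanh (ε / 2)`, the mean of a bit whose LLR is `ε`. -/
theorem llrOfMean_mem_Icc {ε e : ℝ} (h : |e| < (Real.exp ε - 1) / (Real.exp ε + 1)) :
    llrOfMean e ∈ Set.Icc ((-ε : ℝ) : EReal) (ε : EReal) := by
  have hp := Real.exp_pos ε
  rw [lt_div_iff₀ (by linarith)] at h
  have ha := abs_nonneg e
  have hlt : |e| < 1 := by nlinarith
  obtain ⟨h1, h2⟩ := abs_lt.1 hlt
  have hq : 0 < (1 + e) / (1 - e) := div_pos (by linarith) (by linarith)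
  rw [llrOfMean_eq_log h1 h2, Set.mem_Icc, EReal.coe_le_coe_iff, EReal.coe_le_coe_iff,
    Real.le_log_iff_exp_le hq, Real.log_le_iff_le_exp hq, Real.exp_neg,
    div_le_iff₀ (by linarith), le_div_iff₀ (by linarith), inv_mul_le_iff₀ hp]
  have b1 := mul_le_mul_of_nonneg_right (le_abs_self e) (by linarith : 0 ≤ Real.exp ε + 1)
  have b2 := mul_le_mul_of_nonneg_right (neg_abs_le e) (by linarith : 0 ≤ Real.exp ε + 1)
  constructor <;> nlinarith

theorem real_extrinsicLLR_notMem_le {C : Finset (Fin n → Bool)} (hne : C.Nonempty) (γ : ℝ)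
    (i : Fin n) {ε : ℝ} (hε : 0 < ε) :
    (law C).real {ω | extrinsicLLR C γ i ω ∉ Set.Icc ((-ε : ℝ) : EReal) (ε : EReal)}
      ≤ sqExtMean C (Real.sqrt γ) i / ((Real.exp ε - 1) / (Real.exp ε + 1)) ^ 2 := by
  have := isProbabilityMeasure_law hne
  have ht : 0 < (Real.exp ε - 1) / (Real.exp ε + 1) :=
    div_pos (by linarith [Real.add_one_le_exp ε]) (by linarith [Real.exp_pos ε])
  set t := (Real.exp ε - 1) / (Real.exp ε + 1) with htd
  have h1 : (law C).real {ω | extrinsicLLR C γ i ω ∉ Set.Icc ((-ε : ℝ) : EReal) (ε : EReal)}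
      ≤ (law C).real {ω | t ^ 2 ≤ extVar C γ i ω ^ 2} := by
    refine ENNReal.toReal_mono (measure_ne_top _ _) (measure_mono_ae ?_)
    filter_upwards [extrinsicLLR_ae_eq hne γ i] with ω hω hmem
    change extrinsicLLR C γ i ω ∉ _ at hmem
    change t ^ 2 ≤ extVar C γ i ω ^ 2
    rw [hω] at hmem
    by_contra hc
    rw [not_le, sq_lt_sq, abs_of_pos ht] at hc
    exact hmem (llrOfMean_mem_Icc hc)
  have h2 := mul_meas_ge_le_integral_of_nonneg (μ := law C)
    (ae_of_all _ fun ω => sq_nonneg (extVar C γ i ω)) (integrable_extVar_sq hne γ i) (t ^ 2)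
  rw [integral_extVar_sq hne] at h2
  rw [le_div_iff₀ (by positivity)]
  calc _ ≤ (law C).real {ω | t ^ 2 ≤ extVar C γ i ω ^ 2} * t ^ 2 :=
        mul_le_mul_of_nonneg_right h1 (by positivity)
    _ ≤ _ := by rw [mul_comm]; exact h2

theorem llrOfMean_neg (e : ℝ) : llrOfMean (-e) = -llrOfMean e := by
  rw [llrOfMean, llrOfMean, ← ENNReal.log_inv, ENNReal.inv_div (by simp) (by
    rw [ENNReal.ofReal_ne_zero_iff, ENNReal.ofReal_ne_zero_iff]
    by_contra! h
    linarith [h.1, h.2])]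
  congr 3
  ring

/-- The bound is `tanh (M / 2)`. At `e = -1` it is trivial, and `e = 1` is excluded since its LLR is
infinite. -/
theorem le_of_llrOfMean_le {M e : ℝ} (he : |e| ≤ 1) (h : llrOfMean e ≤ (M : EReal)) :
    e ≤ 1 - 2 / (1 + Real.exp M) := by
  have hp := Real.exp_pos M
  obtain ⟨h1, h2⟩ := abs_le.1 he
  have hM : 0 ≤ 1 - 2 / (1 + Real.exp M) + 1 := by
    have : 2 / (1 + Real.exp M) ≤ 2 := div_le_self (by norm_num) (by linarith)
    linarith
  rcases h1.eq_or_lt with h1' | h1'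
  · linarith
  rcases h2.eq_or_lt with h2' | h2'
  · subst h2'
    exfalso
    rw [llrOfMean] at h
    norm_num at h
  · rw [llrOfMean_eq_log h1' h2', EReal.coe_le_coe_iff,
      Real.log_le_iff_le_exp (div_pos (by linarith) (by linarith)), div_le_iff₀ (by linarith)] at h
    rw [le_sub_iff_add_le, ← le_sub_iff_add_le', div_le_iff₀ (by linarith)]
    nlinarith

theorem bpsk_mul_llrOfMean (b : Bool) (e : ℝ) :
    (bpsk b : EReal) * llrOfMean e = llrOfMean (bpsk b * e) := by
  cases b
  · rw [bpsk_false, neg_one_mul, llrOfMean_neg, EReal.coe_neg, EReal.coe_one, EReal.neg_mul,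
      one_mul]
  · rw [bpsk_true, EReal.coe_one, one_mul, one_mul]

theorem integral_bpsk_mul_extVar {C : Finset (Fin n → Bool)} (hne : C.Nonempty) (γ : ℝ)
    (i : Fin n) :
    ∫ ω, bpsk (bit i ω) * extVar C γ i ω ∂(law C) = sqExtMean C (Real.sqrt γ) i := by
  rw [← codeAvg_bpsk_mul_extMean hne]
  have := integral_law_recv hne γ (F := fun x y => bpsk (x i) * extMean C (Real.sqrt γ) i y)
    (fun x => (measurable_extMean hne _ i).const_mul _) (K := 1) fun x y => by
      rw [abs_mul, abs_bpsk, one_mul]; exact abs_extMean_le hne _ i y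
  simp only [integral_const_mul] at this
  exact this

/-- Markov's inequality for the nonnegative variable `1 - X_i e_i`. Its mean is `1 - E[e_i ^ 2]`,
because `e_i` is the conditional mean of `X_i`. -/
theorem real_bpsk_mul_extrinsicLLR_le {C : Finset (Fin n → Bool)} (hne : C.Nonempty) (γ : ℝ)
    (i : Fin n) (M : ℝ) :
    (law C).real {ω | (bpsk (bit i ω) : EReal) * extrinsicLLR C γ i ω ≤ (M : EReal)}
      ≤ (1 - sqExtMean C (Real.sqrt γ) i) / (2 / (1 + Real.exp M)) := by
  have := isProbabilityMeasure_law hne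
  have hδ : 0 < 2 / (1 + Real.exp M) := div_pos two_pos (by linarith [Real.exp_pos M])
  set δ := 2 / (1 + Real.exp M) with hδd
  have habs : ∀ ω, |bpsk (bit i ω) * extVar C γ i ω| ≤ 1 := fun ω => by
    rw [abs_mul, abs_bpsk, one_mul]; exact abs_extVar_le hne γ i ω
  have hi : Integrable (fun ω => bpsk (bit i ω) * extVar C γ i ω) (law C) :=
    integrable_of_abs_le ((measurable_bpsk_bit i).mul (measurable_extVar hne γ i)) habs
  have h1 : (law C).real {ω | (bpsk (bit i ω) : EReal) * extrinsicLLR C γ i ω ≤ (M : EReal)}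
      ≤ (law C).real {ω | δ ≤ 1 - bpsk (bit i ω) * extVar C γ i ω} := by
    refine ENNReal.toReal_mono (measure_ne_top _ _) (measure_mono_ae ?_)
    filter_upwards [extrinsicLLR_ae_eq hne γ i] with ω hω hmem
    change (bpsk (bit i ω) : EReal) * extrinsicLLR C γ i ω ≤ _ at hmem
    change δ ≤ 1 - bpsk (bit i ω) * extVar C γ i ω
    rw [hω, bpsk_mul_llrOfMean] at hmem
    linarith [le_of_llrOfMean_le (habs ω) hmem]
  have h2 := mul_meas_ge_le_integral_of_nonneg (μ := law C)
    (f := fun ω => 1 - bpsk (bit i ω) * extVar C γ i ω)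
    (ae_of_all _ fun ω => sub_nonneg.2 (abs_le.1 (habs ω)).2) ((integrable_const 1).sub hi) δ
  rw [integral_sub (integrable_const 1) hi, integral_bpsk_mul_extVar hne] at h2
  simp only [integral_const, probReal_univ, smul_eq_mul, mul_one] at h2
  rw [le_div_iff₀ hδ]
  calc _ ≤ (law C).real {ω | δ ≤ 1 - bpsk (bit i ω) * extVar C γ i ω} * δ :=
        mul_le_mul_of_nonneg_right h1 hδ.le
    _ ≤ _ := by rw [mul_comm]; exact h2

/-! ### Bounds for the extrinsic information -/

theorem measurable_binEntropy_extVar {C : Finset (Fin n → Bool)} (hne : C.Nonempty) (γ : ℝ)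
    (i : Fin n) : Measurable fun ω => Real.binEntropy ((1 + extVar C γ i ω) / 2) :=
  Real.binEntropy_continuous.measurable.comp (((measurable_extVar hne γ i).const_add 1).div_const 2)

theorem abs_binEntropy_extVar_le {C : Finset (Fin n → Bool)} (hne : C.Nonempty) (γ : ℝ)
    (i : Fin n) (ω : (Fin n → Bool) × (Fin n → ℝ)) :
    |Real.binEntropy ((1 + extVar C γ i ω) / 2)| ≤ Real.log 2 := by
  obtain ⟨h1, h2⟩ := abs_le.1 (abs_extVar_le hne γ i ω)
  exact abs_binEntropy_le (by linarith) (by linarith)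

theorem integrable_binEntropy_extVar {C : Finset (Fin n → Bool)} (hne : C.Nonempty) (γ : ℝ)
    (i : Fin n) : Integrable (fun ω => Real.binEntropy ((1 + extVar C γ i ω) / 2)) (law C) := by
  have := isProbabilityMeasure_law hne
  exact integrable_of_abs_le (measurable_binEntropy_extVar hne γ i) (abs_binEntropy_extVar_le hne γ i)

theorem extrinsicInfo_nonneg (C : Finset (Fin n → Bool)) (γ : ℝ) : 0 ≤ extrinsicInfo C γ :=
  div_nonneg (Finset.sum_nonneg fun _ _ => div_nonneg ENNReal.toReal_nonneg log_two_pos.le)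
    (Nat.cast_nonneg _)

theorem avg_le_of_forall_le {f : Fin n → ℝ} {c : ℝ} (hc : 0 ≤ c) (h : ∀ i, f i ≤ c) :
    (∑ i, f i) / n ≤ c := by
  rcases Nat.eq_zero_or_pos n with h0 | hn
  · subst h0; simpa using hc
  rw [div_le_iff₀ (Nat.cast_pos.2 hn)]
  calc ∑ i, f i ≤ ∑ _i : Fin n, c := Finset.sum_le_sum fun i _ => h i
    _ = c * n := by simp [mul_comm]

theorem extrinsicInfo_le_one {C : Finset (Fin n → Bool)} (hne : C.Nonempty) (γ : ℝ) :
    extrinsicInfo C γ ≤ 1 := by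
  refine avg_le_of_forall_le zero_le_one fun i => ?_
  rw [mutualInfoBits_extrinsicLLR hne, div_le_one log_two_pos]
  have h : 0 ≤ ∫ ω, Real.binEntropy ((1 + extVar C γ i ω) / 2) ∂(law C) :=
    integral_nonneg fun ω => by
      obtain ⟨h1, h2⟩ := abs_le.1 (abs_extVar_le hne γ i ω)
      exact Real.binEntropy_nonneg (by linarith) (by linarith)
  linarith [Real.binEntropy_le_log_two (p := (law C).real {ω | bit i ω = true})]

/-- The prior entropy is at most `log 2`, and the posterior entropy at least `log 2 - e ^ 2`. -/
theorem extrinsicInfo_le {C : Finset (Fin n → Bool)} (hne : C.Nonempty) (γ : ℝ) :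
    extrinsicInfo C γ ≤ avgSqExtMean C γ / Real.log 2 := by
  have := isProbabilityMeasure_law hne
  rw [extrinsicInfo, avgSqExtMean, div_right_comm]
  refine div_le_div_of_nonneg_right ?_ (Nat.cast_nonneg _)
  rw [Finset.sum_div]
  refine Finset.sum_le_sum fun i _ => ?_
  rw [mutualInfoBits_extrinsicLLR hne]
  refine div_le_div_of_nonneg_right ?_ log_two_pos.le
  have h := integral_mono (μ := law C) ((integrable_const (Real.log 2)).sub
    (integrable_extVar_sq hne γ i)) (integrable_binEntropy_extVar hne γ i) fun ω =>
      log_two_sub_sq_le_binEntropy (abs_extVar_le hne γ i ω)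
  simp only [Pi.sub_apply] at h
  rw [integral_sub (integrable_const _) (integrable_extVar_sq hne γ i),
    integral_extVar_sq hne] at h
  simp at h
  linarith [Real.binEntropy_le_log_two (p := (law C).real {ω | bit i ω = true})]

/-- The mean square at SNR 0 controls the bias of the bits, hence the loss of prior entropy; the
posterior entropy is controlled by `hK`. -/
theorem le_extrinsicInfo {C : Finset (Fin n → Bool)} (hne : C.Nonempty) (hn : 0 < n) (γ : ℝ)
    {δ K : ℝ} (hK : ∀ e : ℝ, |e| ≤ 1 → Real.binEntropy ((1 + e) / 2) ≤ δ + K * (1 - e ^ 2)) :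
    1 - (avgSqExtMean C 0 + δ + K * (1 - avgSqExtMean C γ)) / Real.log 2 ≤ extrinsicInfo C γ := by
  have := isProbabilityMeasure_law hne
  have hn' : (0 : ℝ) < n := Nat.cast_pos.2 hn
  have key : ∀ i, 1 - (sqExtMean C (Real.sqrt 0) i + δ + K * (1 - sqExtMean C (Real.sqrt γ) i))
      / Real.log 2 ≤ mutualInfoBits (law C) (bit i) (extrinsicLLR C γ i) := by
    intro i
    rw [mutualInfoBits_extrinsicLLR hne, one_sub_div log_two_pos.ne']
    refine div_le_div_of_nonneg_right ?_ log_two_pos.le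
    have hsq := integrable_extVar_sq hne γ i
    have hi : Integrable (fun ω => 1 - extVar C γ i ω ^ 2) (law C) := (integrable_const 1).sub hsq
    have h := integral_mono (μ := law C) (integrable_binEntropy_extVar hne γ i)
      ((integrable_const δ).add (hi.const_mul K)) fun ω => hK _ (abs_extVar_le hne γ i ω)
    simp only [Pi.add_apply] at h
    rw [integral_add (integrable_const _) (hi.const_mul K), integral_const_mul,
      integral_sub (integrable_const _) hsq, integral_extVar_sq hne] at h
    simp at h
    have hm : |∫ ω, extVar C 0 i ω ∂(law C)| ≤ 1 := by
      have := norm_integral_le_of_norm_le_const (μ := law C)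
        (f := extVar C 0 i) (C := 1) (ae_of_all _ fun ω => abs_extVar_le hne 0 i ω)
      simpa using this
    have h2 := log_two_sub_sq_le_binEntropy hm
    rw [← real_bit_eq hne 0 i] at h2
    have h3 := sq_integral_extVar_le hne 0 i
    refine le_trans ?_ (sub_le_sub ((sub_le_sub_left h3 _).trans h2) h)
    linarith
  rw [extrinsicInfo, le_div_iff₀ hn']
  refine le_of_eq_of_le ?_ (Finset.sum_le_sum fun i _ => key i)
  rw [Finset.sum_sub_distrib, ← Finset.sum_div, Finset.sum_add_distrib, Finset.sum_add_distrib,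
    ← Finset.mul_sum, Finset.sum_sub_distrib]
  simp only [Finset.sum_const, Finset.card_univ, Fintype.card_fin, nsmul_eq_mul, mul_one,
    avgSqExtMean]
  field_simp

theorem continuous_extrinsicInfo {C : Finset (Fin n → Bool)} (hne : C.Nonempty) :
    Continuous (extrinsicInfo C) := by
  have := isProbabilityMeasure_law hne
  have hc : ∀ (i : Fin n) ω, Continuous fun γ => extVar C γ i ω := fun i ω => by
    have h : Continuous fun γ : ℝ => (Real.sqrt γ, recv γ ω) := by
      refine Real.continuous_sqrt.prodMk (continuous_pi fun j => ?_)
      exact (Real.continuous_sqrt.mul continuous_const).add continuous_const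
    have h2 := (continuous_extMean hne i).comp h
    exact h2
  have hfun : extrinsicInfo C = fun γ => (∑ i, (Real.binEntropy ((law C).real {ω | bit i ω = true})
      - ∫ ω, Real.binEntropy ((1 + extVar C γ i ω) / 2) ∂(law C)) / Real.log 2) / n := by
    ext γ
    rw [extrinsicInfo]
    simp only [mutualInfoBits_extrinsicLLR hne]
  rw [hfun]
  refine (continuous_finsetSum _ fun i _ => (continuous_const.sub ?_).div_const _).div_const _
  refine continuous_of_dominated (bound := fun _ => Real.log 2)
    (fun γ => (measurable_binEntropy_extVar hne γ i).aestronglyMeasurable)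
    (fun γ => ae_of_all _ fun ω => abs_binEntropy_extVar_le hne γ i ω) (integrable_const _)
    (ae_of_all _ fun ω => ?_)
  exact Real.binEntropy_continuous.comp ((continuous_const.add (hc i ω)).div_const 2)

end Averages

/-! ### Asymptotics for capacity-achieving sequences -/

section Limits

open BinaryCode

theorem sqExtMean_le_one {n : ℕ} {C : Finset (Fin n → Bool)} (hne : C.Nonempty) (γ : ℝ)
    (i : Fin n) : sqExtMean C (Real.sqrt γ) i ≤ 1 := by
  have := isProbabilityMeasure_law hne
  rw [← integral_extVar_sq hne]
  have h := integral_mono (μ := law C) (integrable_extVar_sq hne γ i) (integrable_const 1) fun ω =>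
    (sq_le_one_iff_abs_le_one _).2 (abs_extVar_le hne γ i ω)
  simpa using h

theorem avgSqExtMean_le_one {n : ℕ} {C : Finset (Fin n → Bool)} (hne : C.Nonempty) (γ : ℝ) :
    avgSqExtMean C γ ≤ 1 := avg_le_of_forall_le zero_le_one fun i => sqExtMean_le_one hne γ i

theorem one_sub_avgSqExtMean_le {n : ℕ} {C : Finset (Fin n → Bool)} (hne : C.Nonempty) (hn : 0 < n)
    (γ : ℝ) {dec : (Fin n → ℝ) → Fin n → Bool} (hdec : Measurable dec) :
    1 - avgSqExtMean C γ ≤ 4 * errorProb C γ dec / noiseFactor (Real.sqrt γ) := by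
  have hn' : (0 : ℝ) < n := Nat.cast_pos.2 hn
  have hf := noiseFactor_pos (Real.sqrt γ)
  have h : (∑ i : Fin n, (1 - sqExtMean C (Real.sqrt γ) i)) / n
      ≤ 4 * errorProb C γ dec / noiseFactor (Real.sqrt γ) := by
    refine avg_le_of_forall_le (div_nonneg (mul_nonneg (by norm_num) measureReal_nonneg) hf.le)
      fun i => ?_
    rw [le_div_iff₀ hf, errorProb_eq hne γ hdec]
    linarith [noiseFactor_mul_le hne (Real.sqrt γ) i hdec]
  rw [Finset.sum_sub_distrib, sub_div] at h
  simpa [hn'.ne', avgSqExtMean] using h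

theorem log_card_le {n : ℕ} (C : Finset (Fin n → Bool)) : Real.log C.card ≤ n * Real.log 2 := by
  rcases C.eq_empty_or_nonempty with h | h
  · subst h; simpa using mul_nonneg (Nat.cast_nonneg n) log_two_pos.le
  rw [← Real.log_pow]
  refine Real.log_le_log (Nat.cast_pos.2 h.card_pos) ?_
  have := Finset.card_le_univ C
  rw [Fintype.card_fun, Fintype.card_bool, Fintype.card_fin] at this
  exact_mod_cast this

theorem mul_avgSqExtMean_le {n : ℕ} {C : Finset (Fin n → Bool)} (hne : C.Nonempty) (hn : 0 < n)
    {γ γ' : ℝ} (hγ : 0 ≤ γ) (hγ' : γ < γ') {dec : (Fin n → ℝ) → Fin n → Bool}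
    (hdec : Measurable dec) {ε : ℝ} (h0 : 0 < ε) (h1 : ε < 1) :
    ((gaussMean (Real.sqrt γ') - gaussMean (Real.sqrt γ)) / 2) ^ 2 / 4 * avgSqExtMean C γ
      ≤ symInfo (Real.sqrt γ') - rate C * Real.log 2 - Real.log (1 - ε)
        + errorProb C γ' dec * (Real.log 2 - Real.log ε) := by
  have hn' : (1 : ℝ) ≤ n := Nat.one_le_cast.2 hn
  have hn0 : (0 : ℝ) < n := by linarith
  have h := sum_sqExtMean_le (Real.sqrt_nonneg γ) (Real.sqrt_lt_sqrt hγ hγ') hne hdec h0 h1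
  rw [← errorProb_eq hne γ' hdec] at h
  have he : 0 ≤ errorProb C γ' dec := measureReal_nonneg
  have hl1 : Real.log (1 - ε) ≤ 0 := Real.log_nonpos (by linarith) (by linarith)
  have hl2 : Real.log ε ≤ 0 := Real.log_nonpos h0.le h1.le
  have hr : rate C * Real.log 2 * n = Real.log C.card := by
    have := log_two_pos.ne'
    rw [rate, Real.logb]
    field_simp
  have h2 : errorProb C γ' dec * (Real.log C.card - Real.log ε)
      ≤ errorProb C γ' dec * (n * (Real.log 2 - Real.log ε)) :=
    mul_le_mul_of_nonneg_left (by nlinarith [log_card_le C]) he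
  -- Terms that do not grow with the length are enlarged by the factor `n ≥ 1`, so that dividing by
  -- `n` leaves a bound without `n`.
  have h3 : -Real.log (1 - ε) ≤ n * -Real.log (1 - ε) := by nlinarith
  rw [avgSqExtMean, ← mul_div_assoc, div_le_iff₀ hn0]
  nlinarith

variable {SNR : ℝ} {n : ℕ → ℕ} {C : (k : ℕ) → Finset (Fin (n k) → Bool)}

/-- A code of length 0 has rate 0 by the convention for division, whereas the limiting rate is
positive. -/
theorem eventually_length_pos (hSNR : 0 < SNR) (hC : CapacityAchieving SNR n C) :
    ∀ᶠ k in atTop, 0 < n k := by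
  filter_upwards [hC.1.eventually (lt_mem_nhds (biAwgnInfo_pos hSNR))] with k hk
  refine Nat.pos_of_ne_zero fun h => hk.ne' ?_
  rw [rate, (Nat.cast_eq_zero (R := ℝ)).2 h, div_zero]

theorem tendsto_avgSqExtMean_zero (hSNR : 0 < SNR) (hne : ∀ k, (C k).Nonempty)
    (hC : CapacityAchieving SNR n C) {γ : ℝ} (hγ : 0 ≤ γ) (hγS : γ < SNR) :
    Tendsto (fun k => avgSqExtMean (C k) γ) atTop (𝓝 0) := by
  rw [tendsto_order]
  refine ⟨fun a ha => Eventually.of_forall fun k => ha.trans_le (avgSqExtMean_nonneg (hne k) γ),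
    fun η hη => ?_⟩
  have hd : 0 < (gaussMean (Real.sqrt SNR) - gaussMean (Real.sqrt γ)) / 2 := by
    linarith [gaussMean_lt (Real.sqrt_nonneg γ) (Real.sqrt_lt_sqrt hγ hγS)]
  -- The gap is measured at `SNR` itself, so the constant `c` is fixed before `γ'` is chosen;
  -- monotonicity of `gaussMean` compares it later with the gap at `γ'`.
  set d := (gaussMean (Real.sqrt SNR) - gaussMean (Real.sqrt γ)) / 2 with hdd
  set c := d ^ 2 / 4 with hc
  have hc0 : 0 < c := by positivity
  have hη3 : 0 < c * η / 3 := by positivity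
  obtain ⟨γ', hγ', hSγ'⟩ : ∃ γ', symInfo (Real.sqrt γ') < symInfo (Real.sqrt SNR) + c * η / 3 ∧
      SNR < γ' := by
    have h1 : ∀ᶠ γ' in 𝓝[>] SNR, symInfo (Real.sqrt γ') < symInfo (Real.sqrt SNR) + c * η / 3 :=
      ((continuous_symInfo.comp Real.continuous_sqrt).continuousAt.eventually
        (gt_mem_nhds (by simpa using hη3))).filter_mono nhdsWithin_le_nhds
    exact (h1.and self_mem_nhdsWithin).exists
  obtain ⟨dec, hdec, herr⟩ := hC.2 γ' hSγ'
  -- Budget: `c * η / 3` for the excess of information at `γ'` and `c * η / 3` for `-log (1 - ε)`.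
  -- The decoding term tends to 0 because `ε` is fixed.
  have hε0 : 0 < 1 - Real.exp (-(c * η / 3)) := by
    rw [sub_pos, Real.exp_lt_one_iff]; linarith
  have hε1 : 1 - Real.exp (-(c * η / 3)) < 1 := by linarith [Real.exp_pos (-(c * η / 3))]
  set ε := 1 - Real.exp (-(c * η / 3)) with hε
  have hlog : Real.log (1 - ε) = -(c * η / 3) := by rw [hε, sub_sub_cancel, Real.log_exp]
  have hlim : Tendsto (fun k => symInfo (Real.sqrt γ') - rate (C k) * Real.log 2 - Real.log (1 - ε)
      + errorProb (C k) γ' (dec k) * (Real.log 2 - Real.log ε)) atTop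
      (𝓝 (symInfo (Real.sqrt γ') - biAwgnInfo SNR * Real.log 2 - Real.log (1 - ε)
        + 0 * (Real.log 2 - Real.log ε))) :=
    ((tendsto_const_nhds.sub (hC.1.mul_const _)).sub tendsto_const_nhds).add (herr.mul_const _)
  rw [hlog, biAwgnInfo_eq, div_mul_cancel₀ _ log_two_pos.ne'] at hlim
  have hsmall : symInfo (Real.sqrt γ') - symInfo (Real.sqrt SNR) - -(c * η / 3)
      + 0 * (Real.log 2 - Real.log ε) < c * η := by linarith
  filter_upwards [eventually_length_pos hSNR hC, hlim.eventually (gt_mem_nhds hsmall)] with k hk hlt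
  have key := mul_avgSqExtMean_le (hne k) hk hγ (hγS.trans hSγ') (hdec k) hε0 hε1
  rw [hlog] at key
  have hmono : d ≤ (gaussMean (Real.sqrt γ') - gaussMean (Real.sqrt γ)) / 2 := by
    linarith [gaussMean_lt (Real.sqrt_nonneg SNR) (Real.sqrt_lt_sqrt hSNR.le hSγ')]
  have hcoef : c ≤ ((gaussMean (Real.sqrt γ') - gaussMean (Real.sqrt γ)) / 2) ^ 2 / 4 := by
    rw [hc]
    have := pow_le_pow_left₀ hd.le hmono 2
    linarith
  have h1 := mul_le_mul_of_nonneg_right hcoef (avgSqExtMean_nonneg (hne k) γ)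
  exact lt_of_mul_lt_mul_left (h1.trans_lt (key.trans_lt hlt)) hc0.le

theorem tendsto_avgSqExtMean_one (hSNR : 0 < SNR) (hne : ∀ k, (C k).Nonempty)
    (hC : CapacityAchieving SNR n C) {γ : ℝ} (hγ : SNR < γ) :
    Tendsto (fun k => avgSqExtMean (C k) γ) atTop (𝓝 1) := by
  obtain ⟨dec, hdec, herr⟩ := hC.2 γ hγ
  have hlim : Tendsto (fun k => 1 - 4 * errorProb (C k) γ (dec k) / noiseFactor (Real.sqrt γ)) atTop
      (𝓝 (1 - 4 * 0 / noiseFactor (Real.sqrt γ))) :=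
    tendsto_const_nhds.sub ((herr.const_mul 4).div_const _)
  rw [mul_zero, zero_div, sub_zero] at hlim
  refine tendsto_of_tendsto_of_tendsto_of_le_of_le' hlim tendsto_const_nhds ?_
    (Eventually.of_forall fun k => avgSqExtMean_le_one (hne k) γ)
  filter_upwards [eventually_length_pos hSNR hC] with k hk
  linarith [one_sub_avgSqExtMean_le (hne k) hk γ (hdec k)]

theorem tendsto_avg_abs_bit_sub_half (hSNR : 0 < SNR) (hne : ∀ k, (C k).Nonempty)
    (hC : CapacityAchieving SNR n C) :
    Tendsto (fun k => (∑ i : Fin (n k), |(law (C k)).real {ω | bit i ω = true} - 1 / 2|) / (n k : ℝ))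
      atTop (𝓝 0) := by
  have h := (tendsto_avgSqExtMean_zero hSNR hne hC le_rfl hSNR).sqrt
  rw [Real.sqrt_zero] at h
  exact squeeze_zero (fun k => div_nonneg (Finset.sum_nonneg fun _ _ => abs_nonneg _)
    (Nat.cast_nonneg _)) (fun k => avg_abs_bit_sub_half_le (hne k) 0) h

theorem tendsto_avg_extrinsicLLR_notMem (hSNR : 0 < SNR) (hne : ∀ k, (C k).Nonempty)
    (hC : CapacityAchieving SNR n C) {γ : ℝ} (hγ : 0 ≤ γ) (hγS : γ < SNR) {ε : ℝ} (hε : 0 < ε) :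
    Tendsto (fun k => (∑ i : Fin (n k), (law (C k)).real
      {ω | extrinsicLLR (C k) γ i ω ∉ Set.Icc ((-ε : ℝ) : EReal) (ε : EReal)}) / (n k : ℝ))
      atTop (𝓝 0) := by
  have h := (tendsto_avgSqExtMean_zero hSNR hne hC hγ hγS).div_const
    (((Real.exp ε - 1) / (Real.exp ε + 1)) ^ 2)
  rw [zero_div] at h
  refine squeeze_zero (fun k => div_nonneg (Finset.sum_nonneg fun _ _ => measureReal_nonneg)
    (Nat.cast_nonneg _)) (fun k => ?_) h
  rw [avgSqExtMean, div_right_comm (∑ i, sqExtMean _ _ i)]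
  refine div_le_div_of_nonneg_right ?_ (Nat.cast_nonneg _)
  rw [Finset.sum_div]
  exact Finset.sum_le_sum fun i _ => real_extrinsicLLR_notMem_le (hne k) γ i hε

theorem tendsto_avg_bpsk_mul_extrinsicLLR_le (hSNR : 0 < SNR) (hne : ∀ k, (C k).Nonempty)
    (hC : CapacityAchieving SNR n C) {γ : ℝ} (hγ : SNR < γ) (M : ℝ) :
    Tendsto (fun k => (∑ i : Fin (n k), (law (C k)).real
      {ω | (bpsk (bit i ω) : EReal) * extrinsicLLR (C k) γ i ω ≤ (M : EReal)}) / (n k : ℝ))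
      atTop (𝓝 0) := by
  have h := ((tendsto_const_nhds (x := (1 : ℝ))).sub
    (tendsto_avgSqExtMean_one hSNR hne hC hγ)).div_const (2 / (1 + Real.exp M))
  rw [sub_self, zero_div] at h
  refine tendsto_of_tendsto_of_tendsto_of_le_of_le' tendsto_const_nhds h
    (Eventually.of_forall fun k => div_nonneg (Finset.sum_nonneg fun _ _ => measureReal_nonneg)
      (Nat.cast_nonneg _)) ?_
  filter_upwards [eventually_length_pos hSNR hC] with k hk
  have hk' : (n k : ℝ) ≠ 0 := (Nat.cast_pos.2 hk).ne'
  have : 1 - avgSqExtMean (C k) γ = (∑ i, (1 - sqExtMean (C k) (Real.sqrt γ) i)) / n k := by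
    rw [Finset.sum_sub_distrib, sub_div]
    simp [hk', avgSqExtMean]
  rw [this, div_right_comm (∑ i, (1 - sqExtMean _ _ i))]
  refine div_le_div_of_nonneg_right ?_ (Nat.cast_nonneg _)
  rw [Finset.sum_div]
  exact Finset.sum_le_sum fun i _ => real_bpsk_mul_extrinsicLLR_le (hne k) γ i M

theorem tendsto_extrinsicInfo_zero (hSNR : 0 < SNR) (hne : ∀ k, (C k).Nonempty)
    (hC : CapacityAchieving SNR n C) {γ : ℝ} (hγ : 0 ≤ γ) (hγS : γ < SNR) :
    Tendsto (fun k => extrinsicInfo (C k) γ) atTop (𝓝 0) := by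
  have h := (tendsto_avgSqExtMean_zero hSNR hne hC hγ hγS).div_const (Real.log 2)
  rw [zero_div] at h
  exact squeeze_zero (fun k => extrinsicInfo_nonneg (C k) γ) (fun k => extrinsicInfo_le (hne k) γ) h

theorem tendsto_extrinsicInfo_one (hSNR : 0 < SNR) (hne : ∀ k, (C k).Nonempty)
    (hC : CapacityAchieving SNR n C) {γ : ℝ} (hγ : SNR < γ) :
    Tendsto (fun k => extrinsicInfo (C k) γ) atTop (𝓝 1) := by
  rw [tendsto_order]
  refine ⟨fun a ha => ?_, fun a ha => Eventually.of_forall fun k =>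
    (extrinsicInfo_le_one (hne k) γ).trans_lt ha⟩
  have hl := log_two_pos
  -- Half of the admissible loss goes to `δ`; the other error terms vanish in the limit.
  have hδ : 0 < (1 - a) * Real.log 2 / 2 := by
    have : 0 < 1 - a := by linarith
    positivity
  obtain ⟨K, -, hK⟩ := exists_binEntropy_le hδ
  set δ := (1 - a) * Real.log 2 / 2 with hδd
  have hlim : Tendsto (fun k => 1 - (avgSqExtMean (C k) 0 + δ + K * (1 - avgSqExtMean (C k) γ))
      / Real.log 2) atTop (𝓝 (1 - (0 + δ + K * (1 - 1)) / Real.log 2)) :=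
    tendsto_const_nhds.sub ((((tendsto_avgSqExtMean_zero hSNR hne hC le_rfl hSNR).add_const δ).add
      ((tendsto_const_nhds.sub (tendsto_avgSqExtMean_one hSNR hne hC hγ)).const_mul K)).div_const _)
  have hval : 1 - (0 + δ + K * (1 - 1)) / Real.log 2 = 1 - (1 - a) / 2 := by
    rw [hδd]; field_simp; ring
  rw [hval] at hlim
  filter_upwards [eventually_length_pos hSNR hC,
    hlim.eventually (lt_mem_nhds (a := a) (by linarith))] with k hk hlt
  exact hlt.trans_le (le_extrinsicInfo (hne k) hk γ hK)

/-! ### The EXIT curve -/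

theorem tendsto_exitCurve_zero (hSNR : 0 < SNR) (hne : ∀ k, (C k).Nonempty)
    (hC : CapacityAchieving SNR n C) {a : ℝ} (ha : a < biAwgnInfo SNR) :
    Tendsto (fun k => exitCurve (C k) a) atTop (𝓝 0) :=
  tendsto_extrinsicInfo_zero hSNR hne hC (snrOfInfo_nonneg a) (snrOfInfo_lt hSNR ha)

theorem tendsto_exitCurve_one (hSNR : 0 < SNR) (hne : ∀ k, (C k).Nonempty)
    (hC : CapacityAchieving SNR n C) {a : ℝ} (ha : biAwgnInfo SNR < a) (ha1 : a < 1) :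
    Tendsto (fun k => exitCurve (C k) a) atTop (𝓝 1) :=
  tendsto_extrinsicInfo_one hSNR hne hC (lt_snrOfInfo ha ha1)

theorem abs_exitCurve_le {n : ℕ} {C : Finset (Fin n → Bool)} (hne : C.Nonempty) (a : ℝ) :
    |exitCurve C a| ≤ 1 := by
  rw [exitCurve, abs_of_nonneg (extrinsicInfo_nonneg _ _)]
  exact extrinsicInfo_le_one hne _

/-- The extrinsic information is continuous in the SNR, and `snrOfInfo` is monotone below 1, so
their composition is measurable almost everywhere on the unit interval; it is also bounded by 1. -/
theorem intervalIntegrable_exitCurve {n : ℕ} {C : Finset (Fin n → Bool)} (hne : C.Nonempty) :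
    IntervalIntegrable (exitCurve C) volume 0 1 := by
  rw [intervalIntegrable_iff_integrableOn_Ioo_of_le zero_le_one]
  have hm : AEMeasurable snrOfInfo (volume.restrict (Set.Ioo (0 : ℝ) 1)) :=
    aemeasurable_restrict_of_monotoneOn measurableSet_Ioo
      (monotoneOn_snrOfInfo.mono fun _ h => h.2)
  exact (integrable_const (1 : ℝ)).mono'
    ((continuous_extrinsicInfo hne).measurable.comp_aemeasurable hm).aestronglyMeasurable
    (ae_of_all _ fun a => abs_exitCurve_le hne a)

theorem tendsto_integral_exitCurve (hSNR : 0 < SNR) (hne : ∀ k, (C k).Nonempty)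
    (hC : CapacityAchieving SNR n C) :
    Tendsto (fun k => ∫ a in (0 : ℝ)..1, exitCurve (C k) a) atTop (𝓝 (1 - biAwgnInfo SNR)) := by
  set R := biAwgnInfo SNR with hR
  have hR0 : 0 < R := biAwgnInfo_pos hSNR
  have hR1 : R ≤ 1 := biAwgnInfo_le_one SNR
  have hval : ∫ a in (0 : ℝ)..1, (Set.Ioc R 1).indicator (fun _ => (1 : ℝ)) a = 1 - R := by
    rw [intervalIntegral.integral_of_le zero_le_one, setIntegral_indicator measurableSet_Ioc,
      Set.inter_eq_right.2 (Set.Ioc_subset_Ioc_left hR0.le), setIntegral_const]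
    simp [hR1]
  rw [← hval]
  refine intervalIntegral.tendsto_integral_filter_of_dominated_convergence (fun _ => (1 : ℝ))
    (Eventually.of_forall fun k => ?_)
    (Eventually.of_forall fun k => ae_of_all _ fun a _ => abs_exitCurve_le (hne k) a)
    intervalIntegrable_const ?_
  · exact (intervalIntegrable_exitCurve (hne k)).def'.aestronglyMeasurable
  -- The jump `R` and the endpoint 1, where the limit of the curve is not known, form a null set.
  · have hnull : ∀ x : ℝ, ∀ᵐ a ∂(volume : Measure ℝ), a ≠ x := fun x => by
      rw [ae_iff]; simp
    filter_upwards [hnull R, hnull 1] with a haR ha1 ha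
    rw [Set.uIoc_of_le zero_le_one] at ha
    rcases lt_or_gt_of_ne haR with h | h
    · rw [Set.indicator_of_notMem fun hm => absurd hm.1 h.le.not_gt]
      exact tendsto_exitCurve_zero hSNR hne hC h
    · rw [Set.indicator_of_mem (show a ∈ Set.Ioc R 1 from ⟨h, ha.2⟩)]
      exact tendsto_exitCurve_one hSNR hne hC h (lt_of_le_of_ne ha.2 ha1)

end Limits

theorem mainTheorem7 (SNR : ℝ) (hSNR : 0 < SNR) (n : ℕ → ℕ)
    (C : (k : ℕ) → Finset (Fin (n k) → Bool)) (hne : ∀ k, (C k).Nonempty)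
    (hC : BinaryCode.CapacityAchieving SNR n C) :
    -- the bits are equiprobable
    Tendsto (fun k => (∑ i : Fin (n k),
        |(BinaryCode.law (C k)).real {ω | BinaryCode.bit i ω = true} - 1 / 2|) / (n k : ℝ))
      atTop (𝓝 0) ∧
    -- below the threshold the extrinsic LLRs are zero and carry no information
    (∀ γ : ℝ, 0 ≤ γ → γ < SNR →
      (∀ ε : ℝ, 0 < ε → Tendsto (fun k => (∑ i : Fin (n k),
          (BinaryCode.law (C k)).real
            {ω | BinaryCode.extrinsicLLR (C k) γ i ω ∉ Set.Icc (((-ε : ℝ) : EReal)) (ε : EReal)})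
          / (n k : ℝ)) atTop (𝓝 0)) ∧
      Tendsto (fun k => BinaryCode.extrinsicInfo (C k) γ) atTop (𝓝 0)) ∧
    -- above the threshold they are infinite, with the sign of the bit, and carry one bit
    (∀ γ : ℝ, SNR < γ →
      (∀ M : ℝ, Tendsto (fun k => (∑ i : Fin (n k),
          (BinaryCode.law (C k)).real
            {ω | (bpsk (BinaryCode.bit i ω) : EReal) * BinaryCode.extrinsicLLR (C k) γ i ω
              ≤ (M : EReal)})
          / (n k : ℝ)) atTop (𝓝 0)) ∧
      Tendsto (fun k => BinaryCode.extrinsicInfo (C k) γ) atTop (𝓝 1)) ∧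
    -- the EXIT curve is flat, jumps at the channel information, and has area one minus the rate
    (∀ a : ℝ, 0 ≤ a → a < biAwgnInfo SNR →
      Tendsto (fun k => BinaryCode.exitCurve (C k) a) atTop (𝓝 0)) ∧
    (∀ a : ℝ, biAwgnInfo SNR < a → a < 1 →
      Tendsto (fun k => BinaryCode.exitCurve (C k) a) atTop (𝓝 1)) ∧
    (∀ k, IntervalIntegrable (BinaryCode.exitCurve (C k)) volume 0 1) ∧
    Tendsto (fun k => ∫ a in (0 : ℝ)..1, BinaryCode.exitCurve (C k) a) atTop
      (𝓝 (1 - biAwgnInfo SNR)) :=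
  ⟨tendsto_avg_abs_bit_sub_half hSNR hne hC,
    fun _ h0 h1 => ⟨fun _ hε => tendsto_avg_extrinsicLLR_notMem hSNR hne hC h0 h1 hε,
      tendsto_extrinsicInfo_zero hSNR hne hC h0 h1⟩,
    fun _ h => ⟨fun M => tendsto_avg_bpsk_mul_extrinsicLLR_le hSNR hne hC h M,
      tendsto_extrinsicInfo_one hSNR hne hC h⟩,
    fun _ _ h => tendsto_exitCurve_zero hSNR hne hC h,
    fun _ h h1 => tendsto_exitCurve_one hSNR hne hC h h1,
    fun k => intervalIntegrable_exitCurve (hne k),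
    tendsto_integral_exitCurve hSNR hne hC⟩
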